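/- Let $k=\mathbb{F}_q$ be a finite field of odd characteristic and let $Q$ be a quiver with finite sets of nodes $Q_0$ and arrows $Q_1$. Let $\sigma$ be an involution of $Q$: a pair of involutions of $Q_0$ and $Q_1$ such that an arrow $\alpha\colon i\to j$ is sent to an arrow $\sigma(\alpha)\colon\sigma(j)\to\sigma(i)$, and every arrow $i\to\sigma(i)$ is fixed. Let $(s,\tau)$ be a duality structure: functions $s\colon Q_0\to\{\pm1\}$, $\tau\colon Q_1\to\{\pm1\}$ with $s_{\sigma(i)}=s_i$ and $\tau_\alpha\tau_{\sigma(\alpha)}=s_is_j$ for $\alpha\colon i\to j$. A self-dual representation is a finite dimensional representation $M$ of $Q$ over $k$ with a nondegenerate bilinear form $\langle\cdot,\cdot\rangle$ on $\bigoplus_i M_i$ such that $M_i\perp M_j$ unless $i=\sigma(j)$, the form is $s_i$-symmetric on $M_i+M_{\sigma(i)}$, and $\langle m_\alpha x,x'\rangle=\tau_\alpha\langle x,m_{\sigma(\alpha)}x'\rangle$ for $\alpha\colon i\to j$, $x\in M_i$, $x'\in M_{\sigma(j)}$. Isometries ($\simeq_S$) are isomorphisms preserving the forms, and $Aut_S(M)$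 is the group of self-isometries. A subrepresentation $U\subset M$ is isotropic if $U\subset U^\perp$; then $M/\!/U=U^\perp/U$ is self-dual with the induced form. For $d,d'\in\mathbb{Z}Q_0$ put $\sigma(d)_i=d_{\sigma(i)}$, $H(d)=d+\sigma(d)$, $$\chi(d,d')=\sum_{i\in Q_0}d_id'_i-\sum_{\alpha\colon i\to j}d_id'_j,\qquad \langle d,d'\rangle=\chi(d,d')-\chi(d',d),$$ $$\mathcal{E}(d)=\sum_{i\in Q_0^\sigma}\frac{d_i(d_i-s_i)}2+\sum_{i\in Q_0^+}d_{\sigma(i)}d_i-\sum_{(\alpha\colon\sigma(i)\to i)\in Q_1^\sigma}\frac{d_i(d_i+\tau_\alpha s_i)}2-\sum_{(\alpha\colon i\to j)\in Q_1^+}d_{\sigma(i)}d_j,$$ where $Q_\bullet^\sigma$ is the set of $\sigma$-fixed nodes (arrows) and $Q_\bullet^+$ contains one element of each two-element $\sigma$-orbit. Let $\hat{\mathbb{T}}_Q$ be the algebra of formal series in $x_d$, $d\in\mathbb{Z}_{\ge0}Q_0$, over $\mathbb{Q}(q^{1/2})$, with $x_d\cdot x_{d'}=q^{\frac12\langle d,d'\rangle}x_{d+d'}$,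 and let $\hat{\mathbb{S}}_Q$ be the $\hat{\mathbb{T}}_Q$-module of formal series in $\xi_e$, $e\in(\mathbb{Z}_{\ge0}Q_0)^\sigma$, with $$x_d\star\xi_e=q^{\frac12\left(\langle d,e\rangle+\mathcal{E}(\sigma(d))-\mathcal{E}(d)\right)}\,\xi_{H(d)+e}.$$ Let $\mathcal{H}_Q$ be the Hall algebra: the $\mathbb{Q}$-vector space on isomorphism classes $[U]$ of representations, with $[U]\cdot[V]=\sum_X\#\{\tilde U\subset X\mid\tilde U\simeq U,\ X/\tilde U\simeq V\}\,[X]$. Let $\mathcal{M}_Q$ be the Hall module: the $\mathbb{Q}$-vector space on isometry classes $[M]$ of self-dual representations, with the $\mathcal{H}_Q$-action $$[U]\star[M]=\sum_N\#\{\tilde U\subset N\mid\tilde U\simeq U,\ \tilde U\text{ isotropic},\ N/\!/\tilde U\simeq_SM\}\,[N].$$ Let $\int_{\mathcal{H}}\colon\mathcal{H}_Q\to\hat{\mathbb{T}}_Q$ and $\int_{\mathcal{M}}\colon\mathcal{M}_Q\to\hat{\mathbb{S}}_Q$ be the $\mathbb{Q}$-linear maps $$\int_{\mathcal{H}}[U]=\frac{q^{\frac12\chi(\mathbf{dim}\,U,\mathbf{dim}\,U)}}{\#Aut(U)}\,x_{\mathbf{dim}\,U},\qquad\int_{\mathcal{M}}[M]=\frac{q^{\frac12\mathcal{E}(\mathbf{dim}\,M)}}{\#Aut_S(M)}\,\xi_{\mathbf{dim}\,M}.$$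 Then $\int_{\mathcal{M}}$ is an $\int_{\mathcal{H}}$-morphism, that is, for all $a\in\mathcal{H}_Q$ and $m\in\mathcal{M}_Q$, $$\int_{\mathcal{M}}(a\star m)=\Big(\int_{\mathcal{H}}a\Big)\star\Big(\int_{\mathcal{M}}m\Big).$$ -/

import Mathlib

open Module

universe u v w

namespace SelfDualQuiver

/-! ### Representations of a quiver -/

/-- A finite dimensional representation of the quiver `Q` over the field `k`. -/
structure QuiverRep (k : Type u) [Field k] (Q : Type v) [Quiver.{w} Q] where
  V : Q → Type u
  [addCommGroup : ∀ i, AddCommGroup (V i)]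
  [module : ∀ i, Module k (V i)]
  [finite : ∀ i, Module.Finite k (V i)]
  map : ∀ {i j : Q}, (i ⟶ j) → (V i →ₗ[k] V j)

attribute [instance] QuiverRep.addCommGroup QuiverRep.module QuiverRep.finite

namespace QuiverRep

variable {k : Type u} [Field k] {Q : Type v} [Quiver.{w} Q]

/-- The dimension vector of a representation. -/
noncomputable def dim (X : QuiverRep k Q) : Q → ℕ := fun i => finrank k (X.V i)

/-- An isomorphism of representations. -/
@[ext]
structure Iso (X Y : QuiverRep k Q) where
  equiv : ∀ i, X.V i ≃ₗ[k] Y.V i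
  comm : ∀ {i j : Q} (a : i ⟶ j) (x : X.V i), equiv j (X.map a x) = Y.map a (equiv i x)

namespace Iso

def refl (X : QuiverRep k Q) : Iso X X := ⟨fun _ => LinearEquiv.refl k _, fun _ _ => rfl⟩

def symm {X Y : QuiverRep k Q} (e : Iso X Y) : Iso Y X :=
  ⟨fun i => (e.equiv i).symm, fun {i j} a y => by
    rw [LinearEquiv.symm_apply_eq, e.comm, LinearEquiv.apply_symm_apply]⟩

def trans {X Y Z : QuiverRep k Q} (e : Iso X Y) (f : Iso Y Z) : Iso X Z :=
  ⟨fun i => (e.equiv i).trans (f.equiv i), fun {i j} a x => by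
    simp only [LinearEquiv.trans_apply, e.comm, f.comm]⟩

theorem dim_eq {X Y : QuiverRep k Q} (e : Iso X Y) : X.dim = Y.dim :=
  funext fun i => (e.equiv i).finrank_eq

/-- Conjugation by an isomorphism identifies the automorphism groups. -/
def conj {X Y : QuiverRep k Q} (e : Iso X Y) : Iso X X ≃ Iso Y Y where
  toFun f := (e.symm.trans f).trans e
  invFun f := (e.trans f).trans e.symm
  left_inv f := by ext i x; simp [trans, symm]
  right_inv f := by ext i x; simp [trans, symm]

end Iso

/-- The number of automorphisms of a representation. -/
noncomputable def cardAut (X : QuiverRep k Q) : ℕ := Nat.card (Iso X X)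

variable (k Q) in
/-- Isomorphism of representations as an equivalence relation. -/
instance isoSetoid : Setoid (QuiverRep k Q) where
  r X Y := Nonempty (Iso X Y)
  iseqv := ⟨fun X => ⟨Iso.refl X⟩, fun ⟨e⟩ => ⟨e.symm⟩, fun ⟨e⟩ ⟨f⟩ => ⟨e.trans f⟩⟩

/-- A subrepresentation. -/
@[ext]
structure Sub (X : QuiverRep k Q) where
  carrier : ∀ i, Submodule k (X.V i)
  map_mem : ∀ {i j : Q} (a : i ⟶ j) (x : X.V i), x ∈ carrier i → X.map a x ∈ carrier j

/-- A subrepresentation, regarded as a representation. -/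
def Sub.toRep {X : QuiverRep k Q} (U : X.Sub) : QuiverRep k Q where
  V i := U.carrier i
  map a := (X.map a).restrict (U.map_mem a)

/-- The quotient of a representation by a subrepresentation. -/
def Sub.quot {X : QuiverRep k Q} (U : X.Sub) : QuiverRep k Q where
  V i := X.V i ⧸ U.carrier i
  map {i j} a := (U.carrier i).mapQ (U.carrier j) (X.map a) (U.map_mem a)

/-- The intersection of a subrepresentation `U` with a subrepresentation `W`, as a
subrepresentation of `W`. -/
def Sub.inside {X : QuiverRep k Q} (U W : X.Sub) : W.toRep.Sub where
  carrier i := (U.carrier i).comap (W.carrier i).subtype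
  map_mem a x hx := U.map_mem a x.1 hx

end QuiverRep

/-! ### Involutions, duality structures and self-dual representations -/

/-- A (contravariant) involution of a quiver. -/
structure Involution (Q : Type v) [Quiver.{w} Q] where
  node : Q → Q
  arrow : Quiver.Total Q → Quiver.Total Q
  node_node : ∀ i, node (node i) = i
  arrow_arrow : ∀ a, arrow (arrow a) = a
  left_arrow : ∀ a, (arrow a).left = node a.right
  right_arrow : ∀ a, (arrow a).right = node a.left
  arrow_eq_self : ∀ a : Quiver.Total Q, a.right = node a.left → arrow a = a

/-- A duality structure on a quiver with involution. -/
structure Duality {Q : Type v} [Quiver.{w} Q] (σ : Involution Q) where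
  s : Q → ℤˣ
  τ : Quiver.Total Q → ℤˣ
  s_node : ∀ i, s (σ.node i) = s i
  τ_mul : ∀ a, τ a * τ (σ.arrow a) = s a.left * s a.right

/-- A self-dual representation: a representation `M` with a nondegenerate bilinear form on
`⨁ i, M i`.  The form is given by its blocks `form i j : M i × M j → k`. -/
structure SDRep (k : Type u) [Field k] {Q : Type v} [Quiver.{w} Q] {σ : Involution Q}
    (D : Duality σ) extends QuiverRep k Q where
  form : ∀ i j, V i →ₗ[k] V j →ₗ[k] k
  form_orth : ∀ i j, i ≠ σ.node j → form i j = 0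
  form_symm : ∀ i j x y, form i j x y = ((D.s i : ℤ) : k) * form j i y x
  form_nondeg : ∀ i x, (∀ j y, form i j x y = 0) → x = 0
  form_map : ∀ (a : Quiver.Total Q) (x : V a.left) (y : V (σ.arrow a).left),
    form a.right (σ.arrow a).left (map a.hom x) y =
      ((D.τ a : ℤ) : k) * form a.left (σ.arrow a).right x (map (σ.arrow a).hom y)

namespace SDRep

variable {k : Type u} [Field k] {Q : Type v} [Quiver.{w} Q] {σ : Involution Q} {D : Duality σ}

/-- An isometry of self-dual representations. -/
@[ext]
structure Isometry (M N : SDRep k D) extends QuiverRep.Iso M.toQuiverRep N.toQuiverRep where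
  form_eq : ∀ i j x y, N.form i j (equiv i x) (equiv j y) = M.form i j x y

namespace Isometry

def refl (M : SDRep k D) : Isometry M M := ⟨QuiverRep.Iso.refl _, fun _ _ _ _ => rfl⟩

def symm {M N : SDRep k D} (e : Isometry M N) : Isometry N M :=
  ⟨e.toIso.symm, fun i j x y => by
    rw [← e.form_eq]; simp [QuiverRep.Iso.symm]⟩

def trans {M N P : SDRep k D} (e : Isometry M N) (f : Isometry N P) : Isometry M P :=
  ⟨e.toIso.trans f.toIso, fun i j x y => by
    rw [← e.form_eq, ← f.form_eq]; simp [QuiverRep.Iso.trans]⟩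

/-- Conjugation by an isometry identifies the groups of self-isometries. -/
def conj {M N : SDRep k D} (e : Isometry M N) : Isometry M M ≃ Isometry N N where
  toFun f := (e.symm.trans f).trans e
  invFun f := (e.trans f).trans e.symm
  left_inv f := by
    ext i x; simp [trans, symm, QuiverRep.Iso.symm, QuiverRep.Iso.trans]
  right_inv f := by
    ext i x; simp [trans, symm, QuiverRep.Iso.symm, QuiverRep.Iso.trans]

end Isometry

/-- The number of self-isometries of a self-dual representation. -/
noncomputable def cardAut (M : SDRep k D) : ℕ := Nat.card (Isometry M M)

variable (k D) in
/-- Isometry of self-dual representations as an equivalence relation. -/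
instance isometrySetoid : Setoid (SDRep k D) where
  r M N := Nonempty (Isometry M N)
  iseqv := ⟨fun X => ⟨Isometry.refl X⟩, fun ⟨e⟩ => ⟨e.symm⟩, fun ⟨e⟩ ⟨f⟩ => ⟨e.trans f⟩⟩

theorem form_symm_zero (M : SDRep k D) {i j : Q} {x : M.V i} {y : M.V j}
    (h : M.form i j x y = 0) : M.form j i y x = 0 := by
  rw [M.form_symm, h, mul_zero]

/-- The map `M i → (M (σ i))ᵛ` induced by the form is injective. -/
theorem form_injective (M : SDRep k D) (i : Q) :
    Function.Injective (M.form i (σ.node i)) := by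
  rw [← LinearMap.ker_eq_bot, LinearMap.ker_eq_bot']
  intro x hx
  refine M.form_nondeg i x fun j y => ?_
  by_cases h : i = σ.node j
  · have : j = σ.node i := by rw [h, σ.node_node]
    subst this
    rw [hx]; rfl
  · rw [M.form_orth i j h]; rfl

theorem dim_le (M : SDRep k D) (i : Q) : M.dim i ≤ M.dim (σ.node i) := by
  have := LinearMap.finrank_le_finrank_of_injective (M.form_injective i)
  rwa [Subspace.dual_finrank_eq] at this

/-- The dimension vector of a self-dual representation is `σ`-invariant. -/
theorem dim_node (M : SDRep k D) (i : Q) : M.dim (σ.node i) = M.dim i := by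
  refine le_antisymm ?_ (M.dim_le i)
  have := M.dim_le (σ.node i)
  rwa [σ.node_node] at this

/-- The orthogonal of a subrepresentation. -/
def perp (M : SDRep k D) (U : M.Sub) : M.Sub where
  carrier i :=
    { carrier := {x | ∀ j, ∀ y ∈ U.carrier j, M.form i j x y = 0}
      add_mem' := fun {x x'} hx hx' j y hy => by
        rw [map_add, LinearMap.add_apply, hx j y hy, hx' j y hy, add_zero]
      zero_mem' := fun j y _ => by simp
      smul_mem' := fun c x hx j y hy => by
        rw [map_smul, LinearMap.smul_apply, hx j y hy, smul_zero] }
  map_mem {i j} a x hx l y hy := by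
    by_cases h : j = σ.node l
    · have hl : l = (σ.arrow ⟨i, j, a⟩).left := by rw [σ.left_arrow]; exact (by rw [h, σ.node_node] : l = σ.node j)
      subst hl
      rw [M.form_map ⟨i, j, a⟩ x y, hx _ _ (U.map_mem _ y hy), mul_zero]
    · rw [M.form_orth j l h]; rfl

/-- A subrepresentation `U` is isotropic if it is contained in its orthogonal. -/
def IsIsotropic (M : SDRep k D) (U : M.Sub) : Prop :=
  ∀ i, U.carrier i ≤ (M.perp U).carrier i

theorem mem_perp (M : SDRep k D) (U : M.Sub) (i : Q) (x : M.V i) :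
    x ∈ (M.perp U).carrier i ↔ ∀ j, ∀ y ∈ U.carrier j, M.form i j x y = 0 := Iff.rfl

theorem perp_carrier (M : SDRep k D) (U : M.Sub) (i : Q) :
    (M.perp U).carrier i =
      (U.carrier (σ.node i)).dualAnnihilator.comap (M.form i (σ.node i)) := by
  ext x
  rw [mem_perp, Submodule.mem_comap, Submodule.mem_dualAnnihilator]
  refine ⟨fun h y hy => h _ y hy, fun h j y hy => ?_⟩
  by_cases hj : i = σ.node j
  · have : j = σ.node i := by rw [hj, σ.node_node]
    subst this
    exact h y hy
  · rw [M.form_orth i j hj]; rfl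

theorem finrank_perp (M : SDRep k D) (U : M.Sub) (i : Q) :
    finrank k (U.carrier (σ.node i)) + finrank k ((M.perp U).carrier i) = M.dim i := by
  have hdim : finrank k (M.V i) = finrank k (Dual k (M.V (σ.node i))) := by
    rw [Subspace.dual_finrank_eq]; exact (M.dim_node i).symm
  let e : M.V i ≃ₗ[k] Dual k (M.V (σ.node i)) :=
    LinearEquiv.ofInjectiveOfFinrankEq (M.form i (σ.node i)) (M.form_injective i) hdim
  have he : (M.perp U).carrier i = (U.carrier (σ.node i)).dualAnnihilator.comap e.toLinearMap := by
    rw [perp_carrier]; rfl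
  have h2 : finrank k ((M.perp U).carrier i) =
      finrank k (U.carrier (σ.node i)).dualAnnihilator := by
    rw [he]
    exact (LinearEquiv.ofSubmodule' e _).finrank_eq
  rw [h2, Subspace.finrank_add_finrank_dualAnnihilator_eq]
  exact M.dim_node i

theorem perp_perp (M : SDRep k D) (U : M.Sub) : M.perp (M.perp U) = U := by
  ext1
  funext i
  symm
  refine Submodule.eq_of_le_of_finrank_eq ?_ ?_
  · intro x hx j y hy
    exact M.form_symm_zero (hy i x hx)
  · have h1 := M.finrank_perp (M.perp U) i
    have h2 := M.finrank_perp U (σ.node i)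
    rw [σ.node_node, M.dim_node] at h2
    omega

/-- The bilinear form on `U^⊥ / U` induced by the form of `M`. -/
def reduceForm (M : SDRep k D) (U : M.Sub) (i j : Q) :
    (U.inside (M.perp U)).quot.V i →ₗ[k] (U.inside (M.perp U)).quot.V j →ₗ[k] k :=
  Submodule.liftQ _
    (LinearMap.flip (Submodule.liftQ _
      ((M.form i j).domRestrict₁₂ ((M.perp U).carrier i) ((M.perp U).carrier j)).flip
      (fun y hy => by
        refine LinearMap.mem_ker.2 (LinearMap.ext fun x => ?_)
        exact x.2 j y.1 hy)))
    (fun x hx => by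
      refine LinearMap.mem_ker.2 (LinearMap.ext fun y => ?_)
      obtain ⟨y, rfl⟩ := Submodule.mkQ_surjective _ y
      exact M.form_symm_zero (y.2 i x.1 hx))

/-- The projection `U^⊥ → U^⊥ / U`. -/
def reduceMk (M : SDRep k D) (U : M.Sub) (i : Q) :
    (M.perp U).toRep.V i →ₗ[k] (U.inside (M.perp U)).quot.V i :=
  ((U.inside (M.perp U)).carrier i).mkQ

theorem reduceMk_surjective (M : SDRep k D) (U : M.Sub) (i : Q) :
    Function.Surjective (M.reduceMk U i) := Submodule.mkQ_surjective _

theorem reduceMk_eq_zero (M : SDRep k D) (U : M.Sub) (i : Q) (x : (M.perp U).toRep.V i) :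
    M.reduceMk U i x = 0 ↔ x.1 ∈ U.carrier i :=
  Submodule.Quotient.mk_eq_zero ((U.inside (M.perp U)).carrier i)

theorem reduceForm_mk (M : SDRep k D) (U : M.Sub) (i j : Q) (x : (M.perp U).toRep.V i)
    (y : (M.perp U).toRep.V j) :
    M.reduceForm U i j (M.reduceMk U i x) (M.reduceMk U j y) = M.form i j x.1 y.1 := rfl

/-- The self-dual representation `M // U = U^⊥ / U` attached to an isotropic
subrepresentation `U` of `M`. -/
def reduce (M : SDRep k D) (U : M.Sub) (_hU : M.IsIsotropic U) : SDRep k D where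
  toQuiverRep := (U.inside (M.perp U)).quot
  form := M.reduceForm U
  form_orth i j h := by
    refine LinearMap.ext fun x => LinearMap.ext fun y => ?_
    obtain ⟨x, rfl⟩ := M.reduceMk_surjective U i x
    obtain ⟨y, rfl⟩ := M.reduceMk_surjective U j y
    rw [reduceForm_mk, M.form_orth i j h]; rfl
  form_symm i j x y := by
    obtain ⟨x, rfl⟩ := M.reduceMk_surjective U i x
    obtain ⟨y, rfl⟩ := M.reduceMk_surjective U j y
    exact M.form_symm i j x.1 y.1
  form_nondeg i x h := by
    obtain ⟨x, rfl⟩ := M.reduceMk_surjective U i x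
    rw [M.reduceMk_eq_zero]
    refine (congrArg (fun W => x.1 ∈ W.carrier i) (M.perp_perp U)).mp fun j y hy => ?_
    exact h j (M.reduceMk U j ⟨y, hy⟩)
  form_map a x y := by
    obtain ⟨x, rfl⟩ := M.reduceMk_surjective U _ x
    obtain ⟨y, rfl⟩ := M.reduceMk_surjective U _ y
    exact M.form_map a x.1 y.1

end SDRep

/-! ### Euler forms -/

section Euler

variable {Q : Type v} [Quiver.{w} Q] [Fintype Q] [Fintype (Quiver.Total Q)]

/-- The Euler form `χ` on `ℤ^Q`. -/
def euler (d e : Q → ℤ) : ℤ :=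
  ∑ i, d i * e i - ∑ a : Quiver.Total Q, d a.left * e a.right

/-- The skew-symmetrized Euler form `⟨d, e⟩ = χ(d, e) - χ(e, d)`. -/
def skew (d e : Q → ℤ) : ℤ := euler d e - euler e d

open Classical in
/-- The function `ℰ` on `ℤ^Q` attached to a duality structure.  The sums over a set of
representatives of the two-element `σ`-orbits of nodes and of arrows are written as one half of
the sums over all nodes and all arrows that are not fixed by `σ`; all divisions are exact. -/
noncomputable def sdEuler {σ : Involution Q} (D : Duality σ) (d : Q → ℤ) : ℤ :=
  ∑ i with σ.node i = i, d i * (d i - D.s i) / 2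
    + (∑ i with σ.node i ≠ i, d (σ.node i) * d i) / 2
    - ∑ a : Quiver.Total Q with σ.arrow a = a, d a.right * (d a.right + D.τ a * D.s a.right) / 2
    - (∑ a : Quiver.Total Q with σ.arrow a ≠ a, d (σ.node a.left) * d a.right) / 2

/-- A dimension vector, regarded as an element of `ℤ^Q`. -/
def toInt (d : Q → ℕ) : Q → ℤ := fun i => d i

end Euler

section Arith

variable {Q : Type v} [Quiver.{w} Q] [Fintype Q] [Fintype (Quiver.Total Q)]

theorem euler_add_left (a b c : Q → ℤ) : euler (a + b) c = euler a c + euler b c := by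
  simp only [euler, Pi.add_apply, add_mul, Finset.sum_add_distrib]; ring

theorem euler_add_right (a b c : Q → ℤ) : euler a (b + c) = euler a b + euler a c := by
  simp only [euler, Pi.add_apply, mul_add, Finset.sum_add_distrib]; ring

theorem euler_zero_left (a : Q → ℤ) : euler 0 a = 0 := by simp [euler]

theorem euler_zero_right (a : Q → ℤ) : euler a 0 = 0 := by simp [euler]

theorem euler_node (σ : Involution Q) (a b : Q → ℤ) :
    euler (fun i => a (σ.node i)) (fun i => b (σ.node i)) = euler b a := by
  let en : Q ≃ Q := ⟨σ.node, σ.node, σ.node_node, σ.node_node⟩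
  let ea : Quiver.Total Q ≃ Quiver.Total Q := ⟨σ.arrow, σ.arrow, σ.arrow_arrow, σ.arrow_arrow⟩
  unfold euler
  congr 1
  · exact Fintype.sum_equiv en _ _ fun i => mul_comm _ _
  · refine Fintype.sum_equiv ea _ _ fun e => ?_
    show _ = b (σ.arrow e).left * a (σ.arrow e).right
    rw [σ.left_arrow, σ.right_arrow, mul_comm]

theorem skew_node (σ : Involution Q) (a b : Q → ℤ) :
    skew (fun i => a (σ.node i)) (fun i => b (σ.node i)) = - skew a b := by
  unfold skew; rw [euler_node, euler_node]; ring

theorem half_add {a b : ℤ} (x : ℤ) (h : a = b + 2 * x) : a / 2 = b / 2 + x := by omega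

/-- The defect of additivity of `ℰ` is given by the Euler form. -/
theorem sdEuler_add {σ : Involution Q} (D : Duality σ) (a b : Q → ℤ) :
    sdEuler D (a + b) = sdEuler D a + sdEuler D b + euler (fun i => a (σ.node i)) b := by
  classical
  have hu : ∀ u : ℤˣ, (u : ℤ) = 1 ∨ (u : ℤ) = -1 := fun u => by
    rcases Int.units_eq_one_or u with h | h <;> simp [h]
  have hpar : ∀ (x : ℤ) (u : ℤˣ), (x * (x + u)) % 2 = 0 := fun x u => by
    rcases hu u with h | h <;> rw [h] <;> rcases Int.emod_two_eq_zero_or_one x with hx | hx <;>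
      simp [Int.mul_emod, Int.add_emod, hx]
  have key : ∀ (x y : ℤ) (u : ℤˣ), (x + y) * (x + y + u) / 2 =
      x * (x + u) / 2 + y * (y + u) / 2 + x * y := fun x y u => by
    have h1 := hpar x u
    have h2 := hpar y u
    have h3 : (x + y) * (x + y + u) = x * (x + u) + y * (y + u) + 2 * (x * y) := by ring
    omega
  have hN : ∑ i with σ.node i = i, (a + b) i * ((a + b) i - D.s i) / 2 =
      ∑ i with σ.node i = i, a i * (a i - D.s i) / 2 +
      ∑ i with σ.node i = i, b i * (b i - D.s i) / 2 +
      ∑ i with σ.node i = i, a (σ.node i) * b i := by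
    rw [← Finset.sum_add_distrib, ← Finset.sum_add_distrib]
    refine Finset.sum_congr rfl fun i hi => ?_
    have := key (a i) (b i) (-D.s i)
    rw [(Finset.mem_filter.1 hi).2]
    simpa [sub_eq_add_neg] using this
  have hA : ∑ e : Quiver.Total Q with σ.arrow e = e,
        (a + b) e.right * ((a + b) e.right + D.τ e * D.s e.right) / 2 =
      ∑ e : Quiver.Total Q with σ.arrow e = e, a e.right * (a e.right + D.τ e * D.s e.right) / 2 +
      ∑ e : Quiver.Total Q with σ.arrow e = e, b e.right * (b e.right + D.τ e * D.s e.right) / 2 +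
      ∑ e : Quiver.Total Q with σ.arrow e = e, a (σ.node e.left) * b e.right := by
    rw [← Finset.sum_add_distrib, ← Finset.sum_add_distrib]
    refine Finset.sum_congr rfl fun e he => ?_
    have := key (a e.right) (b e.right) (D.τ e * D.s e.right)
    rw [← σ.right_arrow, (Finset.mem_filter.1 he).2]
    simpa using this
  -- the pairing over the non-fixed nodes is symmetric
  have sN : ∀ x y : Q → ℤ, ∑ i with σ.node i ≠ i, x (σ.node i) * y i =
      ∑ i with σ.node i ≠ i, y (σ.node i) * x i := fun x y => by
    refine Finset.sum_bij' (fun i _ => σ.node i) (fun i _ => σ.node i) ?_ ?_ ?_ ?_ ?_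
    · intro i hi
      simp only [Finset.mem_filter, Finset.mem_univ, true_and, σ.node_node] at hi ⊢
      exact hi.symm
    · intro i hi
      simp only [Finset.mem_filter, Finset.mem_univ, true_and, σ.node_node] at hi ⊢
      exact hi.symm
    · intro i _; exact σ.node_node i
    · intro i _; exact σ.node_node i
    · intro i _; rw [σ.node_node, mul_comm]
  have sA : ∀ x y : Q → ℤ,
      ∑ e : Quiver.Total Q with σ.arrow e ≠ e, x (σ.node e.left) * y e.right =
      ∑ e : Quiver.Total Q with σ.arrow e ≠ e, y (σ.node e.left) * x e.right := fun x y => by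
    refine Finset.sum_bij' (fun i _ => σ.arrow i) (fun i _ => σ.arrow i) ?_ ?_ ?_ ?_ ?_
    · intro i hi
      simp only [Finset.mem_filter, Finset.mem_univ, true_and, σ.arrow_arrow] at hi ⊢
      exact Ne.symm hi
    · intro i hi
      simp only [Finset.mem_filter, Finset.mem_univ, true_and, σ.arrow_arrow] at hi ⊢
      exact Ne.symm hi
    · intro i _; exact σ.arrow_arrow i
    · intro i _; exact σ.arrow_arrow i
    · intro i _; rw [σ.left_arrow, σ.right_arrow, σ.node_node, mul_comm]
  -- the diagonal values are even
  have eN : ∀ x : Q → ℤ, (∑ i with σ.node i ≠ i, x (σ.node i) * x i) % 2 = 0 := fun x => by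
    have h := Finset.sum_involution (s := Finset.univ.filter fun i => σ.node i ≠ i)
      (f := fun i => ((x (σ.node i) * x i : ℤ) : ZMod 2)) (fun i _ => σ.node i)
      (fun i _ => by
        rw [σ.node_node, mul_comm (x i), ← two_mul]
        rw [show (2 : ZMod 2) = 0 from rfl, zero_mul])
      (fun i hi _ => (Finset.mem_filter.1 hi).2)
      (fun i hi => by
        simp only [Finset.mem_filter, Finset.mem_univ, true_and, σ.node_node] at hi ⊢
        exact hi.symm)
      (fun i _ => σ.node_node i)
    rw [← Int.cast_sum, ZMod.intCast_zmod_eq_zero_iff_dvd] at h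
    exact Int.emod_eq_zero_of_dvd h
  have eA : ∀ x : Q → ℤ,
      (∑ e : Quiver.Total Q with σ.arrow e ≠ e, x (σ.node e.left) * x e.right) % 2 = 0 := fun x => by
    have h := Finset.sum_involution
      (s := Finset.univ.filter fun e : Quiver.Total Q => σ.arrow e ≠ e)
      (f := fun e => ((x (σ.node e.left) * x e.right : ℤ) : ZMod 2)) (fun i _ => σ.arrow i)
      (fun i _ => by
        rw [σ.left_arrow, σ.right_arrow, σ.node_node, mul_comm (x i.right), ← two_mul]
        rw [show (2 : ZMod 2) = 0 from rfl, zero_mul])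
      (fun i hi _ => (Finset.mem_filter.1 hi).2)
      (fun i hi => by
        simp only [Finset.mem_filter, Finset.mem_univ, true_and, σ.arrow_arrow] at hi ⊢
        exact Ne.symm hi)
      (fun i _ => σ.arrow_arrow i)
    rw [← Int.cast_sum, ZMod.intCast_zmod_eq_zero_iff_dvd] at h
    exact Int.emod_eq_zero_of_dvd h
  have hN' : (∑ i with σ.node i ≠ i, (a + b) (σ.node i) * (a + b) i) / 2 =
      (∑ i with σ.node i ≠ i, a (σ.node i) * a i) / 2 +
      (∑ i with σ.node i ≠ i, b (σ.node i) * b i) / 2 +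
      ∑ i with σ.node i ≠ i, a (σ.node i) * b i := by
    have h : ∑ i with σ.node i ≠ i, (a + b) (σ.node i) * (a + b) i =
        ∑ i with σ.node i ≠ i, a (σ.node i) * a i + ∑ i with σ.node i ≠ i, b (σ.node i) * b i +
        (∑ i with σ.node i ≠ i, a (σ.node i) * b i +
          ∑ i with σ.node i ≠ i, b (σ.node i) * a i) := by
      simp only [← Finset.sum_add_distrib, Pi.add_apply]
      exact Finset.sum_congr rfl fun i _ => by ring
    rw [sN b a] at h
    have h1 := eN a
    have h2 := eN b
    omega
  have hA' : (∑ e : Quiver.Total Q with σ.arrow e ≠ e, (a + b) (σ.node e.left) * (a + b) e.right) / 2 =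
      (∑ e : Quiver.Total Q with σ.arrow e ≠ e, a (σ.node e.left) * a e.right) / 2 +
      (∑ e : Quiver.Total Q with σ.arrow e ≠ e, b (σ.node e.left) * b e.right) / 2 +
      ∑ e : Quiver.Total Q with σ.arrow e ≠ e, a (σ.node e.left) * b e.right := by
    have h : ∑ e : Quiver.Total Q with σ.arrow e ≠ e, (a + b) (σ.node e.left) * (a + b) e.right =
        ∑ e : Quiver.Total Q with σ.arrow e ≠ e, a (σ.node e.left) * a e.right +
        ∑ e : Quiver.Total Q with σ.arrow e ≠ e, b (σ.node e.left) * b e.right +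
        (∑ e : Quiver.Total Q with σ.arrow e ≠ e, a (σ.node e.left) * b e.right +
          ∑ e : Quiver.Total Q with σ.arrow e ≠ e, b (σ.node e.left) * a e.right) := by
      simp only [← Finset.sum_add_distrib, Pi.add_apply]
      exact Finset.sum_congr rfl fun i _ => by ring
    rw [sA b a] at h
    have h1 := eA a
    have h2 := eA b
    omega
  have tN := Finset.sum_filter_add_sum_filter_not Finset.univ (fun i => σ.node i = i)
    (fun i => a (σ.node i) * b i)
  have tA := Finset.sum_filter_add_sum_filter_not Finset.univ
    (fun e : Quiver.Total Q => σ.arrow e = e) (fun e => a (σ.node e.left) * b e.right)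
  unfold sdEuler euler
  rw [hN, hA, hN', hA', ← tN, ← tA]
  ring

end Arith

/-! ### The quantum torus and its module -/

section Torus

set_option linter.unusedSectionVars false

/-- The field `ℚ(q^{1/2})`, as a subfield of `ℝ`. -/
abbrev HalfField (q : ℕ) : Type := IntermediateField.adjoin ℚ {Real.sqrt (q : ℝ)}

/-- The element `q^{1/2}` of `ℚ(q^{1/2})`. -/
noncomputable def sqrtq (q : ℕ) : HalfField q :=
  ⟨Real.sqrt (q : ℝ), IntermediateField.mem_adjoin_simple_self ℚ _⟩

theorem sqrtq_ne_zero {q : ℕ} (hq : q ≠ 0) : sqrtq q ≠ 0 := by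
  intro h
  have h' : Real.sqrt (q : ℝ) = 0 := congrArg Subtype.val h
  rw [Real.sqrt_eq_zero (Nat.cast_nonneg q)] at h'
  exact hq (by exact_mod_cast h')

theorem card_ne_zero (k : Type u) [Field k] [Finite k] : Nat.card k ≠ 0 :=
  Nat.card_pos.ne'

/-- The quantum torus: formal series `∑ f d • x_d` over the dimension vectors `d`, with
coefficients in `ℚ(q^{1/2})`, where `q` is the number of elements of `k`. -/
def QTorus (k : Type u) (Q : Type v) : Type v := (Q → ℕ) → HalfField (Nat.card k)

/-- The monoid of `σ`-invariant dimension vectors. -/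
@[ext]
structure SymDim {Q : Type v} [Quiver.{w} Q] (σ : Involution Q) : Type v where
  val : Q → ℕ
  val_node : ∀ i, val (σ.node i) = val i

/-- The module over the quantum torus: formal series `∑ g e • ξ_e` over the `σ`-invariant
dimension vectors `e`. -/
def QModule (k : Type u) {Q : Type v} [Quiver.{w} Q] {σ : Involution Q} (_D : Duality σ) : Type v :=
  SymDim σ → HalfField (Nat.card k)

variable {k : Type u} {Q : Type v} [Quiver.{w} Q] {σ : Involution Q} {D : Duality σ}

noncomputable instance : AddCommGroup (QTorus k Q) :=
  inferInstanceAs (AddCommGroup ((Q → ℕ) → HalfField (Nat.card k)))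

noncomputable instance : Module (HalfField (Nat.card k)) (QTorus k Q) :=
  inferInstanceAs (Module (HalfField (Nat.card k)) ((Q → ℕ) → HalfField (Nat.card k)))

noncomputable instance : AddCommGroup (QModule k D) :=
  inferInstanceAs (AddCommGroup (SymDim σ → HalfField (Nat.card k)))

noncomputable instance : Module (HalfField (Nat.card k)) (QModule k D) :=
  inferInstanceAs (Module (HalfField (Nat.card k)) (SymDim σ → HalfField (Nat.card k)))

noncomputable instance : Module ℚ (QTorus k Q) :=
  Module.compHom _ (algebraMap ℚ (HalfField (Nat.card k)))

noncomputable instance : Module ℚ (QModule k D) :=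
  Module.compHom _ (algebraMap ℚ (HalfField (Nat.card k)))

open Classical in
/-- The topological basis element `x_d` of the quantum torus. -/
noncomputable def QTorus.x (d : Q → ℕ) : QTorus k Q := fun n => if n = d then 1 else 0

open Classical in
/-- The topological basis element `ξ_e` of the module over the quantum torus. -/
noncomputable def QModule.ξ (e : SymDim σ) : QModule k D := fun n => if n = e then 1 else 0

theorem QTorus.x_self (d : Q → ℕ) : (QTorus.x d : QTorus k Q) d = 1 := if_pos rfl

theorem QTorus.x_ne {d n : Q → ℕ} (h : n ≠ d) : (QTorus.x d : QTorus k Q) n = 0 := if_neg h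

theorem QModule.ξ_self (e : SymDim σ) : (QModule.ξ e : QModule k D) e = 1 := if_pos rfl

theorem QModule.ξ_ne {e n : SymDim σ} (h : n ≠ e) : (QModule.ξ e : QModule k D) n = 0 := if_neg h

/-- The `σ`-invariant dimension vector `H d = d + σ d`. -/
def SymDim.hyp (σ : Involution Q) (d : Q → ℕ) : SymDim σ :=
  ⟨fun i => d i + d (σ.node i), fun i => by simp only [σ.node_node]; exact add_comm _ _⟩

instance : Add (SymDim σ) :=
  ⟨fun e f => ⟨fun i => e.1 i + f.1 i, fun i => by simp only [e.2, f.2]⟩⟩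

/-- The difference of two `σ`-invariant dimension vectors (only used when `e ≤ n`). -/
def SymDim.sub (n e : SymDim σ) : SymDim σ :=
  ⟨fun i => n.1 i - e.1 i, fun i => by simp only [n.2, e.2]⟩

variable [Fintype Q] [DecidableEq Q] [Fintype (Quiver.Total Q)]

/-- The multiplication of the quantum torus,
`x_d * x_{d'} = q^{⟨d, d'⟩ / 2} x_{d + d'}`, extended to formal series. -/
noncomputable instance : Mul (QTorus k Q) :=
  ⟨fun f g n => ∑ d ∈ Finset.Iic n,
    sqrtq (Nat.card k) ^ skew (toInt d) (toInt (n - d)) * f d * g (n - d)⟩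

noncomputable instance : One (QTorus k Q) := ⟨QTorus.x 0⟩

/-- The exponent `⟨d, e⟩ + ℰ(σ d) - ℰ(d)`. -/
noncomputable def actExp (D : Duality σ) (d : Q → ℕ) (e : SymDim σ) : ℤ :=
  skew (toInt d) (toInt e.1) + sdEuler D (toInt fun i => d (σ.node i)) - sdEuler D (toInt d)

/-- The action of the quantum torus on its module,
`x_d • ξ_e = q^{(⟨d, e⟩ + ℰ(σ d) - ℰ(d)) / 2} ξ_{H d + e}`, extended to formal series. -/
noncomputable instance : SMul (QTorus k Q) (QModule k D) :=
  ⟨fun f g n => ∑ d ∈ Finset.Iic n.1 with ∀ i, (SymDim.hyp σ d).1 i ≤ n.1 i,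
    sqrtq (Nat.card k) ^ actExp D d (n.sub (SymDim.hyp σ d)) * f d * g (n.sub (SymDim.hyp σ d))⟩

theorem QTorus.mul_apply (f g : QTorus k Q) (n : Q → ℕ) : (f * g) n = ∑ d ∈ Finset.Iic n,
    sqrtq (Nat.card k) ^ skew (toInt d) (toInt (n - d)) * f d * g (n - d) := rfl

theorem QModule.smul_apply (f : QTorus k Q) (g : QModule k D) (n : SymDim σ) :
    (f • g) n = ∑ d ∈ Finset.Iic n.1 with ∀ i, (SymDim.hyp σ d).1 i ≤ n.1 i,
      sqrtq (Nat.card k) ^ actExp D d (n.sub (SymDim.hyp σ d)) * f d *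
        g (n.sub (SymDim.hyp σ d)) := rfl

theorem toInt_add (d e : Q → ℕ) : toInt (d + e) = toInt d + toInt e := by
  funext i; simp [toInt]

theorem toInt_zero : toInt (0 : Q → ℕ) = 0 := by funext i; simp [toInt]

theorem skew_add_left (a b c : Q → ℤ) : skew (a + b) c = skew a c + skew b c := by
  simp only [skew, euler_add_left, euler_add_right]; ring

theorem skew_add_right (a b c : Q → ℤ) : skew a (b + c) = skew a b + skew a c := by
  simp only [skew, euler_add_left, euler_add_right]; ring

theorem skew_zero_left (a : Q → ℤ) : skew 0 a = 0 := by
  simp [skew, euler_zero_left, euler_zero_right]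

theorem skew_zero_right (a : Q → ℤ) : skew a 0 = 0 := by
  simp [skew, euler_zero_left, euler_zero_right]

theorem QTorus.mul_assoc' [Field k] [Finite k] (f g h : QTorus k Q) :
    f * g * h = f * (g * h) := by
  have hr := sqrtq_ne_zero (card_ne_zero k)
  funext n
  simp only [QTorus.mul_apply, Finset.mul_sum, Finset.sum_mul]
  rw [Finset.sum_sigma', Finset.sum_sigma']
  refine Finset.sum_bij' (fun p _ => ⟨p.2, p.1 - p.2⟩) (fun p _ => ⟨p.1 + p.2, p.1⟩)
    ?_ ?_ ?_ ?_ ?_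
  · rintro ⟨c, a⟩ h
    simp only [Finset.mem_sigma, Finset.mem_Iic] at h ⊢
    exact ⟨h.2.trans h.1, fun i => Nat.sub_le_sub_right (h.1 i) _⟩
  · rintro ⟨a, b⟩ h
    simp only [Finset.mem_sigma, Finset.mem_Iic] at h ⊢
    refine ⟨fun i => ?_, fun i => by simp⟩
    have h1 : a i ≤ n i := h.1 i
    have h2 : b i ≤ n i - a i := h.2 i
    show a i + b i ≤ n i
    omega
  · rintro ⟨c, a⟩ h
    simp only [Finset.mem_sigma, Finset.mem_Iic] at h ⊢
    congr 1
    exact add_tsub_cancel_of_le h.2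
  · rintro ⟨a, b⟩ h
    simp
  · rintro ⟨c, a⟩ hm
    simp only [Finset.mem_sigma, Finset.mem_Iic] at hm
    obtain ⟨b, rfl⟩ := exists_add_of_le hm.2
    obtain ⟨d, rfl⟩ := exists_add_of_le hm.1
    have e1 : a + b + d - (a + b) = d := by simp
    have e2 : a + b - a = b := by simp
    have e3 : a + b + d - a = b + d := by rw [add_assoc]; simp
    have e4 : b + d - b = d := by simp
    simp only [e1, e2, e3, e4]
    have : sqrtq (Nat.card k) ^ skew (toInt (a + b)) (toInt d) *
        sqrtq (Nat.card k) ^ skew (toInt a) (toInt b) =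
        sqrtq (Nat.card k) ^ skew (toInt a) (toInt (b + d)) *
        sqrtq (Nat.card k) ^ skew (toInt b) (toInt d) := by
      rw [← zpow_add₀ hr, ← zpow_add₀ hr]
      congr 1
      simp only [toInt_add, skew_add_left, skew_add_right]; ring
    linear_combination (f a * g b * h d) * this

noncomputable instance [Field k] [Finite k] : Ring (QTorus k Q) where
  __ := (inferInstance : AddCommGroup (QTorus k Q))
  mul_assoc := QTorus.mul_assoc'
  one_mul f := by
    funext n
    rw [QTorus.mul_apply, Finset.sum_eq_single 0]
    · show _ * (QTorus.x 0 : QTorus k Q) 0 * _ = _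
      simp [toInt_zero, skew_zero_left, QTorus.x_self]
    · intro b _ hb
      show _ * (QTorus.x 0 : QTorus k Q) b * _ = _
      simp [QTorus.x_ne hb]
    · intro h; simp at h
  mul_one f := by
    funext n
    rw [QTorus.mul_apply, Finset.sum_eq_single n]
    · show _ * _ * (QTorus.x 0 : QTorus k Q) (n - n) = _
      simp [toInt_zero, skew_zero_right, QTorus.x_self]
    · intro b hb hne
      show _ * _ * (QTorus.x 0 : QTorus k Q) (n - b) = _
      rw [QTorus.x_ne, mul_zero]
      rw [ne_eq, tsub_eq_zero_iff_le]
      exact fun h => hne (le_antisymm (Finset.mem_Iic.1 hb) h)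
    · intro h; simp at h
  zero_mul f := by
    funext n
    exact Finset.sum_eq_zero fun d _ => by
      show _ * (0 : HalfField (Nat.card k)) * _ = 0
      simp
  mul_zero f := by
    funext n
    exact Finset.sum_eq_zero fun d _ => by
      show _ * (0 : HalfField (Nat.card k)) = 0
      simp
  left_distrib f g h := by
    funext n
    show _ = (f * g) n + (f * h) n
    simp only [QTorus.mul_apply]
    rw [← Finset.sum_add_distrib]
    exact Finset.sum_congr rfl fun d _ => mul_add _ _ _
  right_distrib f g h := by
    funext n
    show _ = (f * h) n + (g * h) n
    simp only [QTorus.mul_apply]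
    rw [← Finset.sum_add_distrib]
    refine Finset.sum_congr rfl fun d _ => ?_
    show _ * (f d + g d) * _ = _
    ring

noncomputable instance [Field k] [Finite k] : Algebra (HalfField (Nat.card k)) (QTorus k Q) :=
  Algebra.ofModule
    (fun c f g => by
      funext n
      show _ = c * (f * g) n
      simp only [QTorus.mul_apply, Finset.mul_sum]
      refine Finset.sum_congr rfl fun d _ => ?_
      show _ * (c * f d) * _ = _
      ring)
    (fun c f g => by
      funext n
      show _ = c * (f * g) n
      simp only [QTorus.mul_apply, Finset.mul_sum]
      refine Finset.sum_congr rfl fun d _ => ?_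
      show _ * _ * (c * g _) = _
      ring)

theorem sdEuler_zero : sdEuler D (0 : Q → ℤ) = 0 := by simp [sdEuler]

theorem hyp_add_apply (a b : Q → ℕ) (i : Q) :
    (SymDim.hyp σ (a + b)).1 i = (SymDim.hyp σ a).1 i + (SymDim.hyp σ b).1 i := by
  simp only [SymDim.hyp, Pi.add_apply]; omega

theorem toInt_hyp (b : Q → ℕ) :
    toInt (SymDim.hyp σ b).1 = toInt b + toInt (fun i => b (σ.node i)) := by
  funext i; simp [toInt, SymDim.hyp]

/-- The cocycle identity behind the associativity of the action. -/
theorem actExp_add (a b : Q → ℕ) (e e' : SymDim σ)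
    (he : toInt e'.1 = toInt (SymDim.hyp σ b).1 + toInt e.1) :
    actExp D (a + b) e + skew (toInt a) (toInt b) = actExp D a e' + actExp D b e := by
  have hs : toInt (fun i => (a + b) (σ.node i)) =
      toInt (fun i => a (σ.node i)) + toInt (fun i => b (σ.node i)) := by
    funext i; simp [toInt]
  have h1 := sdEuler_add D (toInt a) (toInt b)
  have h2 := sdEuler_add D (toInt fun i => a (σ.node i)) (toInt fun i => b (σ.node i))
  have h3 : (fun i => toInt (fun i => a (σ.node i)) (σ.node i)) = toInt a := by
    funext i; simp [toInt, σ.node_node]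
  have h4 := euler_node σ (toInt a) (toInt fun i => b (σ.node i))
  have h5 : (fun i => toInt (fun i => b (σ.node i)) (σ.node i)) = toInt b := by
    funext i; simp [toInt, σ.node_node]
  rw [h3] at h2
  rw [h5] at h4
  simp only [actExp, he, toInt_hyp, hs, toInt_add, skew_add_left, skew_add_right, h1, h2, h4]
  simp only [skew]
  ring

theorem mem_hyp_iff (n : SymDim σ) (d : Q → ℕ) :
    d ∈ (Finset.Iic n.1).filter (fun d => ∀ i, (SymDim.hyp σ d).1 i ≤ n.1 i) ↔
      ∀ i, (SymDim.hyp σ d).1 i ≤ n.1 i := by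
  rw [Finset.mem_filter, Finset.mem_Iic]
  exact ⟨fun h => h.2, fun h => ⟨fun i => (Nat.le_add_right _ _).trans (h i), h⟩⟩

theorem QModule.mul_smul' [Field k] [Finite k] (f g : QTorus k Q) (h : QModule k D) :
    (f * g) • h = f • (g • h) := by
  have hr := sqrtq_ne_zero (card_ne_zero k)
  funext n
  simp only [QModule.smul_apply, QTorus.mul_apply, Finset.mul_sum, Finset.sum_mul]
  rw [Finset.sum_sigma', Finset.sum_sigma']
  refine Finset.sum_bij' (fun p _ => ⟨p.2, p.1 - p.2⟩) (fun p _ => ⟨p.1 + p.2, p.1⟩)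
    ?_ ?_ ?_ ?_ ?_
  · rintro ⟨c, a⟩ h
    simp only [Finset.mem_sigma, mem_hyp_iff, Finset.mem_Iic] at h ⊢
    obtain ⟨b, rfl⟩ := exists_add_of_le h.2
    have h1 : ∀ i, _ := h.1
    simp only [hyp_add_apply] at h1
    rw [add_tsub_cancel_left]
    exact ⟨fun i => by have := h1 i; omega,
      fun i => by have := h1 i; simp only [SymDim.sub]; omega⟩
  · rintro ⟨a, b⟩ h
    simp only [Finset.mem_sigma, mem_hyp_iff, Finset.mem_Iic, hyp_add_apply] at h ⊢
    refine ⟨fun i => ?_, fun i => by simp⟩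
    have h1 := h.1 i
    have h2 := h.2 i
    simp only [SymDim.sub] at h2
    omega
  · rintro ⟨c, a⟩ h
    simp only [Finset.mem_sigma, Finset.mem_Iic] at h ⊢
    congr 1
    exact add_tsub_cancel_of_le h.2
  · rintro ⟨a, b⟩ h
    simp
  · rintro ⟨c, a⟩ hm
    simp only [Finset.mem_sigma, mem_hyp_iff, Finset.mem_Iic] at hm
    obtain ⟨b, rfl⟩ := exists_add_of_le hm.2
    have h1 : ∀ i, _ := hm.1
    simp only [hyp_add_apply] at h1
    have e2 : a + b - a = b := by simp
    have e1 : n.sub (SymDim.hyp σ (a + b)) = (n.sub (SymDim.hyp σ a)).sub (SymDim.hyp σ b) := by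
      refine SymDim.ext (funext fun i => ?_)
      simp only [SymDim.sub, hyp_add_apply]
      omega
    have key := actExp_add (D := D) a b (n.sub (SymDim.hyp σ (a + b))) (n.sub (SymDim.hyp σ a))
      (by
        funext i
        have := h1 i
        simp only [toInt, Pi.add_apply, SymDim.sub, hyp_add_apply]
        omega)
    simp only [e2]
    rw [← e1]
    have : sqrtq (Nat.card k) ^ actExp D (a + b) (n.sub (SymDim.hyp σ (a + b))) *
        sqrtq (Nat.card k) ^ skew (toInt a) (toInt b) =
        sqrtq (Nat.card k) ^ actExp D a (n.sub (SymDim.hyp σ a)) *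
        sqrtq (Nat.card k) ^ actExp D b (n.sub (SymDim.hyp σ (a + b))) := by
      rw [← zpow_add₀ hr, ← zpow_add₀ hr, key]
    linear_combination (f a * g b * h (n.sub (SymDim.hyp σ (a + b)))) * this

noncomputable instance [Field k] [Finite k] : Module (QTorus k Q) (QModule k D) where
  mul_smul := QModule.mul_smul'
  one_smul g := by
    funext n
    have h0 : n.sub (SymDim.hyp σ 0) = n :=
      SymDim.ext (funext fun i => by simp [SymDim.sub, SymDim.hyp])
    rw [QModule.smul_apply, Finset.sum_eq_single 0]
    · show _ * (QTorus.x 0 : QTorus k Q) 0 * _ = _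
      have h1 : actExp D (0 : Q → ℕ) n = 0 := by
        have h2 : toInt (fun i => (0 : Q → ℕ) (σ.node i)) = 0 := by funext i; simp [toInt]
        rw [actExp, h2, toInt_zero, skew_zero_left, sdEuler_zero]; rfl
      rw [h0, h1, QTorus.x_self]; simp
    · intro b _ hb
      show _ * (QTorus.x 0 : QTorus k Q) b * _ = _
      simp [QTorus.x_ne hb]
    · intro h
      exact absurd ((mem_hyp_iff n 0).2 fun i => by simp [SymDim.hyp]) h
  smul_zero f := by
    funext n
    exact Finset.sum_eq_zero fun d _ => by
      show _ * (0 : HalfField (Nat.card k)) = 0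
      simp
  zero_smul g := by
    funext n
    exact Finset.sum_eq_zero fun d _ => by
      show _ * (0 : HalfField (Nat.card k)) * _ = 0
      simp
  smul_add f g h := by
    funext n
    show _ = (f • g) n + (f • h) n
    simp only [QModule.smul_apply]
    rw [← Finset.sum_add_distrib]
    exact Finset.sum_congr rfl fun d _ => mul_add _ _ _
  add_smul f g h := by
    funext n
    show _ = (f • h) n + (g • h) n
    simp only [QModule.smul_apply]
    rw [← Finset.sum_add_distrib]
    refine Finset.sum_congr rfl fun d _ => ?_
    show _ * (f d + g d) * _ = _
    ring

/-- The multiplication on the topological basis. -/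
theorem QTorus.x_mul_x (d e : Q → ℕ) : (QTorus.x d * QTorus.x e : QTorus k Q) =
    sqrtq (Nat.card k) ^ skew (toInt d) (toInt e) • QTorus.x (d + e) := by
  funext n
  rw [QTorus.mul_apply]
  show _ = _ * (QTorus.x (d + e) : QTorus k Q) n
  by_cases h : n = d + e
  · subst h
    rw [Finset.sum_eq_single d]
    · simp [QTorus.x_self]
    · intro b _ hb; simp [QTorus.x_ne hb]
    · intro h; simp at h
  · rw [QTorus.x_ne h, mul_zero]
    refine Finset.sum_eq_zero fun c hc => ?_
    by_cases h1 : c = d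
    · subst h1
      rw [QTorus.x_ne (d := e), mul_zero]
      rintro rfl
      exact h (add_tsub_cancel_of_le (Finset.mem_Iic.1 hc)).symm
    · simp [QTorus.x_ne h1]

/-- The action on the topological bases. -/
theorem QModule.x_smul_ξ (d : Q → ℕ) (e : SymDim σ) :
    ((QTorus.x d : QTorus k Q) • (QModule.ξ e : QModule k D)) =
      sqrtq (Nat.card k) ^ actExp D d e • (QModule.ξ (SymDim.hyp σ d + e) : QModule k D) := by
  funext n
  rw [QModule.smul_apply]
  show _ = _ * (QModule.ξ (SymDim.hyp σ d + e) : QModule k D) n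
  by_cases h : n = SymDim.hyp σ d + e
  · have hs : n.sub (SymDim.hyp σ d) = e := by
      rw [h]; exact SymDim.ext (funext fun i => Nat.add_sub_cancel_left _ _)
    rw [Finset.sum_eq_single d]
    · rw [hs, h]; simp [QTorus.x_self, QModule.ξ_self]
    · intro b _ hb; simp [QTorus.x_ne hb]
    · intro h'
      refine absurd ((mem_hyp_iff n d).2 fun i => ?_) h'
      rw [h]; exact Nat.le_add_right _ _
  · rw [QModule.ξ_ne h, mul_zero]
    refine Finset.sum_eq_zero fun c hc => ?_
    by_cases h1 : c = d
    · subst h1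
      rw [QModule.ξ_ne, mul_zero]
      rintro rfl
      refine h (SymDim.ext (funext fun i => ?_))
      exact (Nat.add_sub_cancel' ((mem_hyp_iff n c).1 hc i)).symm
    · simp [QTorus.x_ne h1]

end Torus

/-! ### The Hall algebra -/

section Hall

set_option linter.unusedSectionVars false

variable {k : Type u} [Field k] {Q : Type v} [Quiver.{w} Q]

/-- Two quotients of the same representation with the same kernels are isomorphic. -/
theorem QuiverRep.exists_iso {R X Y : QuiverRep k Q} (f : ∀ i, R.V i →ₗ[k] X.V i)
    (g : ∀ i, R.V i →ₗ[k] Y.V i) (hf : ∀ i, Function.Surjective (f i))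
    (hg : ∀ i, Function.Surjective (g i)) (hker : ∀ i r, f i r = 0 ↔ g i r = 0)
    (hfc : ∀ {i j : Q} (a : i ⟶ j) r, f j (R.map a r) = X.map a (f i r))
    (hgc : ∀ {i j : Q} (a : i ⟶ j) r, g j (R.map a r) = Y.map a (g i r)) :
    ∃ e : QuiverRep.Iso X Y, ∀ i r, e.equiv i (f i r) = g i r := by
  have hk : ∀ i, LinearMap.ker (f i) = LinearMap.ker (g i) := fun i => by
    ext r; simp only [LinearMap.mem_ker]; exact hker i r
  let e : ∀ i, X.V i ≃ₗ[k] Y.V i := fun i =>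
    ((f i).quotKerEquivOfSurjective (hf i)).symm.trans
      ((Submodule.quotEquivOfEq _ _ (hk i)).trans ((g i).quotKerEquivOfSurjective (hg i)))
  have he : ∀ i r, e i (f i r) = g i r := fun i r => by
    simp only [e, LinearEquiv.trans_apply, LinearMap.quotKerEquivOfSurjective_symm_apply,
      Submodule.quotEquivOfEq_mk, LinearMap.quotKerEquivOfSurjective_apply_mk]
  refine ⟨⟨e, fun {i j} a x => ?_⟩, he⟩
  obtain ⟨r, rfl⟩ := hf i x
  rw [← hfc, he, he, hgc]

variable (k Q) in
/-- Isomorphism classes of representations. -/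
abbrev RepClass : Type _ := Quotient (QuiverRep.isoSetoid k Q)

/-- The isomorphism class of a representation. -/
abbrev RepClass.mk (X : QuiverRep k Q) : RepClass k Q := Quotient.mk _ X

theorem RepClass.mk_eq {X Y : QuiverRep k Q} :
    RepClass.mk X = RepClass.mk Y ↔ Nonempty (QuiverRep.Iso X Y) := Quotient.eq

/-- The dimension vector of an isomorphism class. -/
noncomputable def RepClass.dim : RepClass k Q → Q → ℕ :=
  Quotient.lift QuiverRep.dim fun _ _ ⟨e⟩ => e.dim_eq

/-- The order of the automorphism group of an isomorphism class. -/
noncomputable def RepClass.cardAut : RepClass k Q → ℕ :=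
  Quotient.lift QuiverRep.cardAut fun _ _ ⟨e⟩ => Nat.card_congr e.conj

/-- The inverse image of a subrepresentation under an isomorphism. -/
def QuiverRep.Sub.comap {X Y : QuiverRep k Q} (e : QuiverRep.Iso X Y) (W : Y.Sub) : X.Sub where
  carrier i := (W.carrier i).comap (e.equiv i).toLinearMap
  map_mem {i j} a x hx := by
    show e.equiv j (X.map a x) ∈ W.carrier j
    rw [e.comm]; exact W.map_mem a _ hx

/-- Inverse image under an isomorphism, as a bijection of subrepresentations. -/
def QuiverRep.Sub.comapEquiv {X Y : QuiverRep k Q} (e : QuiverRep.Iso X Y) : Y.Sub ≃ X.Sub where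
  toFun := QuiverRep.Sub.comap e
  invFun := QuiverRep.Sub.comap e.symm
  left_inv W := by
    ext i x
    show e.equiv i ((e.equiv i).symm x) ∈ W.carrier i ↔ _
    rw [LinearEquiv.apply_symm_apply]
  right_inv W := by
    ext i x
    show (e.equiv i).symm (e.equiv i x) ∈ W.carrier i ↔ _
    rw [LinearEquiv.symm_apply_apply]

theorem QuiverRep.Sub.toRep_comap {X Y : QuiverRep k Q} (e : QuiverRep.Iso X Y) (W : Y.Sub) :
    RepClass.mk (W.comap e).toRep = RepClass.mk W.toRep := by
  rw [RepClass.mk_eq]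
  obtain ⟨f, -⟩ := QuiverRep.exists_iso (R := (W.comap e).toRep) (X := (W.comap e).toRep)
    (Y := W.toRep) (fun i => LinearMap.id)
    (fun i => (e.equiv i).toLinearMap.restrict (fun x hx => hx))
    (fun i x => ⟨x, rfl⟩)
    (fun i y => ⟨⟨(e.equiv i).symm y.1, by
      show e.equiv i ((e.equiv i).symm y.1) ∈ W.carrier i
      rw [LinearEquiv.apply_symm_apply]; exact y.2⟩,
      Subtype.ext (LinearEquiv.apply_symm_apply _ _)⟩)
    (fun i r => by
      constructor
      · rintro rfl; exact map_zero _
      · intro h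
        exact Subtype.ext ((e.equiv i).map_eq_zero_iff.1 (congrArg Subtype.val h)))
    (fun a r => rfl)
    (fun a r => Subtype.ext (e.comm a r.1))
  exact ⟨f⟩

theorem QuiverRep.Sub.quot_comap {X Y : QuiverRep k Q} (e : QuiverRep.Iso X Y) (W : Y.Sub) :
    RepClass.mk (W.comap e).quot = RepClass.mk W.quot := by
  rw [RepClass.mk_eq]
  obtain ⟨f, -⟩ := QuiverRep.exists_iso (R := X) (X := (W.comap e).quot)
    (Y := W.quot) (fun i => ((W.comap e).carrier i).mkQ)
    (fun i => (W.carrier i).mkQ ∘ₗ (e.equiv i).toLinearMap)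
    (fun i => Submodule.mkQ_surjective _)
    (fun i => (Submodule.mkQ_surjective _).comp (e.equiv i).surjective)
    (fun i r => (Submodule.Quotient.mk_eq_zero _).trans
      (Submodule.Quotient.mk_eq_zero (W.carrier i)).symm)
    (fun a r => rfl)
    (fun {i j} a r => congrArg (W.carrier j).mkQ (e.comm a r))
  exact ⟨f⟩

/-- The Hall number `F^X_{u, v}`: the number of subrepresentations of `X` in the class `u`
whose quotient is in the class `v`. -/
noncomputable def QuiverRep.hallNumber (u v : RepClass k Q) (X : QuiverRep k Q) : ℕ :=
  Nat.card {W : X.Sub // RepClass.mk W.toRep = u ∧ RepClass.mk W.quot = v}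

/-- The Hall number of a triple of isomorphism classes. -/
noncomputable def RepClass.hallNumber (u v : RepClass k Q) : RepClass k Q → ℕ :=
  Quotient.lift (QuiverRep.hallNumber u v) fun X Y ⟨e⟩ => by
    refine Nat.card_congr ((QuiverRep.Sub.comapEquiv e.symm).subtypeEquiv fun W => ?_)
    show _ ↔ RepClass.mk (W.comap e.symm).toRep = u ∧ RepClass.mk (W.comap e.symm).quot = v
    rw [QuiverRep.Sub.toRep_comap, QuiverRep.Sub.quot_comap]

theorem RepClass.dim_of_hallNumber_ne_zero {u v x : RepClass k Q}
    (h : RepClass.hallNumber u v x ≠ 0) : x.dim = u.dim + v.dim := by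
  induction x using Quotient.inductionOn with
  | h X =>
    have h' : Nat.card {W : X.Sub // RepClass.mk W.toRep = u ∧ RepClass.mk W.quot = v} ≠ 0 := h
    obtain ⟨⟨W, rfl, rfl⟩⟩ := (Nat.card_ne_zero.1 h').1
    funext i
    have := (W.carrier i).finrank_quotient_add_finrank
    show finrank k (X.V i) = finrank k (W.carrier i) + finrank k (X.V i ⧸ W.carrier i)
    omega

theorem finite_linearMap [Finite k] (m n : ℕ) : Finite ((Fin m → k) →ₗ[k] (Fin n → k)) :=
  Finite.of_injective (fun f => (f : (Fin m → k) → (Fin n → k))) DFunLike.coe_injective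

/-- There are finitely many isomorphism classes of a given dimension vector. -/
theorem RepClass.finite_dim [Finite k] [Finite (Quiver.Total Q)] (d : Q → ℕ) :
    {x : RepClass k Q | x.dim = d}.Finite := by
  have hd : ∀ x : {x : RepClass k Q | x.dim = d}, ∀ i, finrank k (x.1.out.V i) = d i := by
    rintro ⟨x, hx⟩ i
    have h1 : x.out.dim = d := by
      rw [← hx]; conv_rhs => rw [← Quotient.out_eq x]
      rfl
    exact congrFun h1 i
  let b : ∀ x : {x : RepClass k Q | x.dim = d}, ∀ i, x.1.out.V i ≃ₗ[k] (Fin (d i) → k) :=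
    fun x i => LinearEquiv.ofFinrankEq _ _ (by rw [hd x i, finrank_fin_fun])
  let F : {x : RepClass k Q | x.dim = d} →
      (∀ a : Quiver.Total Q, (Fin (d a.left) → k) →ₗ[k] (Fin (d a.right) → k)) :=
    fun x a => (b x a.right).toLinearMap ∘ₗ x.1.out.map a.hom ∘ₗ (b x a.left).symm.toLinearMap
  have : ∀ a : Quiver.Total Q, Finite ((Fin (d a.left) → k) →ₗ[k] (Fin (d a.right) → k)) :=
    fun a => finite_linearMap _ _
  refine Set.finite_coe_iff.1 ?_
  refine Finite.of_injective F fun x y h => ?_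
  refine Subtype.ext ?_
  rw [← Quotient.out_eq x.1, ← Quotient.out_eq y.1]
  refine Quotient.sound ⟨⟨fun i => (b x i).trans (b y i).symm, fun {i j} a z => ?_⟩⟩
  have h1 := LinearMap.congr_fun (congrFun h ⟨i, j, a⟩) (b x i z)
  simp only [F, LinearMap.comp_apply, LinearEquiv.coe_coe, LinearEquiv.symm_apply_apply] at h1
  simp only [LinearEquiv.trans_apply, h1, LinearEquiv.symm_apply_apply]

variable (k Q) in
/-- The Hall algebra: the `ℚ`-vector space on the isomorphism classes of representations. -/
def HallAlgebra : Type _ := RepClass k Q →₀ ℚ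

noncomputable instance : AddCommGroup (HallAlgebra k Q) :=
  inferInstanceAs (AddCommGroup (RepClass k Q →₀ ℚ))

noncomputable instance : Module ℚ (HallAlgebra k Q) :=
  inferInstanceAs (Module ℚ (RepClass k Q →₀ ℚ))

/-- The basis element `[U]` of the Hall algebra. -/
noncomputable def HallAlgebra.of (u : RepClass k Q) : HallAlgebra k Q := Finsupp.single u 1

variable [Finite k] [Finite (Quiver.Total Q)]

/-- The product `[U] * [V] = ∑ F^X_{U, V} [X]`. -/
noncomputable def HallAlgebra.ofMul (u v : RepClass k Q) : HallAlgebra k Q :=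
  Finsupp.ofSupportFinite (fun x => (RepClass.hallNumber u v x : ℚ))
    ((RepClass.finite_dim (u.dim + v.dim)).subset fun x hx =>
      RepClass.dim_of_hallNumber_ne_zero fun h => hx (by
        show (RepClass.hallNumber u v x : ℚ) = 0
        rw [h, Nat.cast_zero]))

/-- The multiplication of the Hall algebra, as a bilinear map. -/
noncomputable def HallAlgebra.mulMap : HallAlgebra k Q →ₗ[ℚ] HallAlgebra k Q →ₗ[ℚ] HallAlgebra k Q :=
  Finsupp.linearCombination ℚ fun u => (Finsupp.linearCombination ℚ (HallAlgebra.ofMul u) :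
    HallAlgebra k Q →ₗ[ℚ] HallAlgebra k Q)

noncomputable instance : Mul (HallAlgebra k Q) := ⟨fun a b => HallAlgebra.mulMap a b⟩

end Hall

/-! ### The Hall module -/

section HallModule

set_option linter.unusedSectionVars false

variable {k : Type u} [Field k] {Q : Type v} [Quiver.{w} Q] {σ : Involution Q} {D : Duality σ}

/-- Two quotients of the same representation with the same kernels are isometric if their forms
agree. -/
theorem SDRep.exists_isometry {R : QuiverRep k Q} {X Y : SDRep k D} (f : ∀ i, R.V i →ₗ[k] X.V i)
    (g : ∀ i, R.V i →ₗ[k] Y.V i) (hf : ∀ i, Function.Surjective (f i))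
    (hg : ∀ i, Function.Surjective (g i)) (hker : ∀ i r, f i r = 0 ↔ g i r = 0)
    (hfc : ∀ {i j : Q} (a : i ⟶ j) r, f j (R.map a r) = X.map a (f i r))
    (hgc : ∀ {i j : Q} (a : i ⟶ j) r, g j (R.map a r) = Y.map a (g i r))
    (hform : ∀ i j r s, X.form i j (f i r) (f j s) = Y.form i j (g i r) (g j s)) :
    Nonempty (SDRep.Isometry X Y) := by
  obtain ⟨e, he⟩ := QuiverRep.exists_iso f g hf hg hker hfc hgc
  refine ⟨⟨e, fun i j x y => ?_⟩⟩
  obtain ⟨r, rfl⟩ := hf i x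
  obtain ⟨s, rfl⟩ := hf j y
  rw [he, he, hform]

variable (k D) in
/-- Isometry classes of self-dual representations. -/
abbrev SDClass : Type _ := Quotient (SDRep.isometrySetoid k D)

/-- The isometry class of a self-dual representation. -/
abbrev SDClass.mk (M : SDRep k D) : SDClass k D := Quotient.mk _ M

theorem SDClass.mk_eq {X Y : SDRep k D} :
    SDClass.mk X = SDClass.mk Y ↔ Nonempty (SDRep.Isometry X Y) := Quotient.eq

/-- The dimension vector of an isometry class. -/
noncomputable def SDClass.dim : SDClass k D → SymDim σ :=
  Quotient.lift (fun M => ⟨M.dim, M.dim_node⟩) fun _ _ ⟨e⟩ => SymDim.ext e.toIso.dim_eq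

/-- The order of the isometry group of an isometry class. -/
noncomputable def SDClass.cardAut : SDClass k D → ℕ :=
  Quotient.lift SDRep.cardAut fun _ _ ⟨e⟩ => Nat.card_congr e.conj

theorem SDRep.perp_comap {M N : SDRep k D} (e : SDRep.Isometry M N) (U : N.Sub) :
    M.perp (U.comap e.toIso) = (N.perp U).comap e.toIso := by
  ext i x
  show (∀ j, ∀ y, e.equiv j y ∈ U.carrier j → M.form i j x y = 0) ↔
    ∀ j, ∀ y ∈ U.carrier j, N.form i j (e.equiv i x) y = 0
  refine forall_congr' fun j => ⟨fun h y hy => ?_, fun h y hy => ?_⟩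
  · have := h ((e.equiv j).symm y) (by rwa [LinearEquiv.apply_symm_apply])
    rwa [← e.form_eq, LinearEquiv.apply_symm_apply] at this
  · rw [← e.form_eq]; exact h _ hy

theorem SDRep.isIsotropic_comap {M N : SDRep k D} (e : SDRep.Isometry M N) (U : N.Sub) :
    M.IsIsotropic (U.comap e.toIso) ↔ N.IsIsotropic U := by
  unfold SDRep.IsIsotropic
  rw [SDRep.perp_comap]
  refine forall_congr' fun i => ⟨fun h y hy => ?_, fun h x hx => h hx⟩
  obtain ⟨x, rfl⟩ := (e.equiv i).surjective y
  exact h hy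

theorem SDRep.mem_perp_comap {M N : SDRep k D} (e : SDRep.Isometry M N) (U : N.Sub) (i : Q)
    (x : M.V i) : x ∈ (M.perp (U.comap e.toIso)).carrier i ↔
      e.equiv i x ∈ (N.perp U).carrier i := by
  rw [SDRep.perp_comap]; rfl

theorem SDRep.reduce_comap {M N : SDRep k D} (e : SDRep.Isometry M N) (U : N.Sub)
    (h : M.IsIsotropic (U.comap e.toIso)) (h' : N.IsIsotropic U) :
    SDClass.mk (M.reduce (U.comap e.toIso) h) = SDClass.mk (N.reduce U h') := by
  rw [SDClass.mk_eq]
  let g : ∀ i, (M.perp (U.comap e.toIso)).toRep.V i →ₗ[k] (N.perp U).toRep.V i := fun i =>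
    (e.equiv i).toLinearMap.restrict fun x hx => (SDRep.mem_perp_comap e U i x).1 hx
  refine SDRep.exists_isometry (R := (M.perp (U.comap e.toIso)).toRep)
    (fun i => M.reduceMk _ i) (fun i => N.reduceMk U i ∘ₗ g i)
    (fun i => M.reduceMk_surjective _ i)
    (fun i => (N.reduceMk_surjective U i).comp fun y =>
      ⟨⟨(e.equiv i).symm y.1, (SDRep.mem_perp_comap e U i _).2 (by
        rw [LinearEquiv.apply_symm_apply]; exact y.2)⟩,
        Subtype.ext (LinearEquiv.apply_symm_apply _ _)⟩)
    (fun i r => (M.reduceMk_eq_zero _ i r).trans (N.reduceMk_eq_zero U i (g i r)).symm)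
    (fun a r => rfl)
    (fun {i j} a r => congrArg (N.reduceMk U j) (Subtype.ext (e.comm a r.1)))
    (fun i j r s => (e.form_eq i j r.1 s.1).symm)

/-- The self-dual Hall number `G^N_{u, m}`: the number of isotropic subrepresentations `U` of `N`
in the class `u` such that `N // U` is in the class `m`. -/
noncomputable def SDRep.hallNumber (u : RepClass k Q) (m : SDClass k D) (N : SDRep k D) : ℕ :=
  Nat.card {U : N.Sub // RepClass.mk U.toRep = u ∧
    ∃ h : N.IsIsotropic U, SDClass.mk (N.reduce U h) = m}

/-- The self-dual Hall number of a class `u` and of two isometry classes. -/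
noncomputable def SDClass.hallNumber (u : RepClass k Q) (m : SDClass k D) : SDClass k D → ℕ :=
  Quotient.lift (SDRep.hallNumber u m) fun M N ⟨e⟩ => by
    refine (Nat.card_congr ((QuiverRep.Sub.comapEquiv e.toIso).subtypeEquiv fun U => ?_)).symm
    show _ ↔ RepClass.mk (U.comap e.toIso).toRep = u ∧
      ∃ h : M.IsIsotropic (U.comap e.toIso), SDClass.mk (M.reduce (U.comap e.toIso) h) = m
    rw [QuiverRep.Sub.toRep_comap]
    refine and_congr_right fun _ => ⟨?_, ?_⟩
    · rintro ⟨h, rfl⟩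
      exact ⟨(SDRep.isIsotropic_comap e U).2 h, SDRep.reduce_comap e U _ h⟩
    · rintro ⟨h, rfl⟩
      exact ⟨(SDRep.isIsotropic_comap e U).1 h, (SDRep.reduce_comap e U h _).symm⟩

theorem SDClass.dim_of_hallNumber_ne_zero {u : RepClass k Q} {m n : SDClass k D}
    (h : SDClass.hallNumber u m n ≠ 0) : n.dim = SymDim.hyp σ u.dim + m.dim := by
  induction n using Quotient.inductionOn with
  | h N =>
    have h' : Nat.card {U : N.Sub // RepClass.mk U.toRep = u ∧
      ∃ h : N.IsIsotropic U, SDClass.mk (N.reduce U h) = m} ≠ 0 := h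
    obtain ⟨⟨U, rfl, hU, rfl⟩⟩ := (Nat.card_ne_zero.1 h').1
    refine SymDim.ext (funext fun i => ?_)
    show finrank k (N.V i) = finrank k (U.carrier i) + finrank k (U.carrier (σ.node i)) +
      finrank k (_ ⧸ (U.carrier i).comap ((N.perp U).carrier i).subtype)
    have h1 := N.finrank_perp U i
    have h2 := ((U.carrier i).comap ((N.perp U).carrier i).subtype).finrank_quotient_add_finrank
    have h3 := (Submodule.comapSubtypeEquivOfLe (hU i)).finrank_eq
    have h4 : N.dim i = finrank k (N.V i) := rfl
    omega

theorem finite_form [Finite k] (m n : ℕ) : Finite ((Fin m → k) →ₗ[k] (Fin n → k) →ₗ[k] k) :=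
  Finite.of_injective (fun f => fun x y => f x y) fun _ _ h =>
    LinearMap.ext fun x => LinearMap.ext fun y => congrFun (congrFun h x) y

/-- There are finitely many isometry classes of a given dimension vector. -/
theorem SDClass.finite_dim [Finite k] [Finite Q] [Finite (Quiver.Total Q)] (d : SymDim σ) :
    {x : SDClass k D | x.dim = d}.Finite := by
  have hd : ∀ x : {x : SDClass k D | x.dim = d}, ∀ i, finrank k (x.1.out.V i) = d.1 i := by
    rintro ⟨x, hx⟩ i
    have h1 : (SDClass.mk x.out).dim = d := by
      rw [← hx]; exact congrArg SDClass.dim (Quotient.out_eq x)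
    exact congrFun (congrArg SymDim.val h1) i
  let b : ∀ x : {x : SDClass k D | x.dim = d}, ∀ i, x.1.out.V i ≃ₗ[k] (Fin (d.1 i) → k) :=
    fun x i => LinearEquiv.ofFinrankEq _ _ (by rw [hd x i, finrank_fin_fun])
  let F : {x : SDClass k D | x.dim = d} →
      (∀ a : Quiver.Total Q, (Fin (d.1 a.left) → k) →ₗ[k] (Fin (d.1 a.right) → k)) ×
      (∀ i j : Q, (Fin (d.1 i) → k) →ₗ[k] (Fin (d.1 j) → k) →ₗ[k] k) :=
    fun x => ⟨fun a =>
      (b x a.right).toLinearMap ∘ₗ x.1.out.map a.hom ∘ₗ (b x a.left).symm.toLinearMap,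
      fun i j => (x.1.out.form i j).compl₁₂ (b x i).symm.toLinearMap (b x j).symm.toLinearMap⟩
  have : ∀ a : Quiver.Total Q, Finite ((Fin (d.1 a.left) → k) →ₗ[k] (Fin (d.1 a.right) → k)) :=
    fun a => finite_linearMap _ _
  have : ∀ i j, Finite ((Fin (d.1 i) → k) →ₗ[k] (Fin (d.1 j) → k) →ₗ[k] k) :=
    fun i j => finite_form _ _
  refine Set.finite_coe_iff.1 ?_
  refine Finite.of_injective F fun x y h => ?_
  refine Subtype.ext ?_
  rw [← Quotient.out_eq x.1, ← Quotient.out_eq y.1]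
  refine Quotient.sound ⟨⟨⟨fun i => (b x i).trans (b y i).symm, fun {i j} a z => ?_⟩,
    fun i j z z' => ?_⟩⟩
  · have h1 := LinearMap.congr_fun (congrFun (congrArg Prod.fst h) ⟨i, j, a⟩) (b x i z)
    simp only [F, LinearMap.comp_apply, LinearEquiv.coe_coe, LinearEquiv.symm_apply_apply] at h1
    simp only [LinearEquiv.trans_apply, h1, LinearEquiv.symm_apply_apply]
  · have h1 := LinearMap.congr_fun (LinearMap.congr_fun
      (congrFun (congrFun (congrArg Prod.snd h) i) j) (b x i z)) (b x j z')
    simp only [F, LinearMap.compl₁₂_apply, LinearEquiv.coe_coe,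
      LinearEquiv.symm_apply_apply] at h1
    simp only [LinearEquiv.trans_apply, h1]

variable (k D) in
/-- The Hall module: the `ℚ`-vector space on the isometry classes of self-dual representations. -/
def HallModule : Type _ := SDClass k D →₀ ℚ

noncomputable instance : AddCommGroup (HallModule k D) :=
  inferInstanceAs (AddCommGroup (SDClass k D →₀ ℚ))

noncomputable instance : Module ℚ (HallModule k D) :=
  inferInstanceAs (Module ℚ (SDClass k D →₀ ℚ))

/-- The basis element `[M]` of the Hall module. -/
noncomputable def HallModule.of (m : SDClass k D) : HallModule k D := Finsupp.single m 1

variable [Finite k] [Finite Q] [Finite (Quiver.Total Q)]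

/-- The element `[U] • [M] = ∑ G^N_{U, M} [N]`. -/
noncomputable def HallModule.ofSMul (u : RepClass k Q) (m : SDClass k D) : HallModule k D :=
  Finsupp.ofSupportFinite (fun n => (SDClass.hallNumber u m n : ℚ))
    ((SDClass.finite_dim (SymDim.hyp σ u.dim + m.dim)).subset fun n hn =>
      SDClass.dim_of_hallNumber_ne_zero fun h => hn (by
        show (SDClass.hallNumber u m n : ℚ) = 0
        rw [h, Nat.cast_zero]))

/-- The action of the Hall algebra on the Hall module, as a bilinear map. -/
noncomputable def HallModule.actMap : HallAlgebra k Q →ₗ[ℚ] HallModule k D →ₗ[ℚ] HallModule k D :=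
  Finsupp.linearCombination ℚ fun u => (Finsupp.linearCombination ℚ (HallModule.ofSMul u) :
    HallModule k D →ₗ[ℚ] HallModule k D)

noncomputable instance : SMul (HallAlgebra k Q) (HallModule k D) :=
  ⟨fun a m => HallModule.actMap a m⟩

end HallModule

/-! ### Associativity of the Hall algebra and of the Hall module -/

section Associativity

set_option linter.unusedSectionVars false

/-- A sum over classes of products of a function of the class with the size of a fibre. -/
theorem sum_mul_card_fiber {ι : Type*} {C : Type*} [Finite ι] (c : ι → C) (P : ι → Prop)
    (F : C → ℕ) (S : Finset C) (hS : ∀ y, F y ≠ 0 → y ∈ S) :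
    ∑ y ∈ S, F y * Nat.card {i // c i = y ∧ P i} = ∑ᶠ i : {i // P i}, F (c i) := by
  classical
  have := Fintype.ofFinite ι
  rw [finsum_eq_sum_of_fintype]
  have h1 : ∀ y, Nat.card {i // c i = y ∧ P i} = ∑ i : {i // P i}, if c i = y then 1 else 0 := by
    intro y
    rw [Finset.sum_boole, Nat.cast_id]
    have e : {i // c i = y ∧ P i} ≃ {i : {i // P i} // c i = y} :=
      ⟨fun i => ⟨⟨i.1, i.2.2⟩, i.2.1⟩, fun i => ⟨i.1.1, i.2, i.1.2⟩, fun _ => rfl, fun _ => rfl⟩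
    rw [Nat.card_congr e, Nat.card_eq_fintype_card, Fintype.card_subtype]
  simp only [h1, Finset.mul_sum]
  rw [Finset.sum_comm]
  refine Finset.sum_congr rfl fun i _ => ?_
  by_cases h : F (c i) = 0
  · rw [h]
    refine Finset.sum_eq_zero fun y _ => ?_
    by_cases hy : c i = y
    · rw [← hy, h, zero_mul]
    · rw [if_neg hy, mul_zero]
  · rw [Finset.sum_eq_single_of_mem (c i) (hS _ h)]
    · simp
    · intro b _ hb
      rw [if_neg (Ne.symm hb), mul_zero]

theorem finsum_card {ι : Type*} [Finite ι] (X : ι → Type*) [∀ i, Finite (X i)] :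
    ∑ᶠ i, Nat.card (X i) = Nat.card (Σ i, X i) := by
  have := Fintype.ofFinite ι
  rw [finsum_eq_sum_of_fintype, Nat.card_sigma]

variable {k : Type u} [Field k] {Q : Type v} [Quiver.{w} Q]

namespace QuiverRep

instance finite_sub [Finite k] [Finite Q] (X : QuiverRep k Q) : Finite X.Sub := by
  have : ∀ i, Finite (X.V i) := fun i => Module.finite_of_finite k
  refine Finite.of_injective (fun W : X.Sub => fun i => ((W.carrier i : Submodule k (X.V i)) :
    Set (X.V i))) fun W W' h => ?_
  ext1
  funext i
  exact SetLike.coe_injective (congrFun h i)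

namespace Sub

variable {X : QuiverRep k Q}

/-- A subrepresentation of a subrepresentation. -/
def push (B : X.Sub) (A : B.toRep.Sub) : X.Sub where
  carrier i := (A.carrier i).map (B.carrier i).subtype
  map_mem {i j} a x hx := by
    obtain ⟨y, hy, rfl⟩ := hx
    exact ⟨B.toRep.map a y, A.map_mem a y hy, rfl⟩

theorem mem_push (B : X.Sub) (A : B.toRep.Sub) (i : Q) (x : X.V i) :
    x ∈ (B.push A).carrier i ↔ ∃ h : x ∈ B.carrier i, (⟨x, h⟩ : B.toRep.V i) ∈ A.carrier i := by
  constructor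
  · rintro ⟨y, hy, rfl⟩
    exact ⟨y.2, hy⟩
  · rintro ⟨h, hy⟩
    exact ⟨⟨x, h⟩, hy, rfl⟩

theorem push_le (B : X.Sub) (A : B.toRep.Sub) (i : Q) : (B.push A).carrier i ≤ B.carrier i :=
  fun x hx => ((mem_push B A i x).1 hx).1

theorem push_inside (B : X.Sub) (A : B.toRep.Sub) : (B.push A).inside B = A := by
  ext i x
  show x.1 ∈ (B.push A).carrier i ↔ _
  rw [mem_push]
  exact ⟨fun h => h.2, fun h => ⟨x.2, h⟩⟩

theorem inside_push (B A : X.Sub) (h : ∀ i, A.carrier i ≤ B.carrier i) :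
    B.push (A.inside B) = A := by
  ext i x
  rw [mem_push]
  exact ⟨fun h => h.2, fun hx => ⟨h i hx, hx⟩⟩

theorem toRep_push (B : X.Sub) (A : B.toRep.Sub) :
    RepClass.mk (B.push A).toRep = RepClass.mk A.toRep := by
  rw [RepClass.mk_eq]
  obtain ⟨e, -⟩ := exists_iso (R := A.toRep) (X := (B.push A).toRep) (Y := A.toRep)
    (fun i => (((B.carrier i).subtype.comp (A.carrier i).subtype).codRestrict
      ((B.push A).carrier i) (fun x => ⟨x.1, x.2, rfl⟩) :
      A.toRep.V i →ₗ[k] (B.push A).toRep.V i))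
    (fun i => LinearMap.id)
    (fun i x => by
      obtain ⟨x, y, hy, rfl⟩ := x
      exact ⟨⟨y, hy⟩, rfl⟩)
    (fun i x => ⟨x, rfl⟩)
    (fun i r => by
      constructor
      · intro h
        have h' : (r.1.1 : X.V i) = 0 := congrArg Subtype.val h
        exact Subtype.ext (Subtype.ext h')
      · intro h
        exact Subtype.ext (congrArg (fun z : A.toRep.V i => (z.1.1 : X.V i)) h))
    (fun a r => rfl) (fun a r => rfl)
  exact ⟨e⟩

/-- The inverse image of a subrepresentation of a quotient. -/
def pull (A : X.Sub) (B : A.quot.Sub) : X.Sub where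
  carrier i := (B.carrier i).comap (A.carrier i).mkQ
  map_mem {i _} a x hx := B.map_mem a ((A.carrier i).mkQ x) hx

/-- The image of a subrepresentation in a quotient. -/
def image (A : X.Sub) (B : X.Sub) : A.quot.Sub where
  carrier i := (B.carrier i).map (A.carrier i).mkQ
  map_mem {i j} a x hx := by
    obtain ⟨y, hy, rfl⟩ := hx
    exact ⟨X.map a y, B.map_mem a y hy, rfl⟩

theorem le_pull (A : X.Sub) (B : A.quot.Sub) (i : Q) : A.carrier i ≤ (A.pull B).carrier i := by
  intro x hx
  have h : (A.carrier i).mkQ x = 0 := (Submodule.Quotient.mk_eq_zero (A.carrier i)).2 hx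
  exact (congrArg (fun z : A.quot.V i => z ∈ B.carrier i) h).mpr (zero_mem _)

theorem image_pull (A : X.Sub) (B : A.quot.Sub) : A.image (A.pull B) = B := by
  ext i x
  obtain ⟨x, rfl⟩ := (A.carrier i).mkQ_surjective x
  constructor
  · rintro ⟨y, hy, hyx⟩
    have hy' : (A.carrier i).mkQ y ∈ B.carrier i := hy
    exact (congrArg (fun z : A.quot.V i => z ∈ B.carrier i) hyx).mp hy'
  · intro h
    exact ⟨x, h, rfl⟩

theorem pull_image (A B : X.Sub) (h : ∀ i, A.carrier i ≤ B.carrier i) : A.pull (A.image B) = B := by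
  ext i x
  constructor
  · rintro ⟨y, hy, hyx⟩
    have h1 : y - x ∈ A.carrier i := (Submodule.Quotient.eq (A.carrier i)).1 hyx
    have h2 := sub_mem hy (h i h1)
    rwa [sub_sub_cancel] at h2
  · intro hx
    exact ⟨x, hx, rfl⟩

theorem quot_pull (A : X.Sub) (B : A.quot.Sub) :
    RepClass.mk (A.pull B).quot = RepClass.mk B.quot := by
  rw [RepClass.mk_eq]
  obtain ⟨e, -⟩ := exists_iso (R := X) (X := (A.pull B).quot) (Y := B.quot)
    (fun i => ((A.pull B).carrier i).mkQ)
    (fun i => (B.carrier i).mkQ ∘ₗ (A.carrier i).mkQ)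
    (fun i => Submodule.mkQ_surjective _)
    (fun i => ((B.carrier i).mkQ_surjective).comp ((A.carrier i).mkQ_surjective))
    (fun i r => (Submodule.Quotient.mk_eq_zero _).trans
      (Submodule.Quotient.mk_eq_zero (B.carrier i)).symm)
    (fun a r => rfl) (fun a r => rfl)
  exact ⟨e⟩

theorem toRep_pull (A : X.Sub) (B : A.quot.Sub) :
    RepClass.mk (A.inside (A.pull B)).quot = RepClass.mk B.toRep := by
  rw [RepClass.mk_eq]
  obtain ⟨e, -⟩ := exists_iso (R := (A.pull B).toRep) (X := (A.inside (A.pull B)).quot)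
    (Y := B.toRep)
    (fun i => ((A.inside (A.pull B)).carrier i).mkQ)
    (fun i => (((A.carrier i).mkQ.comp ((A.pull B).carrier i).subtype).codRestrict (B.carrier i)
      (fun x => x.2) : (A.pull B).toRep.V i →ₗ[k] B.toRep.V i))
    (fun i => Submodule.mkQ_surjective _)
    (fun i x => by
      obtain ⟨x, hx⟩ := x
      obtain ⟨y, rfl⟩ := (A.carrier i).mkQ_surjective x
      exact ⟨⟨y, hx⟩, rfl⟩)
    (fun i r => (Submodule.Quotient.mk_eq_zero _).trans (Iff.trans
      (Submodule.Quotient.mk_eq_zero (A.carrier i) (x := r.1)).symm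
      ⟨fun h => Subtype.ext h, fun h => congrArg Subtype.val h⟩))
    (fun a r => rfl) (fun a r => rfl)
  exact ⟨e⟩

end Sub

/-- Two-step filtrations `A ⊂ B ⊂ X` with prescribed classes of the subquotients. -/
def Flags (u v w : RepClass k Q) (X : QuiverRep k Q) : Type _ :=
  {p : X.Sub × X.Sub // (∀ i, p.1.carrier i ≤ p.2.carrier i) ∧ RepClass.mk p.1.toRep = u ∧
    RepClass.mk (p.1.inside p.2).quot = v ∧ RepClass.mk p.2.quot = w}

/-- Flags, with the larger subrepresentation chosen first. -/
def flagsEquiv₁ (u v w : RepClass k Q) (X : QuiverRep k Q) :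
    (Σ B : {B : X.Sub // RepClass.mk B.quot = w},
      {A : B.1.toRep.Sub // RepClass.mk A.toRep = u ∧ RepClass.mk A.quot = v}) ≃
      Flags u v w X where
  toFun p := ⟨⟨p.1.1.push p.2.1, p.1.1⟩, Sub.push_le _ _, by rw [Sub.toRep_push]; exact p.2.2.1,
    by show RepClass.mk ((p.1.1.push p.2.1).inside p.1.1).quot = v
       rw [Sub.push_inside]; exact p.2.2.2, p.1.2⟩
  invFun p := ⟨⟨p.1.2, p.2.2.2.2⟩, ⟨p.1.1.inside p.1.2, by
    rw [← Sub.toRep_push, Sub.inside_push _ _ p.2.1]; exact p.2.2.1, p.2.2.2.1⟩⟩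
  left_inv p := by
    obtain ⟨⟨B, hB⟩, ⟨A, hA⟩⟩ := p
    have := Sub.push_inside B A
    simp only [this]
  right_inv p := by
    obtain ⟨⟨A, B⟩, h1, h2⟩ := p
    exact Subtype.ext (Prod.ext (Sub.inside_push _ _ h1) rfl)

/-- Flags, with the smaller subrepresentation chosen first. -/
def flagsEquiv₂ (u v w : RepClass k Q) (X : QuiverRep k Q) :
    (Σ A : {A : X.Sub // RepClass.mk A.toRep = u},
      {B : A.1.quot.Sub // RepClass.mk B.toRep = v ∧ RepClass.mk B.quot = w}) ≃
      Flags u v w X where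
  toFun p := ⟨⟨p.1.1, p.1.1.pull p.2.1⟩, Sub.le_pull _ _, p.1.2,
    by rw [Sub.toRep_pull]; exact p.2.2.1, by rw [Sub.quot_pull]; exact p.2.2.2⟩
  invFun p := ⟨⟨p.1.1, p.2.2.1⟩, ⟨p.1.1.image p.1.2, by
    rw [← Sub.toRep_pull, Sub.pull_image _ _ p.2.1]; exact p.2.2.2.1, by
    rw [← Sub.quot_pull, Sub.pull_image _ _ p.2.1]; exact p.2.2.2.2⟩⟩
  left_inv p := by
    obtain ⟨⟨A, hA⟩, ⟨B, hB⟩⟩ := p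
    have := Sub.image_pull A B
    simp only [this]
  right_inv p := by
    obtain ⟨⟨A, B⟩, h1, h2⟩ := p
    exact Subtype.ext (Prod.ext rfl (Sub.pull_image _ _ h1))

end QuiverRep

namespace HallAlgebra

variable [Finite k] [Finite Q] [Finite (Quiver.Total Q)]

theorem mul_def (a b : HallAlgebra k Q) : a * b = mulMap a b := rfl

theorem mulMap_of (u v : RepClass k Q) : mulMap (of u) (of v) = ofMul u v := by
  simp only [mulMap, of]
  erw [Finsupp.linearCombination_single, one_smul, Finsupp.linearCombination_single, one_smul]

/-- The coefficient of a basis element. -/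
noncomputable def coeff (x : RepClass k Q) : HallAlgebra k Q →ₗ[ℚ] ℚ := Finsupp.lapply x

theorem ext_coeff {a b : HallAlgebra k Q} (h : ∀ X, coeff (RepClass.mk X) a = coeff (RepClass.mk X) b) :
    a = b :=
  Finsupp.ext fun x => Quotient.inductionOn x h

theorem coeff_ofMul (u v x : RepClass k Q) :
    coeff x (ofMul u v) = RepClass.hallNumber u v x := rfl

/-- The dimension bound gives a finite set of classes that carries the product. -/
theorem ofMul_eq_sum (u v : RepClass k Q) : ∃ S : Finset (RepClass k Q),
    (∀ y, RepClass.hallNumber u v y ≠ 0 → y ∈ S) ∧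
    ofMul u v = ∑ y ∈ S, (RepClass.hallNumber u v y : ℚ) • of y := by
  let f : RepClass k Q →₀ ℚ := ofMul u v
  refine ⟨f.support, fun y hy => ?_, ?_⟩
  · rw [Finsupp.mem_support_iff]
    show (RepClass.hallNumber u v y : ℚ) ≠ 0
    exact_mod_cast hy
  · refine (Finsupp.sum_single f).symm.trans (Finset.sum_congr rfl fun y _ => ?_)
    show _ = (_ : ℚ) • (Finsupp.single y 1 : RepClass k Q →₀ ℚ)
    rw [Finsupp.smul_single, smul_eq_mul, mul_one]; rfl

theorem induction {p : HallAlgebra k Q → Prop} (a : HallAlgebra k Q) (h0 : p 0)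
    (hadd : ∀ a b, p a → p b → p (a + b)) (hsmul : ∀ (c : ℚ) u, p (c • of u)) : p a := by
  refine Finsupp.induction_linear a h0 hadd fun u c => ?_
  have : (Finsupp.single u c : RepClass k Q →₀ ℚ) = c • Finsupp.single u 1 := by
    rw [Finsupp.smul_single, smul_eq_mul, mul_one]
  rw [this]
  exact hsmul c u

theorem coeff_mulMap_ofMul_of (u v w : RepClass k Q) (X : QuiverRep k Q) :
    coeff (RepClass.mk X) (mulMap (ofMul u v) (of w)) = Nat.card (QuiverRep.Flags u v w X) := by
  obtain ⟨S, hS, h⟩ := ofMul_eq_sum u v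
  rw [h, ← Nat.card_congr (QuiverRep.flagsEquiv₁ u v w X), ← finsum_card]
  simp only [map_sum, LinearMap.sum_apply, map_smul, LinearMap.smul_apply, mulMap_of, coeff_ofMul,
    smul_eq_mul]
  exact_mod_cast sum_mul_card_fiber (fun B : X.Sub => RepClass.mk B.toRep)
    (fun B => RepClass.mk B.quot = w) (RepClass.hallNumber u v) S hS

theorem coeff_mulMap_of_ofMul (u v w : RepClass k Q) (X : QuiverRep k Q) :
    coeff (RepClass.mk X) (mulMap (of u) (ofMul v w)) = Nat.card (QuiverRep.Flags u v w X) := by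
  obtain ⟨S, hS, h⟩ := ofMul_eq_sum v w
  have h4 : ∀ y, RepClass.hallNumber u y (RepClass.mk X) =
      Nat.card {A : X.Sub // RepClass.mk A.quot = y ∧ RepClass.mk A.toRep = u} := fun y =>
    Nat.card_congr (Equiv.subtypeEquivRight fun _ => and_comm)
  rw [h, ← Nat.card_congr (QuiverRep.flagsEquiv₂ u v w X), ← finsum_card]
  simp only [map_sum, map_smul, mulMap_of, coeff_ofMul, smul_eq_mul, h4]
  exact_mod_cast sum_mul_card_fiber (fun A : X.Sub => RepClass.mk A.quot)
    (fun A => RepClass.mk A.toRep = u) (RepClass.hallNumber v w) S hS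

theorem mul_assoc' (a b c : HallAlgebra k Q) :
    mulMap (mulMap a b) c = mulMap a (mulMap b c) := by
  induction a using induction with
  | h0 => simp
  | hadd a a' h h' => simp only [map_add, LinearMap.add_apply, h, h']
  | hsmul x u =>
    induction b using induction with
    | h0 => simp
    | hadd a a' h h' => simp only [map_add, LinearMap.add_apply, h, h']
    | hsmul y v =>
      induction c using induction with
      | h0 => simp
      | hadd a a' h h' => simp only [map_add, h, h']
      | hsmul z w =>
        simp only [map_smul, LinearMap.smul_apply, mulMap_of]
        congr 3
        exact ext_coeff fun X =>
          (coeff_mulMap_ofMul_of u v w X).trans (coeff_mulMap_of_ofMul u v w X).symm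

end HallAlgebra

variable (k Q) in
/-- The zero representation. -/
def QuiverRep.zero : QuiverRep k Q where
  V _ := PUnit.{u + 1}
  map _ := 0

theorem QuiverRep.mk_eq_zero_iff {X : QuiverRep k Q} :
    RepClass.mk X = RepClass.mk (QuiverRep.zero k Q) ↔ ∀ i, Subsingleton (X.V i) := by
  rw [RepClass.mk_eq]
  constructor
  · rintro ⟨e⟩ i
    exact (e.equiv i).toEquiv.subsingleton_congr.2 (inferInstanceAs (Subsingleton PUnit))
  · intro h
    obtain ⟨e, -⟩ := exists_iso (R := X) (X := X) (Y := QuiverRep.zero k Q)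
      (fun i => LinearMap.id) (fun i => 0) (fun i x => ⟨x, rfl⟩)
      (fun i x => ⟨0, rfl⟩) (fun i r => ⟨fun _ => rfl, fun _ => Subsingleton.elim _ _⟩)
      (fun a r => rfl) (fun a r => rfl)
    exact ⟨e⟩

/-- The zero subrepresentation. -/
def QuiverRep.Sub.bot (X : QuiverRep k Q) : X.Sub where
  carrier _ := ⊥
  map_mem a x hx := by
    rw [Submodule.mem_bot] at hx ⊢
    rw [hx, map_zero]

/-- The whole representation, as a subrepresentation. -/
def QuiverRep.Sub.top (X : QuiverRep k Q) : X.Sub where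
  carrier _ := ⊤
  map_mem _ _ _ := trivial

theorem QuiverRep.Sub.eq_bot_iff {X : QuiverRep k Q} (U : X.Sub) :
    RepClass.mk U.toRep = RepClass.mk (QuiverRep.zero k Q) ↔ U = QuiverRep.Sub.bot X := by
  rw [QuiverRep.mk_eq_zero_iff]
  constructor
  · intro h
    ext1
    funext i
    exact (Submodule.subsingleton_iff_eq_bot).1 (h i)
  · rintro rfl i
    exact Submodule.subsingleton_iff_eq_bot.2 rfl

theorem QuiverRep.Sub.eq_top_iff {X : QuiverRep k Q} (U : X.Sub) :
    RepClass.mk U.quot = RepClass.mk (QuiverRep.zero k Q) ↔ U = QuiverRep.Sub.top X := by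
  rw [QuiverRep.mk_eq_zero_iff]
  constructor
  · intro h
    ext1
    funext i
    exact (Submodule.Quotient.subsingleton_iff).1 (h i)
  · rintro rfl i
    exact Submodule.Quotient.subsingleton_iff.2 rfl

theorem QuiverRep.Sub.quot_bot (X : QuiverRep k Q) :
    RepClass.mk (QuiverRep.Sub.bot X).quot = RepClass.mk X := by
  rw [RepClass.mk_eq]
  obtain ⟨e, -⟩ := exists_iso (R := X) (X := (QuiverRep.Sub.bot X).quot) (Y := X)
    (fun i => ((QuiverRep.Sub.bot X).carrier i).mkQ) (fun i => LinearMap.id)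
    (fun i => Submodule.mkQ_surjective _) (fun i x => ⟨x, rfl⟩)
    (fun i r => (Submodule.Quotient.mk_eq_zero _).trans (Submodule.mem_bot k))
    (fun a r => rfl) (fun a r => rfl)
  exact ⟨e⟩

theorem QuiverRep.Sub.toRep_top (X : QuiverRep k Q) :
    RepClass.mk (QuiverRep.Sub.top X).toRep = RepClass.mk X := by
  rw [RepClass.mk_eq]
  obtain ⟨e, -⟩ := exists_iso (R := (QuiverRep.Sub.top X).toRep)
    (X := (QuiverRep.Sub.top X).toRep) (Y := X)
    (fun i => LinearMap.id) (fun i => ((QuiverRep.Sub.top X).carrier i).subtype)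
    (fun i x => ⟨x, rfl⟩) (fun i x => ⟨⟨x, trivial⟩, rfl⟩)
    (fun i r => ⟨fun h => congrArg Subtype.val h, fun h => Subtype.ext h⟩)
    (fun a r => rfl) (fun a r => rfl)
  exact ⟨e⟩

/-- Counting a set that is empty or a singleton. -/
theorem card_subtype_eq_single {ι : Type*} (P : ι → Prop) (i₀ : ι) (p : Prop) [Decidable p]
    (h : ∀ i, P i ↔ i = i₀ ∧ p) : Nat.card {i // P i} = if p then 1 else 0 := by
  by_cases hp : p
  · rw [if_pos hp]
    have : Unique {i // P i} :=
      ⟨⟨⟨i₀, (h i₀).2 ⟨rfl, hp⟩⟩⟩, fun i => Subtype.ext ((h i.1).1 i.2).1⟩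
    exact Nat.card_unique
  · rw [if_neg hp]
    have : IsEmpty {i // P i} := ⟨fun i => hp ((h i.1).1 i.2).2⟩
    exact Nat.card_of_isEmpty

namespace HallAlgebra

variable [Finite k] [Finite Q] [Finite (Quiver.Total Q)]

open Classical in
theorem coeff_of (u x : RepClass k Q) : coeff x (of u) = if u = x then 1 else 0 :=
  Finsupp.single_apply

theorem ofMul_zero_left (v : RepClass k Q) : ofMul (RepClass.mk (QuiverRep.zero k Q)) v = of v := by
  classical
  refine ext_coeff fun X => ?_
  rw [coeff_ofMul, coeff_of]
  have : RepClass.hallNumber (RepClass.mk (QuiverRep.zero k Q)) v (RepClass.mk X) =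
      if v = RepClass.mk X then 1 else 0 := by
    refine card_subtype_eq_single _ (QuiverRep.Sub.bot X) _ fun W => ?_
    rw [QuiverRep.Sub.eq_bot_iff]
    refine and_congr_right ?_
    rintro rfl
    rw [QuiverRep.Sub.quot_bot, eq_comm]
  rw [this]; split_ifs <;> simp

theorem ofMul_zero_right (v : RepClass k Q) :
    ofMul v (RepClass.mk (QuiverRep.zero k Q)) = of v := by
  classical
  refine ext_coeff fun X => ?_
  rw [coeff_ofMul, coeff_of]
  have : RepClass.hallNumber v (RepClass.mk (QuiverRep.zero k Q)) (RepClass.mk X) =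
      if v = RepClass.mk X then 1 else 0 := by
    refine card_subtype_eq_single _ (QuiverRep.Sub.top X) _ fun W => ?_
    rw [QuiverRep.Sub.eq_top_iff, and_comm]
    refine and_congr_right ?_
    rintro rfl
    rw [QuiverRep.Sub.toRep_top, eq_comm]
  rw [this]; split_ifs <;> simp

noncomputable instance : One (HallAlgebra k Q) := ⟨of (RepClass.mk (QuiverRep.zero k Q))⟩

theorem one_def : (1 : HallAlgebra k Q) = of (RepClass.mk (QuiverRep.zero k Q)) := rfl

noncomputable instance : Ring (HallAlgebra k Q) where
  __ := (inferInstance : AddCommGroup (HallAlgebra k Q))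
  mul_assoc := mul_assoc'
  one_mul a := by
    show mulMap _ a = a
    induction a using induction with
    | h0 => rw [map_zero]
    | hadd a a' h h' => rw [map_add, h, h']
    | hsmul x u => rw [map_smul, one_def, mulMap_of, ofMul_zero_left]
  mul_one a := by
    show mulMap a _ = a
    induction a using induction with
    | h0 => rw [map_zero, LinearMap.zero_apply]
    | hadd a a' h h' => rw [map_add, LinearMap.add_apply, h, h']
    | hsmul x u => rw [map_smul, LinearMap.smul_apply, one_def, mulMap_of, ofMul_zero_right]
  zero_mul a := by show mulMap 0 a = 0; rw [map_zero, LinearMap.zero_apply]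
  mul_zero a := (mulMap a).map_zero
  left_distrib a b c := (mulMap a).map_add b c
  right_distrib a b c := by
    show mulMap (a + b) c = mulMap a c + mulMap b c
    rw [map_add, LinearMap.add_apply]

noncomputable instance : Algebra ℚ (HallAlgebra k Q) :=
  Algebra.ofModule
    (fun c a b => by
      show mulMap (c • a) b = c • mulMap a b
      rw [map_smul, LinearMap.smul_apply])
    (fun c a b => (mulMap a).map_smul c b)

/-- The multiplication on the basis. -/
theorem of_mul_of (u v : RepClass k Q) : of u * of v = ofMul u v := mulMap_of u v

end HallAlgebra

variable {σ : Involution Q} {D : Duality σ}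

namespace SDRep

theorem perp_anti (N : SDRep k D) {A B : N.Sub} (h : ∀ i, A.carrier i ≤ B.carrier i) (i : Q) :
    (N.perp B).carrier i ≤ (N.perp A).carrier i :=
  fun _ hx j y hy => hx j y (h j hy)

/-- Two-step isotropic filtrations `A ⊂ B ⊂ N` with prescribed classes of the subquotients. -/
def Flags (u v : RepClass k Q) (m : SDClass k D) (N : SDRep k D) : Type _ :=
  {p : N.Sub × N.Sub // (∀ i, p.1.carrier i ≤ p.2.carrier i) ∧ RepClass.mk p.1.toRep = u ∧
    RepClass.mk (p.1.inside p.2).quot = v ∧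
    ∃ h : N.IsIsotropic p.2, SDClass.mk (N.reduce p.2 h) = m}

/-- Isotropic flags, with the larger subrepresentation chosen first. -/
def flagsEquiv₁ (u v : RepClass k Q) (m : SDClass k D) (N : SDRep k D) :
    (Σ B : {B : N.Sub // ∃ h : N.IsIsotropic B, SDClass.mk (N.reduce B h) = m},
      {A : B.1.toRep.Sub // RepClass.mk A.toRep = u ∧ RepClass.mk A.quot = v}) ≃
      Flags u v m N where
  toFun p := ⟨⟨p.1.1.push p.2.1, p.1.1⟩, QuiverRep.Sub.push_le _ _,
    by rw [QuiverRep.Sub.toRep_push]; exact p.2.2.1,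
    by show RepClass.mk ((p.1.1.push p.2.1).inside p.1.1).quot = v
       rw [QuiverRep.Sub.push_inside]; exact p.2.2.2, p.1.2⟩
  invFun p := ⟨⟨p.1.2, p.2.2.2.2⟩, ⟨p.1.1.inside p.1.2, by
    rw [← QuiverRep.Sub.toRep_push, QuiverRep.Sub.inside_push _ _ p.2.1]; exact p.2.2.1,
    p.2.2.2.1⟩⟩
  left_inv p := by
    obtain ⟨⟨B, hB⟩, ⟨A, hA⟩⟩ := p
    have := QuiverRep.Sub.push_inside B A
    simp only [this]
  right_inv p := by
    obtain ⟨⟨A, B⟩, h1, h2⟩ := p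
    exact Subtype.ext (Prod.ext (QuiverRep.Sub.inside_push _ _ h1) rfl)

/-- The inverse image in `N` of a subrepresentation of `A^⊥ / A`. -/
def pull (N : SDRep k D) (A : N.Sub) (B : (A.inside (N.perp A)).quot.Sub) : N.Sub :=
  (N.perp A).push ((A.inside (N.perp A)).pull B)

/-- The image in `A^⊥ / A` of a subrepresentation of `N`. -/
def image (N : SDRep k D) (A B : N.Sub) : (A.inside (N.perp A)).quot.Sub :=
  (A.inside (N.perp A)).image (B.inside (N.perp A))

theorem mem_pull (N : SDRep k D) (A : N.Sub) (B : (A.inside (N.perp A)).quot.Sub) (i : Q)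
    (x : N.V i) : x ∈ (N.pull A B).carrier i ↔
      ∃ h : x ∈ (N.perp A).carrier i, N.reduceMk A i ⟨x, h⟩ ∈ B.carrier i :=
  QuiverRep.Sub.mem_push _ _ i x

theorem le_pull (N : SDRep k D) (A : N.Sub) (hA : N.IsIsotropic A)
    (B : (A.inside (N.perp A)).quot.Sub) (i : Q) : A.carrier i ≤ (N.pull A B).carrier i := by
  intro x hx
  rw [mem_pull]
  refine ⟨hA i hx, ?_⟩
  have h : N.reduceMk A i ⟨x, hA i hx⟩ = 0 := (N.reduceMk_eq_zero A i _).2 hx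
  exact (congrArg (· ∈ B.carrier i) h).mpr (zero_mem _)

theorem image_pull (N : SDRep k D) (A : N.Sub) (B : (A.inside (N.perp A)).quot.Sub) :
    N.image A (N.pull A B) = B := by
  unfold image pull
  rw [QuiverRep.Sub.push_inside, QuiverRep.Sub.image_pull]

theorem pull_image (N : SDRep k D) (A B : N.Sub) (h : ∀ i, A.carrier i ≤ B.carrier i)
    (hB : ∀ i, B.carrier i ≤ (N.perp A).carrier i) : N.pull A (N.image A B) = B := by
  unfold image pull
  rw [QuiverRep.Sub.pull_image, QuiverRep.Sub.inside_push _ _ hB]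
  exact fun i x hx => h i hx

theorem isIsotropic_pull (N : SDRep k D) (A : N.Sub) (hA : N.IsIsotropic A)
    (B : (A.inside (N.perp A)).quot.Sub) :
    N.IsIsotropic (N.pull A B) ↔ (N.reduce A hA).IsIsotropic B := by
  constructor
  · intro h i x hx j y hy
    obtain ⟨x, rfl⟩ := N.reduceMk_surjective A i x
    obtain ⟨y, rfl⟩ := N.reduceMk_surjective A j y
    exact h i ((N.mem_pull A B i x.1).2 ⟨x.2, hx⟩) j y.1 ((N.mem_pull A B j y.1).2 ⟨y.2, hy⟩)
  · intro h i x hx j y hy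
    obtain ⟨hx1, hx2⟩ := (N.mem_pull A B i x).1 hx
    obtain ⟨hy1, hy2⟩ := (N.mem_pull A B j y).1 hy
    exact h i hx2 j _ hy2

theorem toRep_pull (N : SDRep k D) (A : N.Sub) (B : (A.inside (N.perp A)).quot.Sub) :
    RepClass.mk (A.inside (N.pull A B)).quot = RepClass.mk B.toRep := by
  rw [RepClass.mk_eq]
  let g : ∀ i, (N.pull A B).toRep.V i →ₗ[k] B.toRep.V i := fun i =>
    { toFun := fun x => ⟨N.reduceMk A i ⟨x.1, ((N.mem_pull A B i x.1).1 x.2).1⟩,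
        ((N.mem_pull A B i x.1).1 x.2).2⟩
      map_add' := fun _ _ => rfl
      map_smul' := fun _ _ => rfl }
  obtain ⟨e, -⟩ := QuiverRep.exists_iso (R := (N.pull A B).toRep)
    (X := (A.inside (N.pull A B)).quot) (Y := B.toRep)
    (fun i => ((A.inside (N.pull A B)).carrier i).mkQ) g
    (fun i => Submodule.mkQ_surjective _)
    (fun i x => by
      obtain ⟨x, hx⟩ := x
      obtain ⟨y, rfl⟩ := N.reduceMk_surjective A i x
      exact ⟨⟨y.1, (N.mem_pull A B i y.1).2 ⟨y.2, hx⟩⟩, rfl⟩)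
    (fun i r => (Submodule.Quotient.mk_eq_zero _).trans (Iff.trans
      (N.reduceMk_eq_zero A i ⟨r.1, ((N.mem_pull A B i r.1).1 r.2).1⟩).symm
      ⟨fun h => Subtype.ext h, fun h => congrArg Subtype.val h⟩))
    (fun a r => rfl) (fun a r => rfl)
  exact ⟨e⟩

theorem reduce_pull (N : SDRep k D) (A : N.Sub) (hA : N.IsIsotropic A)
    (B : (A.inside (N.perp A)).quot.Sub) (h : N.IsIsotropic (N.pull A B))
    (h' : (N.reduce A hA).IsIsotropic B) :
    SDClass.mk (N.reduce (N.pull A B) h) = SDClass.mk ((N.reduce A hA).reduce B h') := by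
  rw [SDClass.mk_eq]
  have hp : ∀ i, (N.perp (N.pull A B)).carrier i ≤ (N.perp A).carrier i :=
    N.perp_anti (N.le_pull A hA B)
  have hm : ∀ i (x : (N.perp A).toRep.V i), x.1 ∈ (N.perp (N.pull A B)).carrier i ↔
      N.reduceMk A i x ∈ ((N.reduce A hA).perp B).carrier i := by
    intro i x
    constructor
    · intro hx j y hy
      obtain ⟨y, rfl⟩ := N.reduceMk_surjective A j y
      exact hx j y.1 ((N.mem_pull A B j y.1).2 ⟨y.2, hy⟩)
    · intro hx j y hy
      obtain ⟨hy1, hy2⟩ := (N.mem_pull A B j y).1 hy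
      exact hx j _ hy2
  let g : ∀ i, (N.perp (N.pull A B)).toRep.V i →ₗ[k] ((N.reduce A hA).perp B).toRep.V i :=
    fun i =>
    { toFun := fun x => ⟨N.reduceMk A i ⟨x.1, hp i x.2⟩, (hm i ⟨x.1, hp i x.2⟩).1 x.2⟩
      map_add' := fun _ _ => rfl
      map_smul' := fun _ _ => rfl }
  have hg : ∀ i, Function.Surjective (g i) := fun i x => by
    obtain ⟨x, hx⟩ := x
    obtain ⟨y, rfl⟩ := N.reduceMk_surjective A i x
    exact ⟨⟨y.1, (hm i y).2 hx⟩, rfl⟩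
  refine SDRep.exists_isometry (R := (N.perp (N.pull A B)).toRep)
    (fun i => N.reduceMk (N.pull A B) i) (fun i => (N.reduce A hA).reduceMk B i ∘ₗ g i)
    (fun i => N.reduceMk_surjective _ i)
    (fun i => ((N.reduce A hA).reduceMk_surjective B i).comp (hg i))
    (fun i r => ?_) (fun a r => rfl) (fun a r => rfl) (fun i j r s => rfl)
  refine (N.reduceMk_eq_zero _ i r).trans (Iff.trans ?_
    ((N.reduce A hA).reduceMk_eq_zero B i (g i r)).symm)
  rw [mem_pull]
  exact ⟨fun h => h.2, fun h => ⟨hp i r.2, h⟩⟩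

theorem reduce_congr (N : SDRep k D) {A B : N.Sub} (h : A = B) (hA : N.IsIsotropic A)
    (hB : N.IsIsotropic B) : SDClass.mk (N.reduce A hA) = SDClass.mk (N.reduce B hB) := by
  subst h; rfl

/-- Isotropic flags, with the smaller subrepresentation chosen first. -/
def flagsEquiv₂ (u v : RepClass k Q) (m : SDClass k D) (N : SDRep k D) :
    (Σ A : {A : {A : N.Sub // N.IsIsotropic A} // RepClass.mk A.1.toRep = u},
      {B : (N.reduce A.1.1 A.1.2).Sub // RepClass.mk B.toRep = v ∧
        ∃ h : (N.reduce A.1.1 A.1.2).IsIsotropic B,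
          SDClass.mk ((N.reduce A.1.1 A.1.2).reduce B h) = m}) ≃
      Flags u v m N where
  toFun p := ⟨⟨p.1.1.1, N.pull p.1.1.1 p.2.1⟩, N.le_pull _ p.1.1.2 _, p.1.2,
    (N.toRep_pull _ _).trans p.2.2.1, by
      obtain ⟨h, h'⟩ := p.2.2.2
      have h1 := (N.isIsotropic_pull p.1.1.1 p.1.1.2 p.2.1).2 h
      exact ⟨h1, (N.reduce_pull _ p.1.1.2 _ h1 h).trans h'⟩⟩
  invFun p :=
    have hA : N.IsIsotropic p.1.1 := fun i x hx => by
      obtain ⟨h, -⟩ := p.2.2.2.2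
      exact N.perp_anti p.2.1 i (h i (p.2.1 i hx))
    have hB : N.pull p.1.1 (N.image p.1.1 p.1.2) = p.1.2 :=
      N.pull_image _ _ p.2.1 fun i x hx => by
        obtain ⟨h, -⟩ := p.2.2.2.2
        exact N.perp_anti p.2.1 i (h i hx)
    ⟨⟨⟨p.1.1, hA⟩, p.2.2.1⟩, ⟨N.image p.1.1 p.1.2, by
      have := N.toRep_pull p.1.1 (N.image p.1.1 p.1.2)
      rw [hB] at this
      exact this.symm.trans p.2.2.2.1, by
      obtain ⟨h, h'⟩ := p.2.2.2.2
      have h1 : N.IsIsotropic (N.pull p.1.1 (N.image p.1.1 p.1.2)) := by rwa [hB]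
      have h2 := (N.isIsotropic_pull p.1.1 hA _).1 h1
      refine ⟨h2, (N.reduce_pull p.1.1 hA _ h1 h2).symm.trans ?_⟩
      exact (N.reduce_congr hB h1 h).trans h'⟩⟩
  left_inv p := by
    obtain ⟨⟨⟨A, hA⟩, hA'⟩, ⟨B, hB⟩⟩ := p
    have := N.image_pull A B
    simp only [this]
  right_inv p := by
    obtain ⟨⟨A, B⟩, h1, h2, h3, h, h4⟩ := p
    exact Subtype.ext (Prod.ext rfl (N.pull_image _ _ h1 fun i x hx => N.perp_anti h1 i (h i hx)))

theorem perp_bot (N : SDRep k D) (i : Q) (x : N.V i) :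
    x ∈ (N.perp (QuiverRep.Sub.bot N.toQuiverRep)).carrier i := by
  intro j y hy
  have hy' : y = 0 := (Submodule.mem_bot k).1 hy
  rw [hy', map_zero]

theorem isIsotropic_bot (N : SDRep k D) : N.IsIsotropic (QuiverRep.Sub.bot N.toQuiverRep) :=
  fun i x _ => N.perp_bot i x

theorem reduce_bot (N : SDRep k D) (h : N.IsIsotropic (QuiverRep.Sub.bot N.toQuiverRep)) :
    SDClass.mk (N.reduce _ h) = SDClass.mk N := by
  rw [SDClass.mk_eq]
  exact SDRep.exists_isometry (R := (N.perp (QuiverRep.Sub.bot N.toQuiverRep)).toRep)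
    (fun i => N.reduceMk _ i)
    (fun i => ((N.perp (QuiverRep.Sub.bot N.toQuiverRep)).carrier i).subtype)
    (fun i => N.reduceMk_surjective _ i) (fun i x => ⟨⟨x, N.perp_bot i x⟩, rfl⟩)
    (fun i r => (N.reduceMk_eq_zero _ i r).trans (Submodule.mem_bot k))
    (fun a r => rfl) (fun a r => rfl) (fun i j r s => rfl)

end SDRep

namespace HallModule

variable [Finite k] [Finite Q] [Finite (Quiver.Total Q)]

theorem smul_def (a : HallAlgebra k Q) (m : HallModule k D) : a • m = actMap a m := rfl

theorem actMap_of (u : RepClass k Q) (m : SDClass k D) :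
    actMap (HallAlgebra.of u) (of m) = ofSMul u m := by
  simp only [actMap, HallAlgebra.of, of]
  erw [Finsupp.linearCombination_single, one_smul, Finsupp.linearCombination_single, one_smul]

theorem induction {p : HallModule k D → Prop} (a : HallModule k D) (h0 : p 0)
    (hadd : ∀ a b, p a → p b → p (a + b)) (hsmul : ∀ (c : ℚ) m, p (c • of m)) : p a := by
  refine Finsupp.induction_linear a h0 hadd fun u c => ?_
  have : (Finsupp.single u c : SDClass k D →₀ ℚ) = c • Finsupp.single u 1 := by
    rw [Finsupp.smul_single, smul_eq_mul, mul_one]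
  rw [this]
  exact hsmul c u

/-- The coefficient of a basis element. -/
noncomputable def coeff (n : SDClass k D) : HallModule k D →ₗ[ℚ] ℚ := Finsupp.lapply n

theorem ext_coeff {a b : HallModule k D} (h : ∀ N, coeff (SDClass.mk N) a = coeff (SDClass.mk N) b) :
    a = b :=
  Finsupp.ext fun n => Quotient.inductionOn n h

theorem coeff_ofSMul (u : RepClass k Q) (m n : SDClass k D) :
    coeff n (ofSMul u m) = SDClass.hallNumber u m n := rfl

open Classical in
theorem coeff_of (m n : SDClass k D) : coeff n (of m) = if m = n then 1 else 0 :=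
  Finsupp.single_apply

theorem ofSMul_eq_sum (u : RepClass k Q) (m : SDClass k D) : ∃ S : Finset (SDClass k D),
    (∀ n, SDClass.hallNumber u m n ≠ 0 → n ∈ S) ∧
    ofSMul u m = ∑ n ∈ S, (SDClass.hallNumber u m n : ℚ) • of n := by
  let f : SDClass k D →₀ ℚ := ofSMul u m
  refine ⟨f.support, fun y hy => ?_, ?_⟩
  · rw [Finsupp.mem_support_iff]
    show (SDClass.hallNumber u m y : ℚ) ≠ 0
    exact_mod_cast hy
  · refine (Finsupp.sum_single f).symm.trans (Finset.sum_congr rfl fun y _ => ?_)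
    show _ = (_ : ℚ) • (Finsupp.single y 1 : SDClass k D →₀ ℚ)
    rw [Finsupp.smul_single, smul_eq_mul, mul_one]; rfl

theorem coeff_actMap_ofMul (u v : RepClass k Q) (m : SDClass k D) (N : SDRep k D) :
    coeff (SDClass.mk N) (actMap (HallAlgebra.ofMul u v) (of m)) =
      Nat.card (SDRep.Flags u v m N) := by
  obtain ⟨S, hS, h⟩ := HallAlgebra.ofMul_eq_sum u v
  rw [h, ← Nat.card_congr (SDRep.flagsEquiv₁ u v m N), ← finsum_card]
  simp only [map_sum, LinearMap.sum_apply, map_smul, LinearMap.smul_apply, actMap_of, coeff_ofSMul,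
    smul_eq_mul]
  exact_mod_cast sum_mul_card_fiber (fun B : N.Sub => RepClass.mk B.toRep)
    (fun B => ∃ h : N.IsIsotropic B, SDClass.mk (N.reduce B h) = m)
    (RepClass.hallNumber u v) S hS

theorem coeff_actMap_ofSMul (u v : RepClass k Q) (m : SDClass k D) (N : SDRep k D) :
    coeff (SDClass.mk N) (actMap (HallAlgebra.of u) (ofSMul v m)) =
      Nat.card (SDRep.Flags u v m N) := by
  obtain ⟨S, hS, h⟩ := ofSMul_eq_sum v m
  have h4 : ∀ y, SDClass.hallNumber u y (SDClass.mk N) =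
      Nat.card {A : {A : N.Sub // N.IsIsotropic A} //
        SDClass.mk (N.reduce A.1 A.2) = y ∧ RepClass.mk A.1.toRep = u} := fun y =>
    Nat.card_congr ⟨fun A => ⟨⟨A.1, A.2.2.1⟩, A.2.2.2, A.2.1⟩,
      fun A => ⟨A.1.1, A.2.2, A.1.2, A.2.1⟩, fun _ => rfl, fun _ => rfl⟩
  have : ∀ A : {A : {A : N.Sub // N.IsIsotropic A} // RepClass.mk A.1.toRep = u},
      Finite (N.reduce A.1.1 A.1.2).Sub := fun A => QuiverRep.finite_sub _
  rw [h, ← Nat.card_congr (SDRep.flagsEquiv₂ u v m N), ← finsum_card]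
  simp only [map_sum, map_smul, actMap_of, coeff_ofSMul, smul_eq_mul, h4]
  exact_mod_cast sum_mul_card_fiber
    (fun A : {A : N.Sub // N.IsIsotropic A} => SDClass.mk (N.reduce A.1 A.2))
    (fun A => RepClass.mk A.1.toRep = u) (SDClass.hallNumber v m) S hS

theorem mul_smul' (a b : HallAlgebra k Q) (m : HallModule k D) :
    actMap (HallAlgebra.mulMap a b) m = actMap a (actMap b m) := by
  induction a using HallAlgebra.induction with
  | h0 => simp
  | hadd a a' h h' => simp only [map_add, LinearMap.add_apply, h, h']
  | hsmul x u =>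
    induction b using HallAlgebra.induction with
    | h0 => simp
    | hadd a a' h h' => simp only [map_add, LinearMap.add_apply, h, h']
    | hsmul y v =>
      induction m using induction with
      | h0 => simp
      | hadd a a' h h' => simp only [map_add, h, h']
      | hsmul z w =>
        simp only [map_smul, LinearMap.smul_apply, actMap_of, HallAlgebra.mulMap_of]
        congr 3
        exact ext_coeff fun X =>
          (coeff_actMap_ofMul u v w X).trans (coeff_actMap_ofSMul u v w X).symm

theorem ofSMul_zero (m : SDClass k D) : ofSMul (RepClass.mk (QuiverRep.zero k Q)) m = of m := by
  classical
  refine ext_coeff fun N => ?_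
  rw [coeff_ofSMul, coeff_of]
  have : SDClass.hallNumber (RepClass.mk (QuiverRep.zero k Q)) m (SDClass.mk N) =
      if m = SDClass.mk N then 1 else 0 := by
    refine card_subtype_eq_single _ (QuiverRep.Sub.bot N.toQuiverRep) _ fun W => ?_
    rw [QuiverRep.Sub.eq_bot_iff]
    refine and_congr_right ?_
    rintro rfl
    constructor
    · rintro ⟨h, rfl⟩
      exact N.reduce_bot h
    · rintro rfl
      exact ⟨N.isIsotropic_bot, N.reduce_bot _⟩
  rw [this]; split_ifs <;> simp

noncomputable instance : Module (HallAlgebra k Q) (HallModule k D) where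
  mul_smul := mul_smul'
  one_smul m := by
    show actMap _ m = m
    induction m using induction with
    | h0 => rw [map_zero]
    | hadd a a' h h' => rw [map_add, h, h']
    | hsmul x u => rw [map_smul, HallAlgebra.one_def, actMap_of, ofSMul_zero]
  smul_zero a := (actMap a).map_zero
  smul_add a m n := (actMap a).map_add m n
  add_smul a b m := by
    show actMap (a + b) m = actMap a m + actMap b m
    rw [map_add, LinearMap.add_apply]
  zero_smul m := by
    show actMap 0 m = 0
    rw [map_zero, LinearMap.zero_apply]

/-- The action on the bases. -/
theorem of_smul_of (u : RepClass k Q) (m : SDClass k D) :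
    HallAlgebra.of u • of m = ofSMul u m := actMap_of u m

end HallModule

end Associativity

/-! ### The integration maps -/

section Integration

variable {k : Type u} [Field k] {Q : Type v} [Quiver.{w} Q] [Fintype Q]
  [Fintype (Quiver.Total Q)]

/-- The Hall algebra integration map,
`[U] ↦ q^{χ(dim U, dim U) / 2} / #Aut(U) • x_{dim U}`, extended `ℚ`-linearly. -/
noncomputable def intH : HallAlgebra k Q →ₗ[ℚ] QTorus k Q :=
  Finsupp.linearCombination ℚ fun u : RepClass k Q =>
    (sqrtq (Nat.card k) ^ euler (toInt u.dim) (toInt u.dim) / (u.cardAut : HalfField (Nat.card k))) •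
      (QTorus.x u.dim : QTorus k Q)

/-- The Hall module integration map,
`[M] ↦ q^{ℰ(dim M) / 2} / #Aut_S(M) • ξ_{dim M}`, extended `ℚ`-linearly. -/
noncomputable def intM {σ : Involution Q} (D : Duality σ) : HallModule k D →ₗ[ℚ] QModule k D :=
  Finsupp.linearCombination ℚ fun m : SDClass k D =>
    (sqrtq (Nat.card k) ^ sdEuler D (toInt m.dim.val) / (m.cardAut : HalfField (Nat.card k))) •
      (QModule.ξ m.dim : QModule k D)

end Integration

end SelfDualQuiver

open SelfDualQuiver

/-! By bilinearity it is enough to treat basis elements [U] and [M]. Every N that occurs in [U] ⋆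
[M] has dimension vector H(dim U) + dim M, so the claim is an identity of scalars: the sum over N of
G^N_{U,M} / #Aut_S(N) must equal q^{-χ(dim M, dim U) - ℰ(dim U)} / (#Aut(U) #Aut_S(M)).

This sum comes from a double count. Let V = U ⊕ M ⊕ U^∨ carry the form of M plus the hyperbolic
form, and call a graded isometry ψ : V → N adapted if ψ(U) is a subrepresentation isomorphic to U
through ψ and the structure maps of N act on ψ(M) as those of M modulo ψ(U).

Transporting the structure maps of N to V, an adapted ψ is the same as a family of block-triangular
maps over the arrows, compatible with the form, together with an isometry from the resulting
deformation of the hyperbolic sum to N (`card_adapted`).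

On the other hand, an adapted ψ determines a unique isotropic W ≃ U in N with an isometry M ≃ N //
W. The ψ over a given such datum form a torsor under the unipotent isometries of V that preserve U ⊂
U ⊕ M ⊂ V and are trivial on the graded pieces (`card_adapted_eq_mul`). As 2 is invertible, the
exponential identifies this group with its Lie algebra, a family of the same kind over the nodes,
with sign -1.

Dividing by #Aut_S(N) and summing over N counts each deformation once (`sum_hallNumber_div`). What
is left is the quotient of the numbers of families over arrows and over nodes. Both are computed by
`card_nilMaps`: the free blocks M → U give χ(dim M, dim U), and the blocks U^∨ → U with a sign
symmetry give ℰ(dim U). The cocycle identity `exponent_eq` then matches the powers of q^{1/2}. -/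

namespace SelfDualQuiver

/-! ### Counting functions with a sign symmetry under an involution -/

section SignedInvolution

/-- The number of functions on a finite set that transform by a sign under an involution. -/
theorem card_signed_functions {k : Type*} [Field k] [Finite k] (h2 : (2 : k) ≠ 0) {P : Type*}
    [Fintype P] [DecidableEq P] (f : P → P) (hf : ∀ p, f (f p) = p) (ε : P → ℤˣ)
    (hε : ∀ p, ε (f p) = ε p) :
    ∃ R : ℕ, Nat.card {g : P → k // ∀ p, g (f p) = ((ε p : ℤ) : k) * g p} = Nat.card k ^ R ∧
      (2 * R : ℤ) = Fintype.card P + ∑ p with f p = p, (ε p : ℤ) := by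
  classical
  -- An auxiliary total order selects one element of each two-element orbit.
  let _ : LinearOrder P := LinearOrder.lift' (Fintype.equivFin P) (Equiv.injective _)
  have hsq : ∀ p, ((ε p : ℤ) : k) * ((ε p : ℤ) : k) = 1 := fun p => by
    rcases Int.units_eq_one_or (ε p) with h | h <;> simp [h]
  let S : Finset P := Finset.univ.filter fun p => p < f p
  let S' : Finset P := Finset.univ.filter fun p => f p < p
  let F : Finset P := Finset.univ.filter fun p => f p = p
  let F₁ : Finset P := F.filter fun p => ε p = 1
  let F₂ : Finset P := F.filter fun p => ¬ ε p = 1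
  -- The values are free at the smaller element of each two-element orbit and at the fixed points of
  -- sign 1. The larger element of an orbit gets a determined value, and at a fixed point of sign -1
  -- the condition g p = -g p forces 0 because 2 ≠ 0.
  refine ⟨(S ∪ F₁).card, ?_, ?_⟩
  · let φ : {g : P → k // ∀ p, g (f p) = ((ε p : ℤ) : k) * g p} → ((S ∪ F₁ : Finset P) → k) :=
      fun g p => g.1 p.1
    have hφ : Function.Bijective φ := by
      constructor
      · intro g g' h
        have h1 : ∀ p ∈ S ∪ F₁, g.1 p = g'.1 p := fun p hp => congrFun h ⟨p, hp⟩
        refine Subtype.ext (funext fun p => ?_)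
        rcases lt_trichotomy p (f p) with hp | hp | hp
        · exact h1 p (by simp [S, hp])
        · by_cases he : ε p = 1
          · exact h1 p (by simp [F₁, F, hp.symm, he])
          · have he' : ε p = -1 := (Int.units_eq_one_or _).resolve_left he
            have key : ∀ g : {g : P → k // ∀ p, g (f p) = ((ε p : ℤ) : k) * g p}, g.1 p = 0 := by
              intro g
              have := g.2 p
              rw [← hp, he'] at this
              have h3 : 2 * g.1 p = 0 := by
                push_cast at this
                linear_combination this
              exact (mul_eq_zero.1 h3).resolve_left h2
            rw [key g, key g']
        · have h3 := h1 (f p) (by simp [S, hp, hf])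
          have h4 := g.2 (f p)
          have h5 := g'.2 (f p)
          rw [hf] at h4 h5
          rw [h4, h5, h3]
      · intro a
        let a' : P → k := fun p => if h : p ∈ S ∪ F₁ then a ⟨p, h⟩ else 0
        refine ⟨⟨fun p => if f p < p then ((ε p : ℤ) : k) * a' (f p) else a' p, fun p => ?_⟩, ?_⟩
        · simp only [hf, hε]
          rcases lt_trichotomy p (f p) with hp | hp | hp
          · rw [if_pos hp, if_neg (not_lt.2 hp.le)]
          · rw [← hp, if_neg (lt_irrefl p)]
            by_cases he : ε p = 1
            · simp [he]
            · have : p ∉ S ∪ F₁ := by simp [S, F₁, he, ← hp]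
              have h0 : a' p = 0 := dif_neg this
              rw [h0, mul_zero]
          · rw [if_neg (not_lt.2 hp.le), if_pos hp, ← mul_assoc, hsq, one_mul]
        · funext p
          obtain ⟨p, hp⟩ := p
          have h1 : ¬ f p < p := by
            rcases Finset.mem_union.1 hp with h | h
            · exact not_lt.2 (Finset.mem_filter.1 h).2.le
            · have := (Finset.mem_filter.1 (Finset.mem_filter.1 h).1).2
              rw [this]; exact lt_irrefl p
          show (if f p < p then _ else a' p) = _
          rw [if_neg h1]
          exact dif_pos hp
    rw [Nat.card_congr (Equiv.ofBijective φ hφ), Nat.card_fun,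
      Nat.card_eq_fintype_card (α := (S ∪ F₁ : Finset P)),
      Fintype.card_coe]
  -- Here `P` has 2 #`S` + #`F₁` + #`F₂` elements, and the signs at the fixed points add up to #`F₁`
  -- - #`F₂`.
  · have hSS' : S.card = S'.card := by
      refine Finset.card_bij' (fun p _ => f p) (fun p _ => f p) ?_ ?_ ?_ ?_ <;>
        simp +contextual [S, S', hf]
    have hF : F₁.card + F₂.card = F.card := Finset.card_filter_add_card_filter_not _
    have hd : Disjoint S F₁ := by
      rw [Finset.disjoint_left]
      intro p hp hp'
      have := (Finset.mem_filter.1 (Finset.mem_filter.1 hp').1).2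
      have h' := (Finset.mem_filter.1 hp).2
      rw [this] at h'
      exact lt_irrefl p h'
    have htot : Fintype.card P = S.card + S'.card + F.card := by
      rw [← Finset.card_univ]
      have h1 : (Finset.univ : Finset P) = (S ∪ S') ∪ F := by
        ext p
        rcases lt_trichotomy p (f p) with hp | hp | hp
        · simp [S, hp]
        · simp [F, hp.symm]
        · simp [S', hp]
      rw [h1, Finset.card_union_of_disjoint, Finset.card_union_of_disjoint]
      · rw [Finset.disjoint_left]
        intro p hp hp'
        exact lt_asymm (Finset.mem_filter.1 hp).2 (Finset.mem_filter.1 hp').2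
      · rw [Finset.disjoint_left]
        intro p hp hp'
        have h3 := (Finset.mem_filter.1 hp').2
        rcases Finset.mem_union.1 hp with h | h
        · have := (Finset.mem_filter.1 h).2
          rw [h3] at this; exact lt_irrefl p this
        · have := (Finset.mem_filter.1 h).2
          rw [h3] at this; exact lt_irrefl p this
    have hsum : ∑ p ∈ F, (ε p : ℤ) = F₁.card - F₂.card := by
      rw [← Finset.sum_filter_add_sum_filter_not F (fun p => ε p = 1)]
      rw [Finset.sum_congr (g := fun _ => (1 : ℤ)) rfl (fun p hp => by
        rw [(Finset.mem_filter.1 hp).2]; rfl)]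
      rw [Finset.sum_congr (s₁ := F.filter fun p => ¬ ε p = 1) (g := fun _ => (-1 : ℤ)) rfl
        (fun p hp => by
        rw [(Int.units_eq_one_or _).resolve_left (Finset.mem_filter.1 hp).2]; rfl)]
      simp [F₁, F₂, sub_eq_add_neg]
    rw [hsum, Finset.card_union_of_disjoint hd]
    push_cast
    omega

end SignedInvolution

/-! ### The graded dual of a representation and its pairing -/

section Pairing

variable {k : Type u} [Field k] {Q : Type v} [Quiver.{w} Q] {σ : Involution Q}

namespace QuiverRep

/-- The space at `i` of the graded dual of a representation. -/
abbrev DualV (σ : Involution Q) (U : QuiverRep k Q) (i : Q) : Type u := Dual k (U.V (σ.node i))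

/-- The identification of the graded dual with the dual at a node `j = σ i`. -/
def dualEquiv (σ : Involution Q) (U : QuiverRep k Q) (i j : Q) (h : j = σ.node i) :
    U.DualV σ i ≃ₗ[k] Dual k (U.V j) := by
  subst h; exact LinearEquiv.refl k _

open Classical in
/-- The pairing of the graded dual of a representation with the representation. -/
noncomputable def pairing (σ : Involution Q) (U : QuiverRep k Q) (i j : Q) :
    U.DualV σ i →ₗ[k] U.V j →ₗ[k] k :=
  if h : j = σ.node i then (U.dualEquiv σ i j h).toLinearMap else 0

variable (U : QuiverRep k Q)

theorem pairing_orth {i j : Q} (h : i ≠ σ.node j) : U.pairing σ i j = 0 :=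
  dif_neg fun hj => h (by rw [hj, σ.node_node])

theorem pairing_bijective {i j : Q} (h : i = σ.node j) :
    Function.Bijective (U.pairing σ i j) := by
  have hj : j = σ.node i := by rw [h, σ.node_node]
  rw [pairing, dif_pos hj]
  exact (U.dualEquiv σ i j hj).bijective

/-- This is double duality for finite dimensional spaces. -/
theorem pairing_flip_bijective {i j : Q} (h : i = σ.node j) :
    Function.Bijective (U.pairing σ i j).flip := by
  have hj : j = σ.node i := by rw [h, σ.node_node]
  rw [pairing, dif_pos hj]
  subst hj
  exact (evalEquiv k (U.V (σ.node i))).bijective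

/-- A vector of the graded dual with prescribed values. -/
theorem exists_pairing_eq {i j : Q} (h : i = σ.node j) {E : Type*} [AddCommGroup E] [Module k E]
    (B : E →ₗ[k] U.V j →ₗ[k] k) :
    ∃ g : E →ₗ[k] U.DualV σ i, ∀ x u, U.pairing σ i j (g x) u = B x u := by
  let e := LinearEquiv.ofBijective _ (U.pairing_bijective h)
  exact ⟨e.symm.toLinearMap ∘ₗ B, fun x u => LinearMap.congr_fun (e.apply_symm_apply (B x)) u⟩

/-- A vector of the representation with prescribed pairings. -/
theorem exists_pairing_flip_eq {i j : Q} (h : i = σ.node j) {E : Type*} [AddCommGroup E]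
    [Module k E] (B : E →ₗ[k] U.DualV σ i →ₗ[k] k) :
    ∃ g : E →ₗ[k] U.V j, ∀ x w, U.pairing σ i j w (g x) = B x w := by
  let e := LinearEquiv.ofBijective _ (U.pairing_flip_bijective h)
  exact ⟨e.symm.toLinearMap ∘ₗ B, fun x u => LinearMap.congr_fun (e.apply_symm_apply (B x)) u⟩

theorem finrank_dualV (i : Q) : finrank k (U.DualV σ i) = U.dim (σ.node i) :=
  Subspace.dual_finrank_eq

/-- The map is the signed transpose of the map of the arrow σ(a). It is characterized through the
pairing, so that no vector has to be transported along σ(σ(i)) = i. -/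
theorem exists_dualMap (D : Duality σ) (a : Quiver.Total Q) :
    ∃ g : U.DualV σ a.left →ₗ[k] U.DualV σ a.right, ∀ w u,
      U.pairing σ a.right (σ.arrow a).left (g w) u =
        ((D.τ a : ℤ) : k) * U.pairing σ a.left (σ.arrow a).right w (U.map (σ.arrow a).hom u) := by
  obtain ⟨g, hg⟩ := U.exists_pairing_eq (σ := σ) (i := a.right) (j := (σ.arrow a).left)
    (by rw [σ.left_arrow, σ.node_node])
    (((D.τ a : ℤ) : k) • (U.pairing σ a.left (σ.arrow a).right).compl₂ (U.map (σ.arrow a).hom))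
  exact ⟨g, fun w u => by rw [hg]; rfl⟩

/-- The structure maps of the dual representation, with the signs of a duality structure. -/
noncomputable def dualMap (D : Duality σ) {i j : Q} (a : i ⟶ j) :
    U.DualV σ i →ₗ[k] U.DualV σ j := (U.exists_dualMap D ⟨i, j, a⟩).choose

/-- The separate arrow `b` allows the use for the pair (σ(a), a), where σ(σ(a)) = a is not a
definitional equality. -/
theorem pairing_dualMap (D : Duality σ) (a b : Quiver.Total Q) (h : b = σ.arrow a)
    (w : U.DualV σ a.left) (u : U.V b.left) :
    U.pairing σ a.right b.left (U.dualMap D a.hom w) u =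
      ((D.τ a : ℤ) : k) * U.pairing σ a.left b.right w (U.map b.hom u) := by
  subst h
  exact (U.exists_dualMap D a).choose_spec w u

end QuiverRep

end Pairing

/-! ### Signs in the ground field -/

section Units

variable {k : Type u} [Field k] {Q : Type v} [Quiver.{w} Q] {σ : Involution Q}

theorem units_cast_mul_self (ε : ℤˣ) : ((ε : ℤ) : k) * ((ε : ℤ) : k) = 1 := by
  rcases Int.units_eq_one_or ε with h | h <;> simp [h]

theorem Duality.s_cast_mul (D : Duality σ) {i j : Q} (h : i = σ.node j) :
    ((D.s i : ℤ) : k) * ((D.s j : ℤ) : k) = 1 := by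
  rw [h, D.s_node, units_cast_mul_self]

end Units

/-! ### The orthogonal sum of M and the hyperbolic representation on U -/

section Hyperbolic

variable {k : Type u} [Field k] {Q : Type v} [Quiver.{w} Q] {σ : Involution Q} {D : Duality σ}

namespace SDRep

/-- The spaces of the orthogonal sum of `M` and of the hyperbolic representation on `U`. -/
abbrev HypV (U : QuiverRep k Q) (M : SDRep k D) (i : Q) : Type u :=
  U.V i × M.V i × U.DualV σ i

/-- The form of the orthogonal sum of `M` and of the hyperbolic representation on `U`. -/
noncomputable def hypForm (U : QuiverRep k Q) (M : SDRep k D) (i j : Q) :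
    HypV U M i →ₗ[k] HypV U M j →ₗ[k] k :=
  LinearMap.mk₂ k
    (fun x y => M.form i j x.2.1 y.2.1 + U.pairing σ i j x.2.2 y.1 +
      ((D.s i : ℤ) : k) * U.pairing σ j i y.2.2 x.1)
    (fun x x' y => by simp only [Prod.fst_add, Prod.snd_add, map_add, LinearMap.add_apply]; ring)
    (fun c x y => by
      simp only [Prod.smul_fst, Prod.smul_snd, map_smul, LinearMap.smul_apply, smul_eq_mul]; ring)
    (fun x y y' => by simp only [Prod.fst_add, Prod.snd_add, map_add, LinearMap.add_apply]; ring)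
    (fun c x y => by
      simp only [Prod.smul_fst, Prod.smul_snd, map_smul, LinearMap.smul_apply, smul_eq_mul]; ring)

theorem hypForm_apply (U : QuiverRep k Q) (M : SDRep k D) (i j : Q) (x : HypV U M i)
    (y : HypV U M j) : hypForm U M i j x y =
      M.form i j x.2.1 y.2.1 + U.pairing σ i j x.2.2 y.1 +
        ((D.s i : ℤ) : k) * U.pairing σ j i y.2.2 x.1 := rfl

theorem hypForm_orth (U : QuiverRep k Q) (M : SDRep k D) {i j : Q} (h : i ≠ σ.node j) :
    hypForm U M i j = 0 := by
  have h' : j ≠ σ.node i := fun hj => h (by rw [hj, σ.node_node])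
  refine LinearMap.ext fun x => LinearMap.ext fun y => ?_
  simp [hypForm_apply, M.form_orth i j h, U.pairing_orth h, U.pairing_orth h']

theorem hypForm_symm (U : QuiverRep k Q) (M : SDRep k D) (i j : Q) (x : HypV U M i)
    (y : HypV U M j) : hypForm U M i j x y = ((D.s i : ℤ) : k) * hypForm U M j i y x := by
  by_cases h : i = σ.node j
  · rw [hypForm_apply, hypForm_apply, M.form_symm i j]
    linear_combination (-U.pairing σ i j x.2.2 y.1) * D.s_cast_mul (k := k) h
  · have h' : j ≠ σ.node i := fun hj => h (by rw [hj, σ.node_node])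
    rw [hypForm_orth U M h, hypForm_orth U M h']; simp

/-- Testing against a vector of M, of U or of the dual of U isolates the component of `x` in M, in
the dual of U or in U, respectively. -/
theorem hypForm_nondeg (U : QuiverRep k Q) (M : SDRep k D) (i : Q) (x : HypV U M i)
    (h : ∀ j y, hypForm U M i j x y = 0) : x = 0 := by
  simp only [hypForm_apply] at h
  obtain ⟨x₁, x₂, x₃⟩ := x
  have h1 : x₂ = 0 := M.form_nondeg i x₂ fun j y => by simpa using h j (0, y, 0)
  have h2 : x₃ = 0 := by
    refine (U.pairing_bijective (σ := σ) (i := i) (j := σ.node i) (σ.node_node i).symm).1 ?_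
    rw [map_zero]
    exact LinearMap.ext fun u => by simpa using h _ (u, 0, 0)
  have h3 : x₁ = 0 := by
    refine (U.pairing_flip_bijective (σ := σ) (i := σ.node i) (j := i) rfl).1 ?_
    rw [map_zero]
    refine LinearMap.ext fun w => ?_
    have := h _ (0, 0, w)
    have hs : ((D.s i : ℤ) : k) ≠ 0 := left_ne_zero_of_mul_eq_one (units_cast_mul_self (D.s i))
    simpa [hs] using this
  rw [h1, h2, h3]; rfl

/-- The structure maps of the orthogonal sum of `M` and of the hyperbolic representation on
`U`. -/
noncomputable def hypMap (U : QuiverRep k Q) (M : SDRep k D) {i j : Q} (a : i ⟶ j) :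
    HypV U M i →ₗ[k] HypV U M j :=
  (U.map a).prodMap ((M.map a).prodMap (U.dualMap D a))

theorem hypMap_apply (U : QuiverRep k Q) (M : SDRep k D) {i j : Q} (a : i ⟶ j)
    (x : HypV U M i) : hypMap U M a x = (U.map a x.1, M.map a x.2.1, U.dualMap D a x.2.2) := rfl

/-- One of the two pairing terms is the defining property of the dual map at `a`, the other that of
the dual map at σ(a). The signs of the latter agree because of the condition on τ_a τ_{σ(a)}. -/
theorem hypForm_hypMap (U : QuiverRep k Q) (M : SDRep k D) (a : Quiver.Total Q)
    (x : HypV U M a.left) (y : HypV U M (σ.arrow a).left) :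
    hypForm U M a.right (σ.arrow a).left (hypMap U M a.hom x) y =
      ((D.τ a : ℤ) : k) *
        hypForm U M a.left (σ.arrow a).right x (hypMap U M (σ.arrow a).hom y) := by
  have h1 := M.form_map a x.2.1 y.2.1
  have h2 := U.pairing_dualMap D a (σ.arrow a) rfl x.2.2 y.1
  have h3 := U.pairing_dualMap D (σ.arrow a) a (σ.arrow_arrow a).symm y.2.2 x.1
  have h4 : ((D.τ a : ℤ) : k) * ((D.τ (σ.arrow a) : ℤ) : k) =
      ((D.s a.left : ℤ) : k) * ((D.s a.right : ℤ) : k) := by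
    have := congrArg (fun z : ℤˣ => ((z : ℤ) : k)) (D.τ_mul a)
    simpa using this
  have h5 := units_cast_mul_self (k := k) (D.s a.left)
  simp only [hypForm_apply, hypMap_apply]
  rw [h1, h2, h3]
  linear_combination
    (-((D.s a.left : ℤ) : k) * U.pairing σ (σ.arrow a).left a.right y.2.2 (U.map a.hom x.1)) * h4
    - ((D.s a.right : ℤ) : k) *
      U.pairing σ (σ.arrow a).left a.right y.2.2 (U.map a.hom x.1) * h5

end SDRep

end Hyperbolic

/-! ### Block-triangular families compatible with the form, over arrows or over nodes, and their
number -/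

section NilMaps

/-- A family of pairs of nodes `l x`, `r x` with an involution and signs, of the kind given by the
arrows of a quiver with a duality structure. -/
structure TwistedPairs {Q : Type v} [Quiver.{w} Q] {σ : Involution Q} (D : Duality σ)
    (I : Type*) where
  l : I → Q
  r : I → Q
  inv : I → I
  inv_inv : ∀ x, inv (inv x) = x
  l_inv : ∀ x, l (inv x) = σ.node (r x)
  t : I → ℤˣ
  t_mul : ∀ x, t x * t (inv x) = D.s (l x) * D.s (r x)

variable {k : Type u} [Field k] {Q : Type v} [Quiver.{w} Q] {σ : Involution Q} {D : Duality σ}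
  {I : Type*}

/-- The arrows of a quiver with a duality structure. -/
abbrev TwistedPairs.arrows (D : Duality σ) : TwistedPairs D (Quiver.Total Q) where
  l := Quiver.Total.left
  r := Quiver.Total.right
  inv := σ.arrow
  inv_inv := σ.arrow_arrow
  l_inv := σ.left_arrow
  t := D.τ
  t_mul := D.τ_mul

/-- The nodes of a quiver with a duality structure, with negative signs. -/
abbrev TwistedPairs.nodes (D : Duality σ) : TwistedPairs D Q where
  l i := i
  r i := i
  inv := σ.node
  inv_inv := σ.node_node
  l_inv _ := rfl
  -- With this sign, compatibility with the form is skew-adjointness, so families over the nodes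
  -- form the Lie algebra of the unipotent isometries.
  t _ := -1
  t_mul i := by
    rcases Int.units_eq_one_or (D.s i) with h | h <;> simp [h]

namespace TwistedPairs

variable (T : TwistedPairs D I)

theorem r_inv (x : I) : T.r (T.inv x) = σ.node (T.l x) := by
  have := T.l_inv (T.inv x)
  rw [T.inv_inv] at this
  rw [this, σ.node_node]

/-- The sign of the symmetry of the block at `x`. -/
def sign (x : I) : ℤˣ := T.t x * D.s (T.r x)

/-- Blocks interchanged by transposition thus have the same symmetry, as `card_signed_functions`
requires. -/
theorem sign_inv (x : I) : T.sign (T.inv x) = T.sign x := by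
  have h := T.t_mul x
  have h1 := Int.units_mul_self (T.t x)
  have h2 := Int.units_mul_self (D.s (T.r x))
  have h3 := Int.units_mul_self (D.s (T.l x))
  unfold sign
  rw [T.r_inv, D.s_node]
  calc T.t (T.inv x) * D.s (T.l x) = T.t x * (T.t x * T.t (T.inv x)) * D.s (T.l x) := by
        rw [← mul_assoc, h1, one_mul]
    _ = T.t x * D.s (T.r x) * (D.s (T.l x) * D.s (T.l x)) := by
        rw [h]; simp only [mul_assoc, mul_comm]
    _ = _ := by rw [h3, mul_one]

end TwistedPairs

/-- Families of linear maps `V (l x) → V (r x)` between the spaces of `V = HypV U M` that vanish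
on `U`, map `U^⊥` to `U`, and are compatible with the form. -/
structure NilMaps (T : TwistedPairs D I) (U : QuiverRep k Q) (M : SDRep k D) where
  map : ∀ x, SDRep.HypV U M (T.l x) →ₗ[k] SDRep.HypV U M (T.r x)
  map_left : ∀ x u, map x (u, 0, 0) = 0
  map_mid : ∀ x m, (map x (0, m, 0)).2 = 0
  form_map : ∀ x v v', SDRep.hypForm U M (T.r x) (T.l (T.inv x)) (map x v) v' =
    ((T.t x : ℤ) : k) *
      SDRep.hypForm U M (T.l x) (T.r (T.inv x)) v (map (T.inv x) v')

theorem NilMaps.ext {T : TwistedPairs D I} {U : QuiverRep k Q} {M : SDRep k D}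
    {n n' : NilMaps T U M} (h : ∀ x, n.map x = n'.map x) : n = n' := by
  have : n.map = n'.map := funext h
  cases n; cases n'; cases this; rfl

/-- The families of maps from the dual of `U` to `U` that are compatible with the pairing. -/
abbrev DualMaps (T : TwistedPairs D I) (U : QuiverRep k Q) : Type _ :=
  {b : ∀ x, U.DualV σ (T.l x) →ₗ[k] U.V (T.r x) // ∀ x w w',
    ((D.s (T.r x) : ℤ) : k) * U.pairing σ (T.l (T.inv x)) (T.r x) w' (b x w) =
      ((T.t x : ℤ) : k) * U.pairing σ (T.l x) (T.r (T.inv x)) w (b (T.inv x) w')}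

theorem SDRep.form_bijective (M : SDRep k D) {i j : Q} (h : i = σ.node j) :
    Function.Bijective (M.form i j) := by
  have hj : j = σ.node i := by rw [h, σ.node_node]
  subst hj
  have hd : finrank k (M.V i) = finrank k (Dual k (M.V (σ.node i))) := by
    rw [Subspace.dual_finrank_eq]; exact (M.dim_node i).symm
  exact ⟨M.form_injective i,
    (LinearMap.injective_iff_surjective_of_finrank_eq_finrank hd).1 (M.form_injective i)⟩

/-- A vector with prescribed values of the form. -/
theorem SDRep.exists_form_eq (M : SDRep k D) {i j : Q} (h : i = σ.node j) {E : Type*}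
    [AddCommGroup E] [Module k E] (B : E →ₗ[k] M.V j →ₗ[k] k) :
    ∃ g : E →ₗ[k] M.V i, ∀ x m, M.form i j (g x) m = B x m := by
  let e := LinearEquiv.ofBijective _ (M.form_bijective h)
  exact ⟨e.symm.toLinearMap ∘ₗ B, fun x u => LinearMap.congr_fun (e.apply_symm_apply (B x)) u⟩

variable (T : TwistedPairs D I) (U : QuiverRep k Q) (M : SDRep k D)

-- By adjunction, vanishing on U forces the image to be orthogonal to U, hence to lie in U^⊥ = U ⊕
-- M.
variable {T U M} in
theorem NilMaps.map_snd_snd (n : NilMaps T U M) (x : I) (v : SDRep.HypV U M (T.l x)) :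
    (n.map x v).2.2 = 0 := by
  refine (U.pairing_bijective (σ := σ) (j := T.l (T.inv x))
    (by rw [T.l_inv, σ.node_node])).1 ?_
  rw [map_zero]
  refine LinearMap.ext fun u => ?_
  have := n.form_map x v (u, 0, 0)
  rw [n.map_left] at this
  simpa [SDRep.hypForm_apply] using this

/-- The components of a compatible family of maps. -/
noncomputable def NilMaps.components (n : NilMaps T U M) :
    (∀ x, M.V (T.l x) →ₗ[k] U.V (T.r x)) × DualMaps T U :=
  (fun x => LinearMap.fst k _ _ ∘ₗ n.map x ∘ₗ LinearMap.inr k _ _ ∘ₗ LinearMap.inl k _ _,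
    ⟨fun x => LinearMap.fst k _ _ ∘ₗ n.map x ∘ₗ LinearMap.inr k _ _ ∘ₗ LinearMap.inr k _ _,
    fun x w w' => by
      have := n.form_map x (0, 0, w) (0, 0, w')
      simpa [SDRep.hypForm_apply] using this⟩)

/-- Of the three possibly nonzero blocks, M → U and U^∨ → U are the components. The third, U^∨ → M,
is recovered from the block M → U at `T.inv x` by adjunction, because the form of M is
nondegenerate. -/
theorem NilMaps.components_injective : Function.Injective (NilMaps.components T U M) := by
  intro n n' h
  have ha : ∀ x m, (n.map x (0, m, 0)).1 = (n'.map x (0, m, 0)).1 := fun x m =>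
    LinearMap.congr_fun (congrFun (congrArg Prod.fst h) x) m
  have hb : ∀ x w, (n.map x (0, 0, w)).1 = (n'.map x (0, 0, w)).1 := fun x w =>
    LinearMap.congr_fun (congrFun (congrArg (fun p => p.2.1) h) x) w
  have hm : ∀ x m, n.map x (0, m, 0) = n'.map x (0, m, 0) := fun x m =>
    Prod.ext (ha x m) ((n.map_mid x m).trans (n'.map_mid x m).symm)
  have hc : ∀ n : NilMaps T U M, ∀ x w m, M.form (T.r x) (T.l (T.inv x)) (n.map x (0, 0, w)).2.1 m =
      ((T.t x : ℤ) : k) * U.pairing σ (T.l x) (T.r (T.inv x)) w (n.map (T.inv x) (0, m, 0)).1 :=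
    fun n x w m => by
      have := n.form_map x (0, 0, w) (0, m, 0)
      simpa [SDRep.hypForm_apply] using this
  have hw : ∀ x w, n.map x (0, 0, w) = n'.map x (0, 0, w) := fun x w => by
    refine Prod.ext (hb x w) (Prod.ext ?_ ((n.map_snd_snd x _).trans (n'.map_snd_snd x _).symm))
    refine (M.form_bijective (i := T.r x) (j := T.l (T.inv x))
      (by rw [T.l_inv, σ.node_node])).1 ?_
    refine LinearMap.ext fun m => ?_
    rw [hc, hc, ha]
  refine NilMaps.ext fun x => LinearMap.ext fun v => ?_
  obtain ⟨u, m, w⟩ := v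
  have hv : ((u, m, w) : SDRep.HypV U M (T.l x)) = (u, 0, 0) + (0, m, 0) + (0, 0, w) := by
    simp
  rw [hv]
  simp only [map_add]
  rw [n.map_left, n'.map_left, hm, hw]

/-- The block U^∨ → M is defined as the signed adjoint of M → U. Compatibility with the form then
holds on U^∨ × M by construction, on M × U^∨ by the sign rule `t_mul`, and on U^∨ × U^∨ by the
condition in `DualMaps`. -/
theorem NilMaps.components_surjective : Function.Surjective (NilMaps.components T U M) := by
  rintro ⟨a, b⟩
  -- The free index `y` makes the property usable at `T.inv x` with `y = x`, without a cast along
  -- `T.inv_inv`.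
  have hc : ∀ x, ∃ c : U.DualV σ (T.l x) →ₗ[k] M.V (T.r x), ∀ y, y = T.inv x → ∀ w m,
      M.form (T.r x) (T.l y) (c w) m =
        ((T.t x : ℤ) : k) * U.pairing σ (T.l x) (T.r y) w (a y m) := fun x => by
    obtain ⟨c, hc⟩ := M.exists_form_eq (i := T.r x) (j := T.l (T.inv x))
      (by rw [T.l_inv, σ.node_node])
      (((T.t x : ℤ) : k) • (U.pairing σ (T.l x) (T.r (T.inv x))).compl₂ (a (T.inv x)))
    refine ⟨c, ?_⟩
    rintro y rfl w m
    rw [hc]; rfl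
  choose c hc using hc
  refine ⟨⟨fun x => LinearMap.prod ((a x).coprod (b.1 x) ∘ₗ LinearMap.snd k _ _)
    (LinearMap.prod (c x ∘ₗ LinearMap.snd k _ _ ∘ₗ LinearMap.snd k _ _) 0), ?_, ?_, ?_⟩, ?_⟩
  · intro x u; simp
  · intro x m; simp
  · intro x v v'
    have h1 := hc x _ rfl v.2.2 v'.2.1
    have h2 := hc (T.inv x) x (T.inv_inv x).symm v'.2.2 v.2.1
    have h3 := b.2 x v.2.2 v'.2.2
    have h4 := M.form_symm (T.l x) (T.r (T.inv x)) v.2.1 (c (T.inv x) v'.2.2)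
    have h5 : ((T.t x : ℤ) : k) * ((T.t (T.inv x) : ℤ) : k) =
        ((D.s (T.l x) : ℤ) : k) * ((D.s (T.r x) : ℤ) : k) := by
      have := congrArg (fun z : ℤˣ => ((z : ℤ) : k)) (T.t_mul x)
      simpa using this
    have h6 := units_cast_mul_self (k := k) (D.s (T.l x))
    simp only [SDRep.hypForm_apply, LinearMap.prod_apply, Function.prod, LinearMap.coe_comp,
      Function.comp_apply, LinearMap.snd_apply, LinearMap.coprod_apply, LinearMap.zero_apply,
      map_zero, map_add, add_zero]
    rw [h1, h4, h2]
    linear_combination h3 - (((D.s (T.l x) : ℤ) : k) *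
        U.pairing σ (T.l (T.inv x)) (T.r x) v'.2.2 (a x v.2.1)) * h5 -
      ((D.s (T.r x) : ℤ) : k) * U.pairing σ (T.l (T.inv x)) (T.r x) v'.2.2 (a x v.2.1) * h6
  · refine Prod.ext (funext fun x => LinearMap.ext fun m => ?_)
      (Subtype.ext (funext fun x => LinearMap.ext fun w => ?_))
    · simp [NilMaps.components]
    · simp [NilMaps.components]

/-- The dimensions of the graded dual at the nodes `l x`. -/
noncomputable def blockDim (x : I) : ℕ := finrank k (U.DualV σ (T.l x))

theorem blockDim_eq (x : I) : blockDim T U x = U.dim (T.r (T.inv x)) := by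
  rw [blockDim, QuiverRep.finrank_dualV, T.r_inv]

theorem blockDim_inv (x : I) : blockDim T U (T.inv x) = U.dim (T.r x) := by
  rw [blockDim_eq, T.inv_inv]

/-- The positions of the matrix entries of a family of maps from the dual of `U` to `U`. -/
abbrev BlockIndex : Type _ := Σ x : I, Fin (blockDim T U x) × Fin (blockDim T U (T.inv x))

variable {T U} in
theorem BlockIndex.ext {p q : BlockIndex T U} (h1 : p.1 = q.1) (h2 : p.2.1.val = q.2.1.val)
    (h3 : p.2.2.val = q.2.2.val) : p = q := by
  obtain ⟨x, c, d⟩ := p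
  obtain ⟨y, c', d'⟩ := q
  obtain rfl : x = y := h1
  obtain rfl : c = c' := Fin.ext h2
  obtain rfl : d = d' := Fin.ext h3
  rfl

/-- Transposition of matrix entries. -/
noncomputable def BlockIndex.swap (p : BlockIndex T U) : BlockIndex T U :=
  ⟨T.inv p.1, p.2.2, Fin.cast (by rw [T.inv_inv]) p.2.1⟩

theorem BlockIndex.swap_swap (p : BlockIndex T U) : swap T U (swap T U p) = p :=
  BlockIndex.ext (T.inv_inv _) rfl rfl

/-- Transposing twice returns to the index `T.inv (T.inv x)`, whose chosen basis has to be compared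
with that at `x`. -/
theorem pairing_finBasis_cast {x y : I} (h : x = y) (j : Q) (c : Fin (blockDim T U x))
    (hc : blockDim T U x = blockDim T U y) (u : U.V j) :
    U.pairing σ (T.l y) j (finBasis k (U.DualV σ (T.l y)) (Fin.cast hc c)) u =
      U.pairing σ (T.l x) j (finBasis k (U.DualV σ (T.l x)) c) u := by
  subst h; rfl

/-- The matrix entries of a compatible family of maps from the dual of `U` to `U`. -/
noncomputable def DualMaps.entries (b : DualMaps T U) :
    {g : BlockIndex T U → k // ∀ p, g (BlockIndex.swap T U p) = ((T.sign p.1 : ℤ) : k) * g p} :=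
  ⟨fun p => U.pairing σ (T.l (T.inv p.1)) (T.r p.1) (finBasis k _ p.2.2)
    (b.1 p.1 (finBasis k _ p.2.1)), fun p => by
      have h := b.2 p.1 (finBasis k _ p.2.1) (finBasis k _ p.2.2)
      have h1 := pairing_finBasis_cast T U (T.inv_inv p.1).symm (T.r (T.inv p.1)) p.2.1
        (by rw [T.inv_inv]) (b.1 (T.inv p.1) (finBasis k _ p.2.2))
      refine h1.trans ?_
      have h2 := units_cast_mul_self (k := k) (T.t p.1)
      rw [TwistedPairs.sign]
      push_cast
      linear_combination (-((T.t p.1 : ℤ) : k)) * h -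
        U.pairing σ (T.l p.1) (T.r (T.inv p.1)) (finBasis k _ p.2.1)
          (b.1 (T.inv p.1) (finBasis k _ p.2.2)) * h2⟩

/-- Since the pairing is perfect, a map from the dual of U to U is the same as a bilinear form on
two duals, hence a matrix in the chosen bases. Compatibility becomes symmetry up to sign under
transposition. -/
theorem DualMaps.entries_bijective : Function.Bijective (DualMaps.entries T U) := by
  constructor
  · intro b b' h
    refine Subtype.ext (funext fun x => (finBasis k (U.DualV σ (T.l x))).ext fun c => ?_)
    refine (U.pairing_flip_bijective (σ := σ) (i := T.l (T.inv x)) (j := T.r x) (T.l_inv x)).1 ?_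
    refine (finBasis k (U.DualV σ (T.l (T.inv x)))).ext fun c' => ?_
    exact congrFun (congrArg Subtype.val h) ⟨x, c, c'⟩
  · rintro ⟨g, hg⟩
    have hb : ∀ x, ∃ b : U.DualV σ (T.l x) →ₗ[k] U.V (T.r x), ∀ c c',
        U.pairing σ (T.l (T.inv x)) (T.r x) (finBasis k _ c') (b (finBasis k _ c)) =
          g ⟨x, c, c'⟩ := fun x => by
      obtain ⟨b, hb⟩ := U.exists_pairing_flip_eq (T.l_inv x)
        ((finBasis k (U.DualV σ (T.l x))).constr k fun c =>
          (finBasis k (U.DualV σ (T.l (T.inv x)))).constr k fun c' => (g ⟨x, c, c'⟩ : k))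
      exact ⟨b, fun c c' => by rw [hb, Basis.constr_basis, Basis.constr_basis]⟩
    choose b hb using hb
    refine ⟨⟨b, fun x w w' => ?_⟩, Subtype.ext (funext fun p => hb p.1 p.2.1 p.2.2)⟩
    -- Both sides of the compatibility are bilinear in `w` and `w'`, so basis vectors are enough.
    have key : ((D.s (T.r x) : ℤ) : k) • (U.pairing σ (T.l (T.inv x)) (T.r x)).flip ∘ₗ b x =
        ((T.t x : ℤ) : k) • (U.pairing σ (T.l x) (T.r (T.inv x))).compl₂ (b (T.inv x)) := by
      refine LinearMap.ext_basis (finBasis k _) (finBasis k _) fun c c' => ?_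
      have h1 := hb x c c'
      have h2 := hb (T.inv x) c' (Fin.cast (by rw [T.inv_inv]) c)
      have h2 :=
        (pairing_finBasis_cast T U (T.inv_inv x).symm _ c (by rw [T.inv_inv]) _).symm.trans h2
      have h3 := hg ⟨x, c, c'⟩
      have h4 := units_cast_mul_self (k := k) (T.t x)
      show ((D.s (T.r x) : ℤ) : k) * U.pairing σ _ _ _ _ = ((T.t x : ℤ) : k) * U.pairing σ _ _ _ _
      rw [h1, h2]
      erw [h3]
      rw [TwistedPairs.sign]
      push_cast
      linear_combination (-((D.s (T.r x) : ℤ) : k) * g ⟨x, c, c'⟩) * h4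
    exact LinearMap.congr_fun (LinearMap.congr_fun key w) w'

open Classical in
/-- The number of compatible families of maps. -/
theorem card_nilMaps [Finite k] [Fintype I] (h2 : (2 : k) ≠ 0) : ∃ R : ℕ,
    Nat.card (NilMaps T U M) = Nat.card k ^ (∑ x, M.dim (T.l x) * U.dim (T.r x) + R) ∧
    (2 * R : ℤ) = ∑ x, (U.dim (σ.node (T.l x)) : ℤ) * U.dim (T.r x) +
      ∑ x with T.inv x = x, (T.t x * D.s (T.r x) : ℤ) * U.dim (T.r x) := by
  obtain ⟨R, hR, hR'⟩ := card_signed_functions h2 (BlockIndex.swap T U) (BlockIndex.swap_swap T U)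
    (fun p => T.sign p.1) (fun p => T.sign_inv p.1)
  refine ⟨R, ?_, ?_⟩
  -- The blocks M → U are arbitrary linear maps and account for the sum in the exponent; the blocks
  -- U^∨ → U account for `R`.
  · rw [Nat.card_congr (Equiv.ofBijective _
      ⟨NilMaps.components_injective T U M, NilMaps.components_surjective T U M⟩), Nat.card_prod,
      Nat.card_congr (Equiv.ofBijective _ (DualMaps.entries_bijective T U)), hR, pow_add,
      Nat.card_pi, ← Finset.prod_pow_eq_pow_sum]
    congr 1
    refine Finset.prod_congr rfl fun x _ => ?_
    rw [Module.natCard_eq_pow_finrank (K := k), Module.finrank_linearMap]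
    rfl
  · rw [hR']
    congr 1
    · rw [Fintype.card_sigma]
      push_cast
      refine Finset.sum_congr rfl fun x _ => ?_
      rw [Fintype.card_prod, Fintype.card_fin, Fintype.card_fin, blockDim_eq, blockDim_inv, T.r_inv]
      push_cast; rfl
    -- Transposition fixes exactly the diagonal entries of the blocks with `T.inv x = x`; each such
    -- block contributes its sign times its size.
    · rw [Finset.sum_filter, Fintype.sum_sigma, Finset.sum_filter]
      refine Finset.sum_congr rfl fun x _ => ?_
      by_cases hx : T.inv x = x
      · rw [if_pos hx, Fintype.sum_prod_type]
        have hd : blockDim T U x = blockDim T U (T.inv x) := by rw [hx]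
        have h1 : ∀ c : Fin (blockDim T U x), ∑ c' : Fin (blockDim T U (T.inv x)),
            (if BlockIndex.swap T U ⟨x, c, c'⟩ = ⟨x, c, c'⟩ then (T.sign x : ℤ) else 0) =
              (T.sign x : ℤ) := fun c => by
          rw [Finset.sum_eq_single (Fin.cast hd c)]
          · rw [if_pos]
            exact BlockIndex.ext hx rfl rfl
          · intro c' _ hc'
            rw [if_neg]
            intro h
            refine hc' (Fin.ext ?_)
            exact congrArg (fun p : BlockIndex T U => p.2.1.val) h
          · simp
        simp only [h1]
        rw [Finset.sum_const, Finset.card_univ, Fintype.card_fin, blockDim_eq, hx, nsmul_eq_mul,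
          mul_comm, TwistedPairs.sign]
        push_cast; rfl
      · rw [if_neg hx]
        refine Finset.sum_eq_zero fun p _ => if_neg fun h => hx (congrArg Sigma.fst h)

end NilMaps

/-! ### Splitting off an isotropic subrepresentation together with a dual, as graded spaces -/

section Splitting

variable {k : Type u} [Field k] {Q : Type v} [Quiver.{w} Q] {σ : Involution Q} {D : Duality σ}

/-- An isometry of graded spaces from the orthogonal sum of `M` and of the hyperbolic
representation on `U` to `N`; it is not required to commute with the structure maps. -/
@[ext]
structure HypIsometry (U : QuiverRep k Q) (M N : SDRep k D) where
  equiv : ∀ i, SDRep.HypV U M i ≃ₗ[k] N.V i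
  form_eq : ∀ i j x y, N.form i j (equiv i x) (equiv j y) = SDRep.hypForm U M i j x y

variable {U : QuiverRep k Q} {M N : SDRep k D}

/-- A form-preserving family of linear maps is a family of isomorphisms if the dimensions
agree. -/
theorem exists_hypIsometry (ψ : ∀ i, SDRep.HypV U M i →ₗ[k] N.V i)
    (hdim : ∀ i, finrank k (SDRep.HypV U M i) = finrank k (N.V i))
    (hψ : ∀ i j x y, N.form i j (ψ i x) (ψ j y) = SDRep.hypForm U M i j x y) :
    ∃ φ : HypIsometry U M N, ∀ i x, φ.equiv i x = ψ i x := by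
  -- A vector of the kernel is orthogonal to everything, and the hyperbolic form is nondegenerate.
  have hinj : ∀ i, Function.Injective (ψ i) := fun i => by
    rw [← LinearMap.ker_eq_bot, LinearMap.ker_eq_bot']
    intro x hx
    refine SDRep.hypForm_nondeg U M i x fun j y => ?_
    rw [← hψ, hx, map_zero, LinearMap.zero_apply]
  exact ⟨⟨fun i => LinearEquiv.ofInjectiveOfFinrankEq (ψ i) (hinj i) (hdim i),
    fun i j x y => hψ i j x y⟩, fun i x => rfl⟩

/-- An isometry of graded spaces is compatible with identifications of `U` with a
subrepresentation `W` of `N` and of `M` with `N // W`. -/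
structure HypIsometry.Lifts (ψ : HypIsometry U M N) {W : N.Sub} {hW : N.IsIsotropic W}
    (e : QuiverRep.Iso U W.toRep) (f : SDRep.Isometry M (N.reduce W hW)) : Prop where
  left : ∀ i u, ψ.equiv i (u, 0, 0) = (e.equiv i u).1
  mid : ∀ i m, ∃ y : (N.perp W).toRep.V i,
    y.1 = ψ.equiv i (0, m, 0) ∧ N.reduceMk W i y = f.equiv i m

/-- The quotient of N_i by (W^⊥)_i has the dimension of W_{σ(i)}, which is that of the dual summand.
-/
theorem SDRep.finrank_hypV {W : N.Sub} (hW : N.IsIsotropic W)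
    (e : QuiverRep.Iso U W.toRep) (f : SDRep.Isometry M (N.reduce W hW)) (i : Q) :
    finrank k (SDRep.HypV U M i) = finrank k (N.V i) := by
  have h1 := N.finrank_perp W i
  have h2 := ((W.carrier i).comap ((N.perp W).carrier i).subtype).finrank_quotient_add_finrank
  have h3 := (Submodule.comapSubtypeEquivOfLe (hW i)).finrank_eq
  have h4 : N.dim i = finrank k (N.V i) := rfl
  have h5 : finrank k (U.V i) = finrank k (W.carrier i) := (e.equiv i).finrank_eq
  have h6 : U.dim (σ.node i) = finrank k (W.carrier (σ.node i)) := (e.equiv (σ.node i)).finrank_eq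
  have h7 : finrank k (M.V i) =
    finrank k (_ ⧸ (W.carrier i).comap ((N.perp W).carrier i).subtype) := (f.equiv i).finrank_eq
  rw [finrank_prod, finrank_prod, QuiverRep.finrank_dualV]
  omega

/-- An isotropic subrepresentation splits off, as a graded space with a form, together with a
dual. -/
theorem HypIsometry.exists_lifts (h2 : (2 : k) ≠ 0) {W : N.Sub} {hW : N.IsIsotropic W}
    (e : QuiverRep.Iso U W.toRep) (f : SDRep.Isometry M (N.reduce W hW)) :
    ∃ ψ : HypIsometry U M N, ψ.Lifts e f := by
  let ι : ∀ i, U.V i →ₗ[k] N.V i := fun i => (W.carrier i).subtype ∘ₗ (e.equiv i).toLinearMap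
  have hιW : ∀ i u, ι i u ∈ W.carrier i := fun i u => (e.equiv i u).2
  have hι : ∀ i u, ι i u = 0 → u = 0 := fun i u h =>
    (e.equiv i).map_eq_zero_iff.1 (Subtype.ext h)
  -- M is lifted to W^⊥ by an arbitrary linear section of W^⊥ → W^⊥ / W. The choice does not affect
  -- the form, since W is orthogonal to W^⊥.
  have hs : ∀ i, ∃ s : M.V i →ₗ[k] (N.perp W).toRep.V i, ∀ m, N.reduceMk W i (s m) = f.equiv i m :=
    fun i => by
      obtain ⟨r, hr⟩ := (N.reduceMk W i).exists_rightInverse_of_surjective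
        (LinearMap.range_eq_top.2 (N.reduceMk_surjective W i))
      exact ⟨r ∘ₗ (f.equiv i).toLinearMap, fun m => LinearMap.congr_fun hr (f.equiv i m)⟩
  choose s₀ hs₀ using hs
  let s : ∀ i, M.V i →ₗ[k] N.V i := fun i => ((N.perp W).carrier i).subtype ∘ₗ s₀ i
  have hsp : ∀ i m, s i m ∈ (N.perp W).carrier i := fun i m => (s₀ i m).2
  have Fii : ∀ i j u u', N.form i j (ι i u) (ι j u') = 0 := fun i j u u' =>
    hW i (hιW i u) j _ (hιW j u')
  have Fsi : ∀ i j m u, N.form i j (s i m) (ι j u) = 0 := fun i j m u => hsp i m j _ (hιW j u)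
  have Fis : ∀ i j u m, N.form i j (ι i u) (s j m) = 0 := fun i j u m =>
    N.form_symm_zero (Fsi j i m u)
  have Fss : ∀ i j m m', N.form i j (s i m) (s j m') = M.form i j m m' := fun i j m m' => by
    rw [← f.form_eq, ← hs₀, ← hs₀]; rfl
  -- A first embedding of the dual of U, with the right pairing with U and orthogonal to M. The sum
  -- of U and M embeds in N, so the prescribed values extend along a linear retraction and are
  -- represented by the nondegenerate form of N.
  have hω₀ : ∀ i, ∃ g : U.DualV σ i →ₗ[k] N.V i, ∀ j,
      (∀ w u, N.form i j (g w) (ι j u) = U.pairing σ i j w u) ∧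
      ∀ w m, N.form i j (g w) (s j m) = 0 := fun i => by
    let θ : U.V (σ.node i) × M.V (σ.node i) →ₗ[k] N.V (σ.node i) :=
      (ι (σ.node i)).coprod (s (σ.node i))
    have hθ : LinearMap.ker θ = ⊥ := by
      rw [LinearMap.ker_eq_bot']
      rintro ⟨u, m⟩ h
      have h' : ι _ u + s _ m = 0 := by simpa [θ] using h
      have h3 : N.reduceMk W (σ.node i) (s₀ _ m) = 0 := by
        rw [N.reduceMk_eq_zero]
        have : s _ m = - ι _ u := by rw [eq_neg_iff_add_eq_zero, add_comm]; exact h'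
        show s _ m ∈ _
        rw [this]; exact neg_mem (hιW _ u)
      have hm : m = 0 := (f.equiv (σ.node i)).map_eq_zero_iff.1 ((hs₀ _ m).symm.trans h3)
      rw [hm, map_zero, add_zero] at h'
      rw [hm, hι _ u h']; rfl
    obtain ⟨ρ, hρ⟩ := θ.exists_leftInverse_of_injective hθ
    obtain ⟨g, hg⟩ := N.exists_form_eq (i := i) (j := σ.node i) (σ.node_node i).symm
      ((U.pairing σ i (σ.node i)).compl₂ (LinearMap.fst k _ _ ∘ₗ ρ))
    refine ⟨g, fun j => ?_⟩
    by_cases h : i = σ.node j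
    · have hj : j = σ.node i := by rw [h, σ.node_node]
      subst hj
      have hρu : ∀ u, ρ (ι _ u) = (u, 0) := fun u => by
        have := LinearMap.congr_fun hρ (u, 0)
        simpa [θ] using this
      have hρm : ∀ m, ρ (s _ m) = (0, m) := fun m => by
        have := LinearMap.congr_fun hρ (0, m)
        simpa [θ] using this
      exact ⟨fun w u => by rw [hg, LinearMap.compl₂_apply, LinearMap.comp_apply, hρu]; rfl,
        fun w m => by rw [hg, LinearMap.compl₂_apply, LinearMap.comp_apply, hρm]; simp⟩
    · rw [N.form_orth i j h, U.pairing_orth h]; simp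
  choose ω₀ hω₀ using hω₀
  -- The image of `ω₀` need not be isotropic. It is corrected by vectors of U: each argument
  -- contributes minus one half of the form on this image, by the symmetry up to sign, so the total
  -- cancels. Here 2 must be invertible.
  have hh : ∀ i, ∃ h : U.DualV σ i →ₗ[k] U.V i, ∀ j, j = σ.node i → ∀ w w',
      U.pairing σ j i w' (h w) = -2⁻¹ * N.form j i (ω₀ j w') (ω₀ i w) := fun i => by
    obtain ⟨h, hh⟩ := U.exists_pairing_flip_eq (σ := σ) (i := σ.node i) (j := i) rfl
      ((-2⁻¹ : k) • (N.form (σ.node i) i).flip.compl₁₂ (ω₀ i) (ω₀ (σ.node i)))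
    refine ⟨h, ?_⟩
    rintro j rfl w w'
    rw [hh]; rfl
  choose h hh using hh
  let ω : ∀ i, U.DualV σ i →ₗ[k] N.V i := fun i => ω₀ i + ι i ∘ₗ h i
  have hω : ∀ i w, ω i w = ω₀ i w + ι i (h i w) := fun i w => rfl
  have Fωi : ∀ i j w u, N.form i j (ω i w) (ι j u) = U.pairing σ i j w u := fun i j w u => by
    rw [hω, map_add, LinearMap.add_apply, Fii, (hω₀ i j).1, add_zero]
  have Fωs : ∀ i j w m, N.form i j (ω i w) (s j m) = 0 := fun i j w m => by
    rw [hω, map_add, LinearMap.add_apply, Fis, (hω₀ i j).2, add_zero]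
  have Fiω : ∀ i j u w, N.form i j (ι i u) (ω j w) = ((D.s i : ℤ) : k) * U.pairing σ j i w u :=
    fun i j u w => by rw [N.form_symm, Fωi]
  have Fsω : ∀ i j m w, N.form i j (s i m) (ω j w) = 0 :=
    fun i j m w => N.form_symm_zero (Fωs j i w m)
  have Fωω : ∀ i j w w', N.form i j (ω i w) (ω j w') = 0 := fun i j w w' => by
    by_cases hij : i = σ.node j
    · have hji : j = σ.node i := by rw [hij, σ.node_node]
      have h3 := hh i j hji w w'
      have h4 := hh j i hij w' w
      have h5 : N.form i j (ι i (h i w)) (ω₀ j w') =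
          ((D.s i : ℤ) : k) * U.pairing σ j i w' (h i w) := by
        rw [N.form_symm, (hω₀ j i).1]
      have h6 := N.form_symm i j (ω₀ i w) (ω₀ j w')
      have h7 : (2 : k) * 2⁻¹ = 1 := mul_inv_cancel₀ h2
      simp only [hω, map_add, LinearMap.add_apply]
      rw [Fii, (hω₀ i j).1, h5, h3, h4]
      linear_combination 2⁻¹ * h6 - N.form i j (ω₀ i w) (ω₀ j w') * h7
    · rw [N.form_orth i j hij]; rfl
  let ψ : ∀ i, SDRep.HypV U M i →ₗ[k] N.V i := fun i => (ι i).coprod ((s i).coprod (ω i))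
  have hψ : ∀ i x, ψ i x = ι i x.1 + (s i x.2.1 + ω i x.2.2) := fun i x => rfl
  obtain ⟨φ, hφ⟩ := exists_hypIsometry ψ (SDRep.finrank_hypV hW e f) fun i j x y => by
    simp only [hψ, map_add, LinearMap.add_apply, Fii, Fis, Fiω, Fsi, Fss, Fsω, Fωi, Fωs, Fωω,
      SDRep.hypForm_apply]
    ring
  refine ⟨φ, fun i u => ?_, fun i m => ⟨s₀ i m, ?_, hs₀ i m⟩⟩
  · rw [hφ, hψ]; simp [ι]; rfl
  · rw [hφ, hψ]; simp [s]; rfl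

end Splitting

/-! ### The exponential of nilpotent skew-adjoint maps, and the torsor of splittings -/

section Exponential

variable {k : Type u} [Field k] {Q : Type v} [Quiver.{w} Q] {σ : Involution Q} {D : Duality σ}
  {U : QuiverRep k Q} {M N : SDRep k D}

/-- An endomorphism of the space at a node that vanishes on `U`, maps `U^⊥` to `U` and maps the
whole space to `U^⊥`. -/
structure IsNil {i : Q} (δ : SDRep.HypV U M i →ₗ[k] SDRep.HypV U M i) : Prop where
  left : ∀ u, δ (u, 0, 0) = 0
  mid : ∀ m, (δ (0, m, 0)).2 = 0
  snd_snd : ∀ x, (δ x).2.2 = 0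

namespace IsNil

variable {i : Q} {δ : SDRep.HypV U M i →ₗ[k] SDRep.HypV U M i} (hδ : IsNil δ)
include hδ

theorem apply_of_snd {x : SDRep.HypV U M i} (hx : x.2 = 0) : δ x = 0 := by
  obtain ⟨u, y⟩ := x
  obtain rfl : y = 0 := hx
  exact hδ.left u

theorem apply_snd_of_snd_snd {x : SDRep.HypV U M i} (hx : x.2.2 = 0) : (δ x).2 = 0 := by
  obtain ⟨u, m, y⟩ := x
  obtain rfl : y = 0 := hx
  have : ((u, m, 0) : SDRep.HypV U M i) = (u, 0, 0) + (0, m, 0) := by simp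
  rw [this, map_add, hδ.left, zero_add, hδ.mid]

theorem apply_apply_snd (x : SDRep.HypV U M i) : (δ (δ x)).2 = 0 :=
  hδ.apply_snd_of_snd_snd (hδ.snd_snd x)

/-- The map `δ` lowers the three-step filtration U ⊂ U ⊕ M ⊂ V by one step. -/
theorem apply_apply_apply (x : SDRep.HypV U M i) : δ (δ (δ x)) = 0 :=
  hδ.apply_of_snd (hδ.apply_apply_snd x)

end IsNil

theorem SDRep.hypForm_of_snd {i j : Q} {x : SDRep.HypV U M i} {y : SDRep.HypV U M j}
    (hx : x.2 = 0) (hy : y.2.2 = 0) : SDRep.hypForm U M i j x y = 0 := by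
  simp [hypForm_apply, hx, hy]

theorem NilMaps.isNil (n : NilMaps (TwistedPairs.nodes D) U M) (i : Q) : IsNil (n.map i) :=
  ⟨n.map_left i, n.map_mid i, n.map_snd_snd i⟩

theorem NilMaps.hypForm_map (n : NilMaps (TwistedPairs.nodes D) U M) (i j : Q)
    (x : SDRep.HypV U M i) (y : SDRep.HypV U M j) :
    SDRep.hypForm U M i j (n.map i x) y = - SDRep.hypForm U M i j x (n.map j y) := by
  by_cases h : i = σ.node j
  · obtain rfl : j = σ.node i := by rw [h, σ.node_node]
    have := n.form_map i x y
    simpa using this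
  · rw [SDRep.hypForm_orth U M h]; simp

/-- The truncated exponential series. -/
noncomputable def expMap (δ : ∀ i, SDRep.HypV U M i →ₗ[k] SDRep.HypV U M i) (i : Q) :
    SDRep.HypV U M i →ₗ[k] SDRep.HypV U M i :=
  -- For the maps considered the cube vanishes, so the series ends here and only 2 has to be
  -- inverted, even in small odd characteristic.
  LinearMap.id + δ i + (2⁻¹ : k) • (δ i ∘ₗ δ i)

theorem expMap_apply (δ : ∀ i, SDRep.HypV U M i →ₗ[k] SDRep.HypV U M i) (i : Q)
    (x : SDRep.HypV U M i) : expMap δ i x = x + δ i x + (2⁻¹ : k) • δ i (δ i x) := rfl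

/-- Skew-adjointness moves exp(n) to the other argument as exp(-n). After expansion the terms of
order three and more vanish and the quadratic ones cancel. -/
theorem hypForm_expMap (h2 : (2 : k) ≠ 0) (n : NilMaps (TwistedPairs.nodes D) U M) (i j : Q)
    (x : SDRep.HypV U M i) (y : SDRep.HypV U M j) :
    SDRep.hypForm U M i j (expMap n.map i x) (expMap n.map j y) = SDRep.hypForm U M i j x y := by
  have h3 := (n.isNil j).apply_apply_apply
  have h7 : (2 : k) * 2⁻¹ = 1 := mul_inv_cancel₀ h2
  simp only [expMap_apply, map_add, LinearMap.add_apply, map_smul, LinearMap.smul_apply,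
    n.hypForm_map, h3, map_zero, smul_eq_mul]
  linear_combination (SDRep.hypForm U M i j x (n.map j (n.map j y))) * h7

/-- The isometry `ψ₀ ∘ exp n`. -/
theorem HypIsometry.exists_comp_exp (h2 : (2 : k) ≠ 0) (ψ₀ : HypIsometry U M N)
    (n : NilMaps (TwistedPairs.nodes D) U M) :
    ∃ ψ : HypIsometry U M N, ∀ i x, ψ.equiv i x = ψ₀.equiv i (expMap n.map i x) :=
  exists_hypIsometry (fun i => (ψ₀.equiv i).toLinearMap ∘ₗ expMap n.map i)
    (fun i => (ψ₀.equiv i).finrank_eq) fun i j x y =>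
      (ψ₀.form_eq i j _ _).trans (hypForm_expMap h2 n i j x y)

/-- A unipotent isometry has a logarithm. -/
theorem exists_log (h2 : (2 : k) ≠ 0) (δ : ∀ i, SDRep.HypV U M i →ₗ[k] SDRep.HypV U M i)
    (hδ : ∀ i, IsNil (δ i)) (hform : ∀ i j x y,
      SDRep.hypForm U M i j (x + δ i x) (y + δ j y) = SDRep.hypForm U M i j x y) :
    ∃ n : NilMaps (TwistedPairs.nodes D) U M, ∀ i x, expMap n.map i x = x + δ i x := by
  have h7 : (2 : k) * 2⁻¹ = 1 := mul_inv_cancel₀ h2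
  have hI : ∀ i j x y, SDRep.hypForm U M i j (δ i x) y + SDRep.hypForm U M i j x (δ j y) +
      SDRep.hypForm U M i j (δ i x) (δ j y) = 0 := fun i j x y => by
    have := hform i j x y
    simp only [map_add, LinearMap.add_apply] at this
    linear_combination this
  -- The logarithmic series of 1 + δ, which stops because the cube of δ is zero.
  let n : ∀ i, SDRep.HypV U M i →ₗ[k] SDRep.HypV U M i := fun i => δ i - (2⁻¹ : k) • (δ i ∘ₗ δ i)
  have hn : ∀ i x, n i x = δ i x - (2⁻¹ : k) • δ i (δ i x) := fun i x => rfl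
  -- The isometry relation is used at (x, y), (δx, y), (x, δy) and (δx, δy). The term with δ²x and
  -- δ²y vanishes, since δ²x lies in U and δ²y in U^⊥.
  have hskew : ∀ i j x y, SDRep.hypForm U M i j (n i x) y = - SDRep.hypForm U M i j x (n j y) := by
    intro i j x y
    have h1 := hI i j x y
    have h3 := hI i j (δ i x) y
    have h4 := hI i j x (δ j y)
    have h5 := hI i j (δ i x) (δ j y)
    have h6 : SDRep.hypForm U M i j (δ i (δ i x)) (δ j (δ j y)) = 0 :=
      SDRep.hypForm_of_snd ((hδ i).apply_apply_snd x) ((hδ j).snd_snd _)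
    simp only [hn, map_sub, LinearMap.sub_apply, map_smul, LinearMap.smul_apply, smul_eq_mul]
    linear_combination h1 - 2⁻¹ * (h3 + h4 - h5 + h6) +
      (SDRep.hypForm U M i j (δ i x) (δ j y)) * h7
  have hnn : ∀ i x, n i (n i x) = δ i (δ i x) := fun i x => by
    simp only [hn, map_sub, map_smul, (hδ i).apply_apply_apply, smul_zero, sub_zero]
  refine ⟨⟨n, fun i u => ?_, fun i m => ?_, fun i x y => ?_⟩, fun i x => ?_⟩
  · rw [hn, (hδ i).left]; simp
  · rw [hn, Prod.snd_sub, Prod.smul_snd, (hδ i).apply_apply_snd, (hδ i).mid]; simp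
  · rw [hskew]; simp
  · rw [expMap_apply]
    show x + n i x + (2⁻¹ : k) • n i (n i x) = _
    rw [hnn, hn]; abel

/-- With δ = exp(n) - 1, the logarithm δ - δ²/2 gives back n. -/
theorem expMap_injective {n n' : NilMaps (TwistedPairs.nodes D) U M}
    (h : ∀ i x, expMap n.map i x = expMap n'.map i x) : n = n' := by
  have key : ∀ n : NilMaps (TwistedPairs.nodes D) U M, ∀ i x, n.map i x =
      (expMap n.map i x - x) - (2⁻¹ : k) •
        (expMap n.map i (expMap n.map i x - x) - (expMap n.map i x - x)) := fun n i x => by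
    have h3 := (n.isNil i).apply_apply_apply
    simp only [expMap_apply, map_add, map_sub, map_smul, h3, map_zero, smul_zero, add_zero]
    abel_nf
  refine NilMaps.ext fun i => LinearMap.ext fun x => ?_
  rw [key n, key n', h, h]

variable {W : N.Sub} {hW : N.IsIsotropic W} {e : QuiverRep.Iso U W.toRep}
  {f : SDRep.Isometry M (N.reduce W hW)}

/-- The exponential fixes U and moves vectors of M only by vectors of U, which become zero in N //
W. -/
theorem HypIsometry.Lifts.comp_exp {ψ₀ ψ : HypIsometry U M N} (h₀ : ψ₀.Lifts e f)
    (n : NilMaps (TwistedPairs.nodes D) U M)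
    (hψ : ∀ i x, ψ.equiv i x = ψ₀.equiv i (expMap n.map i x)) : ψ.Lifts e f := by
  refine ⟨fun i u => ?_, fun i m => ?_⟩
  · rw [hψ, expMap_apply, (n.isNil i).left, map_zero, smul_zero, add_zero, add_zero, h₀.left]
  · obtain ⟨y, hy, hy'⟩ := h₀.mid i m
    obtain ⟨u, hu⟩ : ∃ u, n.map i (0, m, 0) = (u, 0, 0) :=
      ⟨(n.map i (0, m, 0)).1, Prod.ext rfl (n.map_mid i m)⟩
    let z : (N.perp W).toRep.V i := ⟨(e.equiv i u).1, hW i (e.equiv i u).2⟩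
    have hz : N.reduceMk W i z = 0 := (N.reduceMk_eq_zero W i z).2 (e.equiv i u).2
    refine ⟨y + z, ?_, ((N.reduceMk W i).map_add y z).trans
      ((congrArg₂ (· + ·) hy' hz).trans (add_zero _))⟩
    rw [hψ, expMap_apply, hu, (n.isNil i).left, smul_zero, add_zero, map_add, h₀.left, ← hy]
    rfl

/-- The isometry ψ₀⁻¹ψ of V is the identity on U, and on M up to U. By duality it also preserves the
component in the dual of U, so it is unipotent and has a logarithm. -/
theorem HypIsometry.Lifts.exists_exp (h2 : (2 : k) ≠ 0) {ψ₀ ψ : HypIsometry U M N}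
    (h₀ : ψ₀.Lifts e f) (h : ψ.Lifts e f) :
    ∃ n : NilMaps (TwistedPairs.nodes D) U M,
      ∀ i x, ψ.equiv i x = ψ₀.equiv i (expMap n.map i x) := by
  let g : ∀ i, SDRep.HypV U M i →ₗ[k] SDRep.HypV U M i := fun i =>
    (ψ₀.equiv i).symm.toLinearMap ∘ₗ (ψ.equiv i).toLinearMap
  have hg : ∀ i x, ψ₀.equiv i (g i x) = ψ.equiv i x := fun i x =>
    (ψ₀.equiv i).apply_symm_apply _
  have hgf : ∀ i j x y, SDRep.hypForm U M i j (g i x) (g j y) = SDRep.hypForm U M i j x y :=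
    fun i j x y => by rw [← ψ₀.form_eq, hg, hg, ψ.form_eq]
  have hgl : ∀ i u, g i (u, 0, 0) = (u, 0, 0) := fun i u => by
    apply (ψ₀.equiv i).injective
    rw [hg, h.left, h₀.left]
  have hgm : ∀ i m, ∃ u, g i (0, m, 0) = (u, m, 0) := fun i m => by
    obtain ⟨y, hy, hy'⟩ := h.mid i m
    obtain ⟨z, hz, hz'⟩ := h₀.mid i m
    have h3 : N.reduceMk W i (y - z) = 0 :=
      ((N.reduceMk W i).map_sub y z).trans (sub_eq_zero.2 (hy'.trans hz'.symm))
    have h4 : y.1 - z.1 ∈ W.carrier i := (N.reduceMk_eq_zero W i (y - z)).1 h3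
    let v : W.toRep.V i := ⟨y.1 - z.1, h4⟩
    have hv : ψ₀.equiv i ((e.equiv i).symm v, 0, 0) = y.1 - z.1 := by
      rw [h₀.left, LinearEquiv.apply_symm_apply]
    refine ⟨(e.equiv i).symm v, ?_⟩
    apply (ψ₀.equiv i).injective
    have h5 : (((e.equiv i).symm v, m, 0) : SDRep.HypV U M i) =
        ((e.equiv i).symm v, 0, 0) + (0, m, 0) := by simp
    rw [hg, h5, map_add, hv, ← hy, ← hz, sub_add_cancel]
  -- The component in the dual of U is read off from the form against U, which `g` fixes pointwise.
  have hgr : ∀ i x, (g i x).2.2 = x.2.2 := fun i x => by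
    refine (U.pairing_bijective (σ := σ) (i := i) (j := σ.node i) (σ.node_node i).symm).1 ?_
    refine LinearMap.ext fun u => ?_
    have := hgf i (σ.node i) x (u, 0, 0)
    rw [hgl] at this
    simpa [SDRep.hypForm_apply] using this
  obtain ⟨n, hn⟩ := exists_log h2 (fun i => g i - LinearMap.id)
    (fun i => ⟨fun u => by simp [hgl], fun m => by
      obtain ⟨u, hu⟩ := hgm i m
      simp only [LinearMap.sub_apply, hu]
      simp, fun x => by simp [hgr]⟩)
    (fun i j x y => by simpa using hgf i j x y)
  refine ⟨n, fun i x => ?_⟩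
  rw [hn, ← hg]
  simp

/-- The number of graded isometries that are compatible with given identifications. -/
theorem HypIsometry.card_lifts (h2 : (2 : k) ≠ 0) {W : N.Sub} {hW : N.IsIsotropic W}
    (e : QuiverRep.Iso U W.toRep) (f : SDRep.Isometry M (N.reduce W hW)) :
    Nat.card {ψ : HypIsometry U M N // ψ.Lifts e f} =
      Nat.card (NilMaps (TwistedPairs.nodes D) U M) := by
  obtain ⟨ψ₀, h₀⟩ := HypIsometry.exists_lifts h2 e f
  choose F hF using ψ₀.exists_comp_exp h2
  symm
  -- Once one lift ψ₀ is chosen, every lift is ψ₀ ∘ exp(n) for exactly one n.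
  refine Nat.card_congr (Equiv.ofBijective (fun n => ⟨F n, h₀.comp_exp n (hF n)⟩) ⟨?_, ?_⟩)
  · intro n n' h
    refine expMap_injective fun i x => (ψ₀.equiv i).injective ?_
    have h' : F n = F n' := congrArg Subtype.val h
    rw [← hF, ← hF, h']
  · rintro ⟨ψ, hψ⟩
    obtain ⟨n, hn⟩ := h₀.exists_exp h2 hψ
    refine ⟨n, Subtype.ext (HypIsometry.ext (funext fun i => LinearEquiv.ext fun x => ?_))⟩
    rw [hF, hn]

end Exponential

/-! ### Finiteness of the sets of isomorphisms and isometries -/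

section Finiteness

variable {k : Type u} [Field k] [Finite k] {Q : Type v} [Quiver.{w} Q] [Finite Q]
  {σ : Involution Q} {D : Duality σ}

instance QuiverRep.finite_iso (X Y : QuiverRep k Q) : Finite (QuiverRep.Iso X Y) := by
  have : ∀ (X : QuiverRep k Q) i, Finite (X.V i) := fun X i => Module.finite_of_finite k
  exact Finite.of_injective (fun e : QuiverRep.Iso X Y => fun i x => e.equiv i x) fun _ _ h =>
    QuiverRep.Iso.ext (funext fun i => LinearEquiv.ext fun x => congrFun (congrFun h i) x)

instance SDRep.finite_isometry (M N : SDRep k D) : Finite (SDRep.Isometry M N) :=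
  Finite.of_injective (fun e : SDRep.Isometry M N => e.toIso) fun _ _ h =>
    SDRep.Isometry.ext (congrArg QuiverRep.Iso.equiv h)

instance HypIsometry.finite (U : QuiverRep k Q) (M N : SDRep k D) :
    Finite (HypIsometry U M N) := by
  have : ∀ (X : QuiverRep k Q) i, Finite (X.V i) := fun X i => Module.finite_of_finite k
  have : ∀ i, Finite (SDRep.HypV U M i) := fun i => Module.finite_of_finite k
  exact Finite.of_injective (fun e : HypIsometry U M N => fun i x => e.equiv i x) fun _ _ h =>
    HypIsometry.ext (funext fun i => LinearEquiv.ext fun x => congrFun (congrFun h i) x)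

end Finiteness

/-! ### Isomorphisms and isometries as torsors under automorphism groups -/

section Conjugation

variable {k : Type u} [Field k] {Q : Type v} [Quiver.{w} Q] {σ : Involution Q} {D : Duality σ}

theorem QuiverRep.card_iso (X Y : QuiverRep k Q) (h : RepClass.mk X = RepClass.mk Y) :
    Nat.card (QuiverRep.Iso X Y) = X.cardAut := by
  obtain ⟨e⟩ := RepClass.mk_eq.1 h
  refine Nat.card_congr ⟨fun f => f.trans e.symm, fun f => f.trans e, fun f => ?_, fun f => ?_⟩ <;>
    ext i x <;> simp [Iso.trans, Iso.symm]

theorem SDRep.card_isometry (X Y : SDRep k D) (h : SDClass.mk X = SDClass.mk Y) :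
    Nat.card (SDRep.Isometry X Y) = Y.cardAut := by
  obtain ⟨e⟩ := SDClass.mk_eq.1 h
  refine Nat.card_congr ⟨fun f => e.symm.trans f, fun f => e.trans f, fun f => ?_, fun f => ?_⟩ <;>
    ext i x <;> simp [Isometry.trans, Isometry.symm, QuiverRep.Iso.trans, QuiverRep.Iso.symm]

end Conjugation

/-! ### The double count of adapted isometries -/

section Counting

variable {k : Type u} [Field k] {Q : Type v} [Quiver.{w} Q] {σ : Involution Q} {D : Duality σ}
  {U : QuiverRep k Q} {M : SDRep k D}

/-- The self-dual representation on the orthogonal sum of `M` and of the hyperbolic space on `U`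
obtained by adding a compatible family of maps to the structure maps. -/
noncomputable def NilMaps.deform (n : NilMaps (TwistedPairs.arrows D) U M) : SDRep k D where
  V := SDRep.HypV U M
  map {i j} a := SDRep.hypMap U M a + n.map ⟨i, j, a⟩
  form := SDRep.hypForm U M
  form_orth _ _ := SDRep.hypForm_orth U M
  form_symm := SDRep.hypForm_symm U M
  form_nondeg := SDRep.hypForm_nondeg U M
  form_map a x y := by
    have h1 := SDRep.hypForm_hypMap U M a x y
    have h2 := n.form_map a x y
    rw [LinearMap.add_apply, LinearMap.add_apply, map_add, map_add, LinearMap.add_apply, h1,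
      mul_add]
    exact congrArg _ h2

variable {N : SDRep k D}

/-- A graded isometry is adapted if `U` is embedded as a subrepresentation and `M` is identified
with a subquotient. -/
structure HypIsometry.Adapted (ψ : HypIsometry U M N) : Prop where
  left : ∀ {i j : Q} (a : i ⟶ j) u, N.map a (ψ.equiv i (u, 0, 0)) = ψ.equiv j (U.map a u, 0, 0)
  mid : ∀ {i j : Q} (a : i ⟶ j) m, ∃ u, N.map a (ψ.equiv i (0, m, 0)) =
    ψ.equiv j (u, M.map a m, 0)

variable (U M N) in
/-- Adapted graded isometries correspond to isometries from the deformations of the orthogonal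
sum of `M` and of the hyperbolic representation on `U`. -/
theorem card_adapted : Nat.card {ψ : HypIsometry U M N // ψ.Adapted} =
    Nat.card (Σ n : NilMaps (TwistedPairs.arrows D) U M, SDRep.Isometry n.deform N) := by
  let ψ : ∀ n : NilMaps (TwistedPairs.arrows D) U M, SDRep.Isometry n.deform N →
      HypIsometry U M N := fun n φ => ⟨φ.equiv, φ.form_eq⟩
  have hcomm : ∀ n φ {i j : Q} (a : i ⟶ j) (x : SDRep.HypV U M i),
      N.map a ((ψ n φ).equiv i x) =
        (ψ n φ).equiv j (SDRep.hypMap U M a x + n.map ⟨i, j, a⟩ x) :=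
    fun n φ {i j} a x => (φ.comm a x).symm
  have hψ : ∀ n φ, (ψ n φ).Adapted := fun n φ => by
    refine ⟨fun {i j} a u => ?_, fun {i j} a m => ⟨(n.map ⟨i, j, a⟩ (0, m, 0)).1, ?_⟩⟩
    · rw [hcomm, n.map_left ⟨i, j, a⟩, add_zero, SDRep.hypMap_apply]
      simp
    · have h : n.map ⟨i, j, a⟩ (0, m, 0) = ((n.map ⟨i, j, a⟩ (0, m, 0)).1, 0) :=
        Prod.ext rfl (n.map_mid ⟨i, j, a⟩ m)
      rw [hcomm]
      congr 1
      rw [h, SDRep.hypMap_apply]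
      simp
  symm
  refine Nat.card_congr (Equiv.ofBijective (fun p => ⟨ψ p.1 p.2, hψ p.1 p.2⟩) ⟨?_, ?_⟩)
  · rintro ⟨n, φ⟩ ⟨n', φ'⟩ h
    have h1 : ψ n φ = ψ n' φ' := congrArg Subtype.val h
    -- The deformation is determined by the isometry, being the difference between the transported
    -- structure maps of N and those of the hyperbolic sum.
    obtain rfl : n = n' := NilMaps.ext fun a => LinearMap.ext fun x => by
      have h2 := hcomm n φ a.hom x
      rw [h1, hcomm] at h2
      exact (add_left_cancel ((ψ n' φ').equiv _ |>.injective h2)).symm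
    have h3 : φ.equiv = φ'.equiv := congrArg HypIsometry.equiv h1
    rw [SDRep.Isometry.ext h3]
  · rintro ⟨χ, hχ⟩
    -- Adaptedness says that this difference vanishes on U and maps M to U. Its compatibility with
    -- the form is the difference of the compatibilities for N and for the hyperbolic sum.
    let δ : ∀ a : Quiver.Total Q, SDRep.HypV U M a.left →ₗ[k] SDRep.HypV U M a.right := fun a =>
      (χ.equiv a.right).symm.toLinearMap ∘ₗ N.map a.hom ∘ₗ (χ.equiv a.left).toLinearMap -
        SDRep.hypMap U M a.hom
    have hδ : ∀ a x, χ.equiv a.right (SDRep.hypMap U M a.hom x + δ a x) =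
        N.map a.hom (χ.equiv a.left x) := fun a x => by
      simp [δ]
    have hδ' : ∀ a x y, N.map a.hom (χ.equiv a.left x) = χ.equiv a.right y →
        δ a x = y - SDRep.hypMap U M a.hom x := fun a x y h => by
      rw [← hδ] at h
      rw [← (χ.equiv a.right).injective h, add_sub_cancel_left]
    let n : NilMaps (TwistedPairs.arrows D) U M := by
      refine ⟨δ, fun a u => ?_, fun a m => ?_, fun a x y => ?_⟩
      · rw [hδ' a _ _ (hχ.left a.hom u), SDRep.hypMap_apply]; simp
      · obtain ⟨u, hu⟩ := hχ.mid a.hom m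
        rw [hδ' a _ _ hu, SDRep.hypMap_apply]; simp
      · have h1 := SDRep.hypForm_hypMap U M a x y
        have h2 := N.form_map a (χ.equiv _ x) (χ.equiv _ y)
        rw [← hδ a, ← hδ (σ.arrow a), χ.form_eq, χ.form_eq, map_add, map_add, LinearMap.add_apply,
          h1, mul_add] at h2
        exact add_left_cancel h2
    exact ⟨⟨n, ⟨⟨χ.equiv, fun {i j} a x => hδ ⟨i, j, a⟩ x⟩, χ.form_eq⟩⟩, rfl⟩

variable (U M N) in
/-- Isotropic subrepresentations `W` of `N` with identifications of `U` with `W` and of `M` with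
`N // W`. -/
abbrev IsotropicEmbedding : Type _ :=
  Σ W : {W : N.Sub // N.IsIsotropic W},
    QuiverRep.Iso U W.1.toRep × SDRep.Isometry M (N.reduce W.1 W.2)

/-- The identification of U with W commutes with the structure maps exactly; that of M with N // W
controls them only modulo W, which accounts for the error term in U. -/
theorem HypIsometry.Lifts.adapted {ψ : HypIsometry U M N} {W : N.Sub} {hW : N.IsIsotropic W}
    {e : QuiverRep.Iso U W.toRep} {f : SDRep.Isometry M (N.reduce W hW)} (h : ψ.Lifts e f) :
    ψ.Adapted := by
  refine ⟨fun {i j} a u => ?_, fun {i j} a m => ?_⟩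
  · rw [h.left, h.left, e.comm]; rfl
  · obtain ⟨y, hy, hy'⟩ := h.mid i m
    obtain ⟨z, hz, hz'⟩ := h.mid j (M.map a m)
    let y₂ : (N.perp W).toRep.V j := (N.perp W).toRep.map a y
    have hy₂ : N.reduceMk W j y₂ = f.equiv j (M.map a m) :=
      (congrArg ((N.reduce W hW).map a) hy').trans (f.comm a m).symm
    have h3 : N.reduceMk W j (y₂ - z) = 0 :=
      ((N.reduceMk W j).map_sub y₂ z).trans (sub_eq_zero.2 (hy₂.trans hz'.symm))
    have h4 : y₂.1 - z.1 ∈ W.carrier j := (N.reduceMk_eq_zero W j (y₂ - z)).1 h3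
    let v : W.toRep.V j := ⟨y₂.1 - z.1, h4⟩
    have hv : ψ.equiv j ((e.equiv j).symm v, 0, 0) = y₂.1 - z.1 := by
      rw [h.left, LinearEquiv.apply_symm_apply]
    refine ⟨(e.equiv j).symm v, ?_⟩
    have h5 : (((e.equiv j).symm v, M.map a m, 0) : SDRep.HypV U M j) =
        ((e.equiv j).symm v, 0, 0) + (0, M.map a m, 0) := by simp
    rw [h5, map_add, hv, ← hz, ← hy, sub_add_cancel]
    rfl

/-- Take W = ψ(U). Then W^⊥ = ψ(U ⊕ M), and projection to M identifies W^⊥ / W with M. -/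
theorem HypIsometry.Adapted.exists_lifts {ψ : HypIsometry U M N} (h : ψ.Adapted) :
    ∃ s : IsotropicEmbedding U M N, ψ.Lifts s.2.1 s.2.2 := by
  let ι : ∀ i, U.V i →ₗ[k] N.V i := fun i =>
    (ψ.equiv i).toLinearMap ∘ₗ LinearMap.inl k (U.V i) (M.V i × U.DualV σ i)
  have hι : ∀ i u, ι i u = ψ.equiv i (u, 0, 0) := fun i u => rfl
  have hinj : ∀ i, Function.Injective (ι i) := fun i =>
    (ψ.equiv i).injective.comp LinearMap.inl_injective
  let W : N.Sub := ⟨fun i => LinearMap.range (ι i), by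
    rintro i j a x ⟨u, rfl⟩
    exact ⟨U.map a u, (h.left a u).symm⟩⟩
  have hmem : ∀ i x, ψ.equiv i x ∈ W.carrier i ↔ x.2 = 0 := fun i x => by
    constructor
    · rintro ⟨u, hu⟩
      rw [← (ψ.equiv i).injective hu]; rfl
    · intro hx
      exact ⟨x.1, congrArg (ψ.equiv i) (Prod.ext rfl hx.symm)⟩
  have hW : N.IsIsotropic W := by
    rintro i x ⟨u, rfl⟩ j y ⟨u', rfl⟩
    rw [hι, hι, ψ.form_eq]
    exact SDRep.hypForm_of_snd rfl rfl
  have hperp : ∀ i x, ψ.equiv i x ∈ (N.perp W).carrier i ↔ x.2.2 = 0 := fun i x => by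
    constructor
    · intro hx
      refine (U.pairing_bijective (σ := σ) (i := i) (j := σ.node i) (σ.node_node i).symm).1 ?_
      rw [map_zero]
      refine LinearMap.ext fun u => ?_
      have := hx (σ.node i) (ψ.equiv _ (u, 0, 0)) ⟨u, rfl⟩
      rw [ψ.form_eq] at this
      simpa [SDRep.hypForm_apply] using this
    · rintro hx j y ⟨u, rfl⟩
      rw [hι, ψ.form_eq]
      simp [SDRep.hypForm_apply, hx]
  let e : QuiverRep.Iso U W.toRep := ⟨fun i => LinearEquiv.ofInjective (ι i) (hinj i),
    fun {i j} a u => Subtype.ext (h.left a u).symm⟩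
  let p : ∀ i, (N.perp W).toRep.V i →ₗ[k] M.V i := fun i =>
    LinearMap.fst k _ _ ∘ₗ LinearMap.snd k _ _ ∘ₗ (ψ.equiv i).symm.toLinearMap ∘ₗ
      ((N.perp W).carrier i).subtype
  have hR : ∀ i (r : (N.perp W).toRep.V i), ∃ u, r.1 = ψ.equiv i (u, p i r, 0) := fun i r => by
    have h1 : ψ.equiv i ((ψ.equiv i).symm r.1) ∈ (N.perp W).carrier i := by
      rw [LinearEquiv.apply_symm_apply]; exact r.2
    rw [hperp] at h1
    refine ⟨((ψ.equiv i).symm r.1).1, ?_⟩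
    rw [← LinearEquiv.symm_apply_eq]
    exact Prod.ext rfl (Prod.ext rfl h1)
  have hp : ∀ i (r : (N.perp W).toRep.V i) x, r.1 = ψ.equiv i x → p i r = x.2.1 := by
    intro i r x hr
    have : (ψ.equiv i).symm r.1 = x := by rw [hr, LinearEquiv.symm_apply_apply]
    exact congrArg (fun z => z.2.1) this
  have hq : ∀ i m, ∃ r : (N.perp W).toRep.V i, r.1 = ψ.equiv i (0, m, 0) := fun i m =>
    ⟨⟨ψ.equiv i (0, m, 0), (hperp i _).2 rfl⟩, rfl⟩
  -- The projections of W^⊥ to M and to W^⊥ / W are surjective morphisms with the same kernel W.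
  obtain ⟨f, hf⟩ := QuiverRep.exists_iso (R := (N.perp W).toRep) (X := M.toQuiverRep)
    (Y := (N.reduce W hW).toQuiverRep) p (fun i => N.reduceMk W i)
    (fun i m => by
      obtain ⟨r, hr⟩ := hq i m
      exact ⟨r, hp i r _ hr⟩)
    (fun i => N.reduceMk_surjective W i)
    (fun i r => by
      refine Iff.trans ?_ (N.reduceMk_eq_zero W i r).symm
      obtain ⟨u, hu⟩ := hR i r
      rw [hu, hmem]
      exact ⟨fun h => Prod.ext h rfl, fun h => congrArg Prod.fst h⟩)
    (fun {i j} a r => by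
      obtain ⟨u, hu⟩ := hR i r
      have h5 : ((u, p i r, 0) : SDRep.HypV U M i) = (u, 0, 0) + (0, p i r, 0) := by simp
      obtain ⟨u', hu'⟩ := h.mid a (p i r)
      have h6 : ((N.perp W).toRep.map a r).1 =
          ψ.equiv j ((U.map a u, 0, 0) + (u', M.map a (p i r), 0)) := by
        show N.map a r.1 = _
        rw [hu, h5, map_add, map_add, h.left, hu', map_add]
      rw [hp j _ _ h6]
      simp)
    (fun a r => rfl)
  have hmk : ∀ i m (r : (N.perp W).toRep.V i), r.1 = ψ.equiv i (0, m, 0) →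
      f.equiv i m = N.reduceMk W i r := fun i m r hr =>
    (congrArg (f.equiv i) (hp i r _ hr)).symm.trans (hf i r)
  let F : SDRep.Isometry M (N.reduce W hW) := ⟨f, fun i j x y => by
    obtain ⟨r, hr⟩ := hq i x
    obtain ⟨s, hs⟩ := hq j y
    have h3 : (N.reduce W hW).form i j (f.equiv i x) (f.equiv j y) = N.form i j r.1 s.1 :=
      congrArg₂ (fun a b => N.reduceForm W i j a b) (hmk i x r hr) (hmk j y s hs)
    rw [h3, hr, hs, ψ.form_eq]
    simp [SDRep.hypForm_apply]⟩
  have hF : ψ.Lifts e F := ⟨fun i u => rfl, fun i m => by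
    obtain ⟨r, hr⟩ := hq i m
    exact ⟨r, hr, (hmk i m r hr).symm⟩⟩
  exact ⟨⟨⟨W, hW⟩, e, F⟩, hF⟩

/-- Everything is read off from ψ: W is ψ(U), the isomorphism is the restriction of ψ to U, and the
isometry sends m to the class of ψ(m). -/
theorem HypIsometry.Lifts.unique {ψ : HypIsometry U M N} {s s' : IsotropicEmbedding U M N}
    (h : ψ.Lifts s.2.1 s.2.2) (h' : ψ.Lifts s'.2.1 s'.2.2) : s = s' := by
  obtain ⟨⟨W, hW⟩, e, f⟩ := s
  obtain ⟨⟨W', hW'⟩, e', f'⟩ := s'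
  have hmem : ∀ {W : N.Sub} {hW : N.IsIsotropic W} {e : QuiverRep.Iso U W.toRep}
      {f : SDRep.Isometry M (N.reduce W hW)} (_ : ψ.Lifts e f) i x,
      x ∈ W.carrier i ↔ ∃ u, ψ.equiv i (u, 0, 0) = x := by
    intro W hW e f h i x
    constructor
    · intro hx
      let v : W.toRep.V i := ⟨x, hx⟩
      exact ⟨(e.equiv i).symm v, by rw [h.left, LinearEquiv.apply_symm_apply]⟩
    · rintro ⟨u, rfl⟩
      rw [h.left]; exact (e.equiv i u).2
  obtain rfl : W = W' := by
    ext i x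
    rw [hmem h, hmem h']
  obtain rfl : e = e' := by
    refine QuiverRep.Iso.ext (funext fun i => LinearEquiv.ext fun u => Subtype.ext ?_)
    exact (h.left i u).symm.trans (h'.left i u)
  obtain rfl : f = f' := by
    refine SDRep.Isometry.ext (funext fun i => LinearEquiv.ext fun m => ?_)
    obtain ⟨y, hy, hy'⟩ := h.mid i m
    obtain ⟨z, hz, hz'⟩ := h'.mid i m
    obtain rfl : y = z := Subtype.ext (hy.trans hz.symm)
    exact hy'.symm.trans hz'
  rfl

variable [Finite k] [Finite Q]

-- Adapted isometries are partitioned by the embedding that they lift, and all parts have the size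
-- given by `HypIsometry.card_lifts`.
variable (U M N) in
theorem card_adapted_eq_mul (h2 : (2 : k) ≠ 0) :
    Nat.card {ψ : HypIsometry U M N // ψ.Adapted} =
      Nat.card (IsotropicEmbedding U M N) * Nat.card (NilMaps (TwistedPairs.nodes D) U M) := by
  have hb : Function.Bijective
      (fun p : (Σ s : IsotropicEmbedding U M N, {ψ : HypIsometry U M N // ψ.Lifts s.2.1 s.2.2}) =>
        (⟨p.2.1, p.2.2.adapted⟩ : {ψ : HypIsometry U M N // ψ.Adapted})) := by
    constructor
    · rintro ⟨s, ψ, hψ⟩ ⟨s', ψ', hψ'⟩ h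
      obtain rfl : ψ = ψ' := congrArg Subtype.val h
      obtain rfl : s = s' := hψ.unique hψ'
      rfl
    · rintro ⟨ψ, hψ⟩
      obtain ⟨s, hs⟩ := hψ.exists_lifts
      exact ⟨⟨s, ψ, hs⟩, rfl⟩
  have := Fintype.ofFinite (IsotropicEmbedding U M N)
  rw [← Nat.card_congr (Equiv.ofBijective _ hb), Nat.card_sigma]
  simp only [HypIsometry.card_lifts h2]
  rw [Finset.sum_const, Finset.card_univ, smul_eq_mul,
    Nat.card_eq_fintype_card (α := IsotropicEmbedding U M N)]

-- A subrepresentation counted by the Hall number carries #Aut(U) #Aut_S(M) pairs of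
-- identifications, and any other isotropic subrepresentation carries none.
variable (U M N) in
theorem card_isotropicEmbedding : Nat.card (IsotropicEmbedding U M N) =
    SDRep.hallNumber (RepClass.mk U) (SDClass.mk M) N * (U.cardAut * M.cardAut) := by
  classical
  have := Fintype.ofFinite {W : N.Sub // N.IsIsotropic W}
  have h1 : SDRep.hallNumber (RepClass.mk U) (SDClass.mk M) N =
      Nat.card {W : {W : N.Sub // N.IsIsotropic W} // RepClass.mk W.1.toRep = RepClass.mk U ∧
        SDClass.mk (N.reduce W.1 W.2) = SDClass.mk M} :=
    Nat.card_congr ⟨fun W => ⟨⟨W.1, W.2.2.1⟩, W.2.1, W.2.2.2⟩,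
      fun W => ⟨W.1.1, W.2.1, W.1.2, W.2.2⟩, fun _ => rfl, fun _ => rfl⟩
  have h3 : ∀ W : {W : N.Sub // N.IsIsotropic W},
      Nat.card (QuiverRep.Iso U W.1.toRep × SDRep.Isometry M (N.reduce W.1 W.2)) =
        if RepClass.mk W.1.toRep = RepClass.mk U ∧ SDClass.mk (N.reduce W.1 W.2) = SDClass.mk M
        then U.cardAut * M.cardAut else 0 := fun W => by
    rw [Nat.card_prod]
    split_ifs with h
    · rw [QuiverRep.card_iso _ _ h.1.symm, SDRep.card_isometry _ _ h.2.symm]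
      congr 1
      obtain ⟨e⟩ := SDClass.mk_eq.1 h.2
      exact Nat.card_congr e.conj
    · rw [mul_eq_zero]
      rcases not_and_or.1 h with h | h
      · left
        have : IsEmpty (QuiverRep.Iso U W.1.toRep) :=
          ⟨fun e => h (RepClass.mk_eq.2 ⟨e⟩).symm⟩
        exact Nat.card_of_isEmpty
      · right
        have : IsEmpty (SDRep.Isometry M (N.reduce W.1 W.2)) :=
          ⟨fun e => h (SDClass.mk_eq.2 ⟨e⟩).symm⟩
        exact Nat.card_of_isEmpty
  rw [Nat.card_sigma, h1, Nat.card_eq_fintype_card, Fintype.card_subtype]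
  simp only [h3]
  rw [← Finset.sum_filter, Finset.sum_const, smul_eq_mul]

theorem cardAut_pos (N : SDRep k D) : 0 < N.cardAut :=
  Nat.card_pos_iff.2 ⟨⟨SDRep.Isometry.refl N⟩, inferInstance⟩

theorem QuiverRep.cardAut_pos (X : QuiverRep k Q) : 0 < X.cardAut :=
  Nat.card_pos_iff.2 ⟨⟨QuiverRep.Iso.refl X⟩, inferInstance⟩

-- The two sides are the two counts of adapted isometries: by embeddings and their lifts, and by
-- deformations.
variable (U M N) in
theorem hallNumber_mul_eq_sum (h2 : (2 : k) ≠ 0) [Fintype (NilMaps (TwistedPairs.arrows D) U M)] :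
    SDRep.hallNumber (RepClass.mk U) (SDClass.mk M) N * (U.cardAut * M.cardAut) *
      Nat.card (NilMaps (TwistedPairs.nodes D) U M) =
    ∑ n : NilMaps (TwistedPairs.arrows D) U M, Nat.card (SDRep.Isometry n.deform N) := by
  rw [← card_isotropicEmbedding, ← card_adapted_eq_mul U M N h2, card_adapted, Nat.card_sigma]

variable (U M) in
/-- The sum of the self-dual Hall numbers, weighted by the orders of the isometry groups. -/
theorem sum_hallNumber_div (h2 : (2 : k) ≠ 0) [Finite (NilMaps (TwistedPairs.arrows D) U M)]
    (S : Finset (SDClass k D))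
    (hS : ∀ n, SDClass.hallNumber (RepClass.mk U) (SDClass.mk M) n ≠ 0 → n ∈ S) :
    (∑ n ∈ S, (SDClass.hallNumber (RepClass.mk U) (SDClass.mk M) n : ℚ) / n.cardAut) *
      ((U.cardAut * M.cardAut) * Nat.card (NilMaps (TwistedPairs.nodes D) U M)) =
    Nat.card (NilMaps (TwistedPairs.arrows D) U M) := by
  classical
  have := Fintype.ofFinite (NilMaps (TwistedPairs.arrows D) U M)
  -- The isometries from a deformation to N are either absent or as many as the self-isometries of
  -- N. After division by #Aut_S(N), the term of N thus counts the deformations isometric to N.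
  have hterm : ∀ n : SDClass k D,
      (SDClass.hallNumber (RepClass.mk U) (SDClass.mk M) n : ℚ) / n.cardAut *
        ((U.cardAut * M.cardAut) * Nat.card (NilMaps (TwistedPairs.nodes D) U M)) =
      ∑ r : NilMaps (TwistedPairs.arrows D) U M, if SDClass.mk r.deform = n then 1 else 0 := by
    intro n
    induction n using Quotient.inductionOn with
    | h N =>
      have h1 : (SDRep.hallNumber (RepClass.mk U) (SDClass.mk M) N : ℚ) *
          (U.cardAut * M.cardAut) * Nat.card (NilMaps (TwistedPairs.nodes D) U M) =
          ∑ r : NilMaps (TwistedPairs.arrows D) U M,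
            (Nat.card (SDRep.Isometry r.deform N) : ℚ) := by
        exact_mod_cast hallNumber_mul_eq_sum U M N h2
      have h3 : (N.cardAut : ℚ) ≠ 0 := by exact_mod_cast (cardAut_pos N).ne'
      show (SDRep.hallNumber (RepClass.mk U) (SDClass.mk M) N : ℚ) / N.cardAut * _ = _
      rw [div_mul_eq_mul_div, ← mul_assoc, h1, Finset.sum_div]
      refine Finset.sum_congr rfl fun r _ => ?_
      split_ifs with h
      · rw [SDRep.card_isometry _ _ h, div_self h3]
      · have : IsEmpty (SDRep.Isometry r.deform N) := ⟨fun e => h (SDClass.mk_eq.2 ⟨e⟩)⟩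
        rw [Nat.card_of_isEmpty, Nat.cast_zero, zero_div]
  rw [Finset.sum_mul]
  simp only [hterm]
  rw [Finset.sum_comm]
  -- The class of every deformation is in `S`: a zero Hall number would make the count in `hterm`
  -- zero, but the deformation itself contributes 1.
  have hone : ∀ r : NilMaps (TwistedPairs.arrows D) U M,
      ∑ n ∈ S, (if SDClass.mk r.deform = n then (1 : ℚ) else 0) = 1 := fun r => by
    rw [Finset.sum_ite_eq, if_pos]
    refine hS _ fun h0 => ?_
    have h := hterm (SDClass.mk r.deform)
    rw [h0, Nat.cast_zero, zero_div, zero_mul] at h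
    have h4 := (Finset.sum_eq_zero_iff_of_nonneg (fun _ _ => by split_ifs <;> norm_num)).1
      h.symm r (Finset.mem_univ _)
    rw [if_pos rfl] at h4
    exact one_ne_zero h4
  simp only [hone]
  rw [Finset.sum_const, Finset.card_univ, nsmul_eq_mul, mul_one, Nat.card_eq_fintype_card]

end Counting

/-! ### Comparison of the exponents with the Euler forms -/

section Exponents

/-- The halves in the first sum are exact, since x(x ± 1) is even; `hR` then forces the second sum
to be even as well. This turns a doubled exponent from `card_nilMaps` into the shape used by
`sdEuler`. -/
theorem sum_half_add_half {ι : Type*} [Fintype ι] (p : ι → Prop) [DecidablePred p]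
    (x y : ι → ℤ) (ε : ι → ℤˣ) (hxy : ∀ i, p i → y i = x i) (R : ℤ)
    (hR : 2 * R = ∑ i, y i * x i + ∑ i with p i, (ε i : ℤ) * x i) :
    ∑ i with p i, x i * (x i + ε i) / 2 + (∑ i with ¬ p i, y i * x i) / 2 = R := by
  have h1 : ∀ i, 2 * (x i * (x i + ε i) / 2) = x i * (x i + ε i) := fun i => by
    refine Int.mul_ediv_cancel' ?_
    rcases Int.units_eq_one_or (ε i) with h | h <;> rw [h]
    · exact (Int.even_mul_succ_self (x i)).two_dvd
    · exact (Int.even_mul_pred_self (x i)).two_dvd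
  have h3 : 2 * ∑ i with p i, x i * (x i + ε i) / 2 =
      ∑ i with p i, y i * x i + ∑ i with p i, (ε i : ℤ) * x i := by
    rw [Finset.mul_sum, ← Finset.sum_add_distrib]
    refine Finset.sum_congr rfl fun i hi => ?_
    rw [h1, hxy i (Finset.mem_filter.1 hi).2]; ring
  have h4 := Finset.sum_filter_add_sum_filter_not Finset.univ p (fun i => y i * x i)
  omega

variable {Q : Type v} [Quiver.{w} Q] [Fintype Q] [Fintype (Quiver.Total Q)] {σ : Involution Q}

-- The numbers `R` and `R'` are the exponents of the blocks U^∨ → U over the nodes and over the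
-- arrows, so ℰ measures the difference of the two counts.
open Classical in
theorem sdEuler_eq_sub (D : Duality σ) (d : Q → ℤ) (R R' : ℤ)
    (hR : 2 * R = ∑ i, d (σ.node i) * d i +
      ∑ i with σ.node i = i, ((-1 : ℤˣ) * D.s i : ℤ) * d i)
    (hR' : 2 * R' = ∑ a : Quiver.Total Q, d (σ.node a.left) * d a.right +
      ∑ a : Quiver.Total Q with σ.arrow a = a, (D.τ a * D.s a.right : ℤ) * d a.right) :
    sdEuler D d = R - R' := by
  have h1 := sum_half_add_half (fun i => σ.node i = i) d (fun i => d (σ.node i)) (fun i => - D.s i)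
    (fun i hi => by rw [hi]) R (by rw [hR]; simp)
  have h2 := sum_half_add_half (fun a : Quiver.Total Q => σ.arrow a = a) (fun a => d a.right)
    (fun a => d (σ.node a.left)) (fun a => D.τ a * D.s a.right)
    (fun a ha => by rw [← σ.right_arrow, ha]) R' (by rw [hR']; simp)
  rw [← h1, ← h2, sdEuler]
  simp only [Units.val_neg, Units.val_mul, sub_eq_add_neg, neg_add, ne_eq, add_assoc]

/-- Applying `sdEuler_add` twice to d + σ(d) + e gives ℰ(d) + ℰ(σ(d)) + ℰ(e) + χ(d, d) + χ(d, e) +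
χ(e, d), because σ reverses χ and fixes e. Subtracting the exponent of the action leaves the even
term, which the weighted sum of Hall numbers cancels. -/
theorem exponent_eq [DecidableEq Q] (D : Duality σ) (d : Q → ℕ) (e : SymDim σ) :
    sdEuler D (toInt (SymDim.hyp σ d + e).val) =
      euler (toInt d) (toInt d) + sdEuler D (toInt e.val) + actExp D d e +
        2 * (euler (toInt e.val) (toInt d) + sdEuler D (toInt d)) := by
  have h0 : toInt (SymDim.hyp σ d + e).val =
      (toInt d + toInt fun i => d (σ.node i)) + toInt e.val := by
    rw [← toInt_hyp]; exact toInt_add _ _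
  have h1 : (fun i => (toInt d + toInt fun i => d (σ.node i)) (σ.node i)) =
      toInt d + toInt fun i => d (σ.node i) := by
    funext i
    simp only [Pi.add_apply, toInt, σ.node_node]
    ring
  have h2 := euler_node σ (toInt d) (toInt d)
  have h3 := euler_node σ (toInt d) (toInt e.val)
  have h4 : (fun i => toInt e.val (σ.node i)) = toInt e.val := by
    funext i; simp [toInt, e.val_node]
  have h5 : (fun i => toInt d (σ.node i)) = toInt fun i => d (σ.node i) := rfl
  rw [h4] at h3
  rw [h0, sdEuler_add, sdEuler_add, h1, euler_add_left]
  rw [h5] at h2 h3 ⊢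
  rw [h2, h3, actExp, skew]
  ring

end Exponents

/-! ### Rational scalars on the quantum torus and its module -/

section Scalars

variable {k : Type u} {Q : Type v}

theorem QTorus.rat_smul_def (c : ℚ) (f : QTorus k Q) :
    c • f = algebraMap ℚ (HalfField (Nat.card k)) c • f := rfl

theorem QModule.rat_smul_def [Quiver.{w} Q] {σ : Involution Q} {D : Duality σ} (c : ℚ)
    (g : QModule k D) : c • g = algebraMap ℚ (HalfField (Nat.card k)) c • g := rfl

end Scalars

/-! ### The integration maps on basis elements -/

section Basis

variable {k : Type u} [Field k] {Q : Type v} [Quiver.{w} Q] [Fintype Q]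
  [Fintype (Quiver.Total Q)] {σ : Involution Q} {D : Duality σ}

theorem HallAlgebra.intH_of (u : RepClass k Q) : intH (HallAlgebra.of u) =
    (sqrtq (Nat.card k) ^ euler (toInt u.dim) (toInt u.dim) /
      (u.cardAut : HalfField (Nat.card k))) • (QTorus.x u.dim : QTorus k Q) := by
  unfold intH HallAlgebra.of
  erw [Finsupp.linearCombination_single, one_smul]

theorem HallModule.intM_of (m : SDClass k D) : intM D (HallModule.of m) =
    (sqrtq (Nat.card k) ^ sdEuler D (toInt m.dim.val) /
      (m.cardAut : HalfField (Nat.card k))) • (QModule.ξ m.dim : QModule k D) := by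
  unfold intM HallModule.of
  erw [Finsupp.linearCombination_single, one_smul]

end Basis

/-! ### The weighted sum of Hall numbers and the identity on basis elements -/

section Main

variable {k : Type u} [Field k] [Finite k] {Q : Type v} [Quiver.{w} Q] [Fintype Q]
  [Fintype (Quiver.Total Q)] {σ : Involution Q} {D : Duality σ}

theorem sqrtq_sq (q : ℕ) : sqrtq q ^ (2 : ℤ) = (q : HalfField q) := by
  refine Subtype.ext ?_
  have h : ((sqrtq q ^ (2 : ℤ) : HalfField q) : ℝ) = Real.sqrt q ^ 2 := rfl
  rw [h, Real.sq_sqrt (Nat.cast_nonneg q)]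
  rfl

theorem natCast_pow_eq_sqrtq (q n : ℕ) : (((q ^ n : ℕ)) : HalfField q) = sqrtq q ^ (2 * n : ℤ) := by
  rw [zpow_mul, sqrtq_sq, zpow_natCast, Nat.cast_pow]

/-- The weighted sum of the self-dual Hall numbers as a power of `q^{1/2}`. -/
theorem sum_hallNumber_div_eq (h2 : (2 : k) ≠ 0) (U : QuiverRep k Q) (M : SDRep k D)
    (S : Finset (SDClass k D))
    (hS : ∀ n, SDClass.hallNumber (RepClass.mk U) (SDClass.mk M) n ≠ 0 → n ∈ S) :
    (∑ n ∈ S, (SDClass.hallNumber (RepClass.mk U) (SDClass.mk M) n : HalfField (Nat.card k)) /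
      n.cardAut) = sqrtq (Nat.card k) ^
        (-(2 * (euler (toInt M.dim) (toInt U.dim) + sdEuler D (toInt U.dim)))) /
        (U.cardAut * M.cardAut) := by
  have hq : Nat.card k ≠ 0 := card_ne_zero k
  have hr := sqrtq_ne_zero hq
  obtain ⟨R, hR, hR'⟩ := card_nilMaps (TwistedPairs.nodes D) U M h2
  obtain ⟨R₁, hR₁, hR₁'⟩ := card_nilMaps (TwistedPairs.arrows D) U M h2
  -- `Nat.card` is 0 on infinite types, so a nonzero cardinality gives finiteness.
  have : Finite (NilMaps (TwistedPairs.arrows D) U M) :=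
    Nat.finite_of_card_ne_zero (by rw [hR₁]; exact pow_ne_zero _ hq)
  have hE : sdEuler D (toInt U.dim) = R - R₁ := sdEuler_eq_sub D _ _ _ hR' hR₁'
  have hsum := congrArg (algebraMap ℚ (HalfField (Nat.card k))) (sum_hallNumber_div U M h2 S hS)
  simp only [map_mul, map_sum, map_div₀, map_natCast, hR, hR₁] at hsum
  rw [natCast_pow_eq_sqrtq, natCast_pow_eq_sqrtq] at hsum
  have hU : (U.cardAut : HalfField (Nat.card k)) ≠ 0 := by
    exact_mod_cast (QuiverRep.cardAut_pos U).ne'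
  have hM : (M.cardAut : HalfField (Nat.card k)) ≠ 0 := by
    exact_mod_cast (cardAut_pos M).ne'
  rw [eq_div_iff (mul_ne_zero hU hM)]
  -- The number of node families is cancelled. In the quotient, the free blocks contribute -χ(dim M,
  -- dim U) and the symmetric blocks -ℰ(dim U), doubled in the exponent of q^{1/2}.
  refine mul_right_cancel₀ (zpow_ne_zero _ hr) ((mul_assoc _ _ _).trans (hsum.trans ?_))
  rw [← zpow_add₀ hr, hE, euler]
  congr 1
  simp only [toInt]
  push_cast
  ring

variable [DecidableEq Q]

theorem QModule.smul_smul_smul (c d : HalfField (Nat.card k)) (f : QTorus k Q)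
    (g : QModule k D) : (c • f) • (d • g) = (c * d) • (f • g) := by
  funext n
  show _ = (c * d) * (f • g) n
  rw [QModule.smul_apply, QModule.smul_apply, Finset.mul_sum]
  refine Finset.sum_congr rfl fun i _ => ?_
  show _ * (c * f i) * (d * g _) = _
  ring

/-- All classes in the product share one dimension vector, so both sides are multiples of a single
ξ; the coefficients agree by `sum_hallNumber_div_eq` and `exponent_eq`. -/
theorem intM_of_smul_of (h2 : (2 : k) ≠ 0) (u : RepClass k Q) (m : SDClass k D) :
    intM D (HallAlgebra.of u • HallModule.of m) =
      intH (HallAlgebra.of u) • intM D (HallModule.of m) := by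
  have hr := sqrtq_ne_zero (card_ne_zero k)
  obtain ⟨S, hS, hsum⟩ := HallModule.ofSMul_eq_sum u m
  rw [HallModule.of_smul_of, hsum, map_sum, HallAlgebra.intH_of, HallModule.intM_of,
    QModule.smul_smul_smul, QModule.x_smul_ξ, smul_smul]
  have hterm : ∀ n ∈ S, intM D ((SDClass.hallNumber u m n : ℚ) • HallModule.of n) =
      (sqrtq (Nat.card k) ^ sdEuler D (toInt (SymDim.hyp σ u.dim + m.dim).val) *
        ((SDClass.hallNumber u m n : HalfField (Nat.card k)) / n.cardAut)) •
      (QModule.ξ (SymDim.hyp σ u.dim + m.dim) : QModule k D) := fun n _ => by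
    rw [map_smul, HallModule.intM_of, QModule.rat_smul_def, smul_smul, map_natCast]
    -- The dimension vector of `n` is known only when the Hall number is nonzero; otherwise both
    -- sides are zero.
    by_cases h : SDClass.hallNumber u m n = 0
    · rw [h]; simp
    · rw [SDClass.dim_of_hallNumber_ne_zero h]
      congr 1
      ring
  rw [Finset.sum_congr rfl hterm, ← Finset.sum_smul, ← Finset.mul_sum]
  congr 1
  induction u using Quotient.inductionOn with
  | h U =>
    induction m using Quotient.inductionOn with
    | h M =>
      have h1 := sum_hallNumber_div_eq h2 U M S hS
      refine (congrArg _ h1).trans ?_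
      rw [exponent_eq]
      show _ = sqrtq (Nat.card k) ^ euler (toInt U.dim) (toInt U.dim) /
        (U.cardAut : HalfField (Nat.card k)) * (sqrtq (Nat.card k) ^ sdEuler D (toInt M.dim) /
          (M.cardAut : HalfField (Nat.card k))) * _
      rw [div_mul_div_comm, div_mul_eq_mul_div, mul_div_assoc', ← zpow_add₀ hr, ← zpow_add₀ hr,
        ← zpow_add₀ hr]
      congr 2
      show euler (toInt U.dim) (toInt U.dim) + sdEuler D (toInt M.dim) + actExp D U.dim _ +
        2 * (euler (toInt M.dim) (toInt U.dim) + sdEuler D (toInt U.dim)) + _ =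
          euler (toInt U.dim) (toInt U.dim) + sdEuler D (toInt M.dim) + actExp D U.dim _
      ring

end Main

end SelfDualQuiver

/-- The Hall module integration map is a morphism over the Hall algebra integration map. -/
theorem mainTheorem3 (k : Type u) [Field k] [Finite k] (hk : ringChar k ≠ 2)
    (Q : Type v) [Quiver.{w} Q] [Fintype Q] [DecidableEq Q] [Fintype (Quiver.Total Q)]
    (σ : Involution Q) (D : Duality σ) (a : HallAlgebra k Q) (m : HallModule k D) :
    intM D (a • m) = intH a • intM D m := by
  have h2 : (2 : k) ≠ 0 := Ring.two_ne_zero hk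
  -- Both sides are additive in each variable and compatible with rational scalars, which reduces
  -- the claim to basis elements.
  induction a using HallAlgebra.induction with
  | h0 => rw [zero_smul, map_zero, map_zero, zero_smul]
  | hadd a b ha hb => rw [add_smul, map_add, map_add, add_smul, ha, hb]
  | hsmul c u =>
    induction m using HallModule.induction with
    | h0 => rw [smul_zero, map_zero, smul_zero]
    | hadd m n hm hn => rw [smul_add, map_add, map_add, smul_add, hm, hn]
    | hsmul d m =>
      have h1 : (c • HallAlgebra.of u) • (d • HallModule.of m : HallModule k D) =
          (c * d) • (HallAlgebra.of u • HallModule.of m : HallModule k D) := by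
        simp only [HallModule.smul_def, map_smul, LinearMap.smul_apply, smul_smul, mul_comm]
      rw [h1, (intM D).map_smul, (intM D).map_smul, intH.map_smul, intM_of_smul_of h2,
        QTorus.rat_smul_def, QModule.rat_smul_def, QModule.rat_smul_def, QModule.smul_smul_smul, map_mul]
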